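/- Empirical bootstrap for hyperrectangles. Let $n\ge 4$, $p\ge 3$, and let $X_1,\dots,X_n$ be independent centered random vectors in $\mathbb{R}^p$ whose coordinates $X_{ij}$ have finite second moments. Let $Y_1,\dots,Y_n$ be independent Gaussian vectors with $Y_i\sim N(0,\mathrm{E}[X_iX_i'])$, and $S_n^Y=n^{-1/2}\sum_{i=1}^n Y_i$. Given $X_1^n=\{X_1,\dots,X_n\}$, let $X_1^*,\dots,X_n^*$ be i.i.d. draws from the empirical distribution $n^{-1}\sum_{i=1}^n\delta_{X_i}$, let $\bar X=n^{-1}\sum_{i=1}^n X_i$ and $S_n^{X^*}=n^{-1/2}\sum_{i=1}^n (X_i^*-\bar X)$. Let $\mathcal{A}^{\mathrm{re}}$ be the class of all sets $\{w\in\mathbb{R}^p: a_j\le w_j\le b_j,\ j=1,\dots,p\}$ with $-\infty\le a_j\le b_j\le\infty$, and put $$\rho_n^{EB}(\mathcal{A}^{\mathrm{re}})=\sup_{A\in\mathcal{A}^{\mathrm{re}}}\bigl|\Pr(S_n^{X^*}\in A\mid X_1^n)-\Pr(S_n^Y\in A)\bigr|.$$ Let $b,q>0$, $B_n\ge 1$,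 $\alpha\in(0,e^{-1})$, and let $K$ be a constant with $\log(1/\alpha)\le K\log(pn)$. Assume (M.1) $n^{-1}\sum_{i=1}^n \mathrm{E}[X_{ij}^2]\ge b$ for all $j=1,\dots,p$; (M.2) $n^{-1}\sum_{i=1}^n \mathrm{E}[|X_{ij}|^{2+k}]\le B_n^k$ for all $j=1,\dots,p$ and $k=1,2$. Consider the conditions (E.1) $\mathrm{E}[\exp(|X_{ij}|/B_n)]\le 2$ for all $i=1,\dots,n$ and $j=1,\dots,p$; (E.2) $\mathrm{E}[(\max_{1\le j\le p}|X_{ij}|/B_n)^q]\le 2$ for all $i=1,\dots,n$; and the quantities $$D_n^{(1)}=\left(\frac{B_n^2\log^7(pn)}{n}\right)^{1/6},\qquad D_{n,q}^{(2)}(\alpha)=\left(\frac{B_n^2\log^3(pn)}{\alpha^{2/q}n^{1-2/q}}\right)^{1/3}.$$ Then under (E.1), with probability at least $1-\alpha$, $$\rho_n^{EB}(\mathcal{A}^{\mathrm{re}})\le C D_n^{(1)},$$ where the constant $C$ depends only on $b$ and $K$; while under (E.2), with probability at least $1-\alpha$, $$\rho_n^{EB}(\mathcal{A}^{\mathrm{re}})\le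 C\{D_n^{(1)}+D_{n,q}^{(2)}(\alpha)\},$$ where the constant $C$ depends only on $b$, $q$ and $K$. -/

import Mathlib

open MeasureTheory ProbabilityTheory
open scoped ENNReal

noncomputable section

namespace HDBootstrap

/-- The class of all hyperrectangles `{w : a j ≤ w j ≤ b j for all j}` in `ℝ^p`, where the end
points satisfy `-∞ ≤ a j ≤ b j ≤ ∞`. -/
def hyperrectangles (p : ℕ) : Set (Set (Fin p → ℝ)) :=
  {A | ∃ a b : Fin p → EReal, (∀ j, a j ≤ b j) ∧
    A = {w | ∀ j, a j ≤ (w j : EReal) ∧ (w j : EReal) ≤ b j}}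

/-- The normalized sum `n^{-1/2} ∑ i, x i`. -/
def normalizedSum {n p : ℕ} (x : Fin n → Fin p → ℝ) : Fin p → ℝ :=
  fun j => (∑ i, x i j) / Real.sqrt n

/-- The sample mean `n^{-1} ∑ i, x i`. -/
def sampleMean {n p : ℕ} (x : Fin n → Fin p → ℝ) : Fin p → ℝ :=
  fun j => (∑ i, x i j) / n

/-- The empirical distribution `n^{-1} ∑ i, δ_{x i}` of the points `x 1, …, x n`. -/
def empiricalMeasure {n p : ℕ} (x : Fin n → Fin p → ℝ) : Measure (Fin p → ℝ) :=
  (n : ℝ≥0∞)⁻¹ • ∑ i, Measure.dirac (x i)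

/-- The conditional law of the bootstrap sample `(X*_1, …, X*_n)` given that the data equal `x`:
`n` i.i.d. draws from the empirical distribution of `x`. -/
def bootstrapSampleLaw {n p : ℕ} (x : Fin n → Fin p → ℝ) : Measure (Fin n → Fin p → ℝ) :=
  Measure.pi fun _ : Fin n => empiricalMeasure x

/-- `Pr(n^{-1/2} ∑ i, (X*_i - X̄) ∈ A | X_1^n)` at the data `X_1^n = x`. -/
def bootstrapProb {n p : ℕ} (x : Fin n → Fin p → ℝ) (A : Set (Fin p → ℝ)) : ℝ :=
  (bootstrapSampleLaw x).real {xs | normalizedSum (fun i => xs i - sampleMean x) ∈ A}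

/-- The empirical bootstrap error at the data `x`,
`sup_{A ∈ 𝒜} |Pr(S_n^{X*} ∈ A | X_1^n = x) - Pr(S_n^Y ∈ A)|`. -/
def rhoEB {n p : ℕ} {Ω' : Type*} [MeasurableSpace Ω'] (Q : Measure Ω')
    (Y : Fin n → Ω' → Fin p → ℝ) (𝒜 : Set (Set (Fin p → ℝ))) (x : Fin n → Fin p → ℝ) : ℝ :=
  ⨆ A : 𝒜, |bootstrapProb x A - Q.real {ω' | normalizedSum (fun i => Y i ω') ∈ (A : Set _)}|

/-- `X_1, …, X_n` are independent centered random vectors in `ℝ^p` whose coordinates have finite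
second moments. -/
structure IsCenteredSample {n p : ℕ} {Ω : Type*} [MeasurableSpace Ω] (P : Measure Ω)
    (X : Fin n → Ω → Fin p → ℝ) : Prop where
  measurable : ∀ i, Measurable (X i)
  indep : iIndepFun X P
  memLp_two : ∀ i j, MemLp (fun ω => X i ω j) 2 P
  centered : ∀ i j, ∫ ω, X i ω j ∂P = 0

/-- `Y_1, …, Y_n` are independent with `Y_i ∼ N(0, E[X_i X_i'])`. -/
structure IsGaussianAnalogue {n p : ℕ} {Ω Ω' : Type*} [MeasurableSpace Ω] [MeasurableSpace Ω']
    (P : Measure Ω) (X : Fin n → Ω → Fin p → ℝ) (Q : Measure Ω')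
    (Y : Fin n → Ω' → Fin p → ℝ) : Prop where
  measurable : ∀ i, Measurable (Y i)
  indep : iIndepFun Y Q
  gaussian : ∀ i, HasGaussianLaw (Y i) Q
  centered : ∀ i j, ∫ ω', Y i ω' j ∂Q = 0
  covariance : ∀ i j k, ∫ ω', Y i ω' j * Y i ω' k ∂Q = ∫ ω, X i ω j * X i ω k ∂P

/-- (M.1): `n^{-1} ∑ i, E[X_{ij}^2] ≥ b` for all `j`. -/
def CondM1 {n p : ℕ} {Ω : Type*} [MeasurableSpace Ω] (P : Measure Ω)
    (X : Fin n → Ω → Fin p → ℝ) (b : ℝ) : Prop :=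
  ∀ j, b ≤ (∑ i, ∫ ω, X i ω j ^ 2 ∂P) / n

/-- (M.2): `n^{-1} ∑ i, E[|X_{ij}|^{2+k}] ≤ B^k` for all `j` and `k = 1, 2` (in particular these
moments are finite). -/
def CondM2 {n p : ℕ} {Ω : Type*} [MeasurableSpace Ω] (P : Measure Ω)
    (X : Fin n → Ω → Fin p → ℝ) (B : ℝ) : Prop :=
  ∀ j, ∀ k : ℕ, k = 1 ∨ k = 2 →
    (∀ i, Integrable (fun ω => |X i ω j| ^ (2 + k)) P) ∧
    (∑ i, ∫ ω, |X i ω j| ^ (2 + k) ∂P) / n ≤ B ^ k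

/-- (E.1): `E[exp(|X_{ij}| / B)] ≤ 2` for all `i, j`. -/
def CondE1 {n p : ℕ} {Ω : Type*} [MeasurableSpace Ω] (P : Measure Ω)
    (X : Fin n → Ω → Fin p → ℝ) (B : ℝ) : Prop :=
  ∀ i j, Integrable (fun ω => Real.exp (|X i ω j| / B)) P ∧
    ∫ ω, Real.exp (|X i ω j| / B) ∂P ≤ 2

/-- (E.2): `E[(max_j |X_{ij}| / B)^q] ≤ 2` for all `i`. -/
def CondE2 {n p : ℕ} {Ω : Type*} [MeasurableSpace Ω] (P : Measure Ω)
    (X : Fin n → Ω → Fin p → ℝ) (B q : ℝ) : Prop :=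
  ∀ i, Integrable (fun ω => ((⨆ j, |X i ω j|) / B) ^ q) P ∧
    ∫ ω, ((⨆ j, |X i ω j|) / B) ^ q ∂P ≤ 2

/-- `D_n^{(1)} = (B^2 log^7(pn) / n)^{1/6}`. -/
def D1 (n p : ℕ) (B : ℝ) : ℝ :=
  (B ^ 2 * Real.log ((p : ℝ) * n) ^ 7 / n) ^ (1 / 6 : ℝ)

/-- `D_{n,q}^{(2)}(α) = (B^2 log^3(pn) / (α^{2/q} n^{1-2/q}))^{1/3}`. -/
def D2 (n p : ℕ) (B q α : ℝ) : ℝ :=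
  (B ^ 2 * Real.log ((p : ℝ) * n) ^ 3 / (α ^ (2 / q) * (n : ℝ) ^ (1 - 2 / q))) ^ (1 / 3 : ℝ)

end HDBootstrap

end

noncomputable section

namespace HDBootstrap

set_option linter.unusedSectionVars false

/-! The data are treated as fixed. Outside an event of probability at most `α` they satisfy a few
moment bounds, and for any fixed data with these bounds the resampling law is compared with the
Gaussian law by a deterministic estimate.

Fixed data. A hyperrectangle is an orthant for the vector of its signed finite sides, of dimension
at most `2 * p` (`mem_rectangle_iff`). The orthant indicator is smoothed to `g (φ F_β)`, where `g`
is a cutoff, `F_β` is the log-sum-exp maximum and `β = φ ℓ`, with `ℓ` of the order of the log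
dimension or larger. Its derivatives are built from softmax averages. They cost powers of `φ` and
`β` but no power of the dimension, they are stable under shifts of size `1 / β`, and they vanish
unless the maximum is within order `1 / φ` of the boundary (`abs_smoothIndD₃_add_le`).

The resampled sum `W` and the Gaussian vector `G` are joined by the path `sin θ W + cos θ G`. In the
derivative along the path, Gaussian integration by parts turns the `G` term into the Hessian
contracted with the covariance (`integral_smoothIndD`). Redrawing one index at a time turns the `W`
term into the Hessian contracted with the empirical covariance, up to a third order remainder
(`abs_resampleMean_expansion_le`). The difference is `cos θ` times the probability that the path is
near the boundary, times explicit constants. With `W` fixed, being near the boundary confines the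
maximum of `G`, suitably shifted, to a window of width of order `1 / (φ cos θ)`. Nazarov's
inequality therefore bounds the product by a multiple of `√ℓ / φ` uniformly in `θ`
(`measure_shell_le`, `abs_deriv_interp_le`), and no recursion on the unknown approximation error is
needed. With `L` bounding the third moments and `Δ` the covariance error, the total is of order `√ℓ
(φ² ℓ² L / √n + φ ℓ Δ + 1 / φ)`.

Nazarov's inequality is obtained by splitting space according to the coordinate that attains the
maximum. Along a regression line each cell is an upper set, and the normal hazard rate grows at most
linearly (`measure_cell_le`, `nazarov_unit`).

Random data. The vectors are truncated at a level `M` that they exceed with probability at most `α /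
4`. Bernstein bounds for the truncated products and cubes, together with a bound on the truncation
bias, control `L` and `Δ` (`exists_bad_event`). Taking `1 / φ` proportional to the rate divided by
`√ℓ` balances all terms (`rate_bounds`). The two moment conditions enter only through the choice of
`M`, by Markov's inequality. -/

/-- A three times differentiable cutoff, equal to `1` on `(-∞, 0]` and to `0` on `[1, ∞)`, with its
first three derivatives bounded by `K`. -/
structure SmoothCutoff (K : ℝ) where
  g : ℝ → ℝ
  g₁ : ℝ → ℝ
  g₂ : ℝ → ℝ
  g₃ : ℝ → ℝ
  hasDeriv : ∀ u, HasDerivAt g (g₁ u) u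
  hasDeriv₁ : ∀ u, HasDerivAt g₁ (g₂ u) u
  hasDeriv₂ : ∀ u, HasDerivAt g₂ (g₃ u) u
  bound₁ : ∀ u, |g₁ u| ≤ K
  bound₂ : ∀ u, |g₂ u| ≤ K
  bound₃ : ∀ u, |g₃ u| ≤ K
  vanish : ∀ u, (u < 0 ∨ 1 < u) → g₁ u = 0 ∧ g₂ u = 0 ∧ g₃ u = 0
  nonneg : ∀ u, 0 ≤ g u
  le_one : ∀ u, g u ≤ 1
  eq_one : ∀ u ≤ 0, g u = 1
  eq_zero : ∀ u, 1 ≤ u → g u = 0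

/-! ### Existence of a smooth cutoff with bounded derivatives. -/

theorem exists_bound_of_vanishing {h : ℝ → ℝ} (hc : Continuous h)
    (hv : ∀ u, (u < 0 ∨ 1 < u) → h u = 0) : ∃ K, 0 ≤ K ∧ ∀ u, |h u| ≤ K := by
  obtain ⟨K, hK⟩ := (isCompact_Icc (a := (0 : ℝ)) (b := 1)).exists_bound_of_continuousOn
    hc.continuousOn
  refine ⟨max K 0, le_max_right _ _, fun u => ?_⟩
  by_cases hu : u < 0 ∨ 1 < u
  · rw [hv u hu]; simp
  · push Not at hu
    exact (hK u ⟨hu.1, hu.2⟩).trans (le_max_left _ _)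

theorem deriv_eq_zero_outside {h : ℝ → ℝ} {c d : ℝ} (h0 : ∀ u < 0, h u = c)
    (h1 : ∀ u, 1 < u → h u = d) : ∀ u, (u < 0 ∨ 1 < u) → deriv h u = 0 := by
  rintro u (hu | hu)
  · have : h =ᶠ[nhds u] fun _ => c := by
      filter_upwards [Iio_mem_nhds hu] with v hv using h0 v hv
    rw [this.deriv_eq]; simp
  · have : h =ᶠ[nhds u] fun _ => d := by
      filter_upwards [Ioi_mem_nhds hu] with v hv using h1 v hv
    rw [this.deriv_eq]; simp

theorem exists_smoothCutoff : ∃ K : ℝ, 1 ≤ K ∧ Nonempty (SmoothCutoff K) := by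
  let g : ℝ → ℝ := fun u => Real.smoothTransition (1 - u)
  have hg : ContDiff ℝ 4 g := Real.smoothTransition.contDiff.comp (contDiff_const.sub contDiff_id)
  have hg1 : ContDiff ℝ 3 (deriv g) := by
    have : ContDiff ℝ (3 + 1) g := by convert! hg
    exact (contDiff_succ_iff_deriv.1 this).2.2
  have hg2 : ContDiff ℝ 2 (deriv (deriv g)) := by
    have : ContDiff ℝ (2 + 1) (deriv g) := by convert! hg1
    exact (contDiff_succ_iff_deriv.1 this).2.2
  have hg3 : ContDiff ℝ 1 (deriv (deriv (deriv g))) := by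
    have : ContDiff ℝ (1 + 1) (deriv (deriv g)) := by convert! hg2
    exact (contDiff_succ_iff_deriv.1 this).2.2
  have e1 : ∀ u ≤ 0, g u = 1 := fun u hu =>
    Real.smoothTransition.one_of_one_le (by linarith)
  have e0 : ∀ u, 1 ≤ u → g u = 0 := fun u hu =>
    Real.smoothTransition.zero_of_nonpos (by linarith)
  have v1 := deriv_eq_zero_outside (h := g) (fun u hu => e1 u hu.le) (fun u hu => e0 u hu.le)
  have v2 := deriv_eq_zero_outside (h := deriv g) (fun u hu => v1 u (Or.inl hu))
    (fun u hu => v1 u (Or.inr hu))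
  have v3 := deriv_eq_zero_outside (h := deriv (deriv g)) (fun u hu => v2 u (Or.inl hu))
    (fun u hu => v2 u (Or.inr hu))
  obtain ⟨K1, _, hK1⟩ := exists_bound_of_vanishing hg1.continuous v1
  obtain ⟨K2, _, hK2⟩ := exists_bound_of_vanishing hg2.continuous v2
  obtain ⟨K3, _, hK3⟩ := exists_bound_of_vanishing hg3.continuous v3
  -- The summand `1` makes the common bound at least one, so that it can later absorb a smoothing
  -- loss that carries no factor `K`.
  refine ⟨1 + K1 + K2 + K3, by linarith, ⟨⟨g, deriv g, deriv (deriv g), deriv (deriv (deriv g)),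
    fun u => (hg.differentiable (by norm_num) u).hasDerivAt,
    fun u => (hg1.differentiable (by norm_num) u).hasDerivAt,
    fun u => (hg2.differentiable (by norm_num) u).hasDerivAt,
    fun u => (hK1 u).trans (by linarith), fun u => (hK2 u).trans (by linarith),
    fun u => (hK3 u).trans (by linarith), fun u hu => ⟨v1 u hu, v2 u hu, v3 u hu⟩,
    fun u => Real.smoothTransition.nonneg _, fun u => Real.smoothTransition.le_one _, e1, e0⟩⟩⟩

/-! ### Softmax averages and the smooth maximum. -/

section Softmax

variable {ι : Type*} [Fintype ι]

/-- The partition function `∑ j, exp (β x_j)`. -/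
def partitionFn (β : ℝ) (x : ι → ℝ) : ℝ := ∑ j, Real.exp (β * x j)

/-- The softmax weights at inverse temperature `β`. -/
def softmaxWeight (β : ℝ) (x : ι → ℝ) (j : ι) : ℝ := Real.exp (β * x j) / partitionFn β x

/-- The average of `a` under the softmax weights. -/
def softmaxAvg (β : ℝ) (x a : ι → ℝ) : ℝ := ∑ j, softmaxWeight β x j * a j

/-- The smooth maximum `β⁻¹ log ∑ j, exp (β x_j)`. -/
def smoothMax (β : ℝ) (x : ι → ℝ) : ℝ := Real.log (partitionFn β x) / β

theorem softmaxWeight_nonneg (β : ℝ) (x : ι → ℝ) (j : ι) : 0 ≤ softmaxWeight β x j := by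
  unfold softmaxWeight partitionFn; positivity

theorem softmaxAvg_mono {β : ℝ} {x a b : ι → ℝ} (h : ∀ j, a j ≤ b j) :
    softmaxAvg β x a ≤ softmaxAvg β x b :=
  Finset.sum_le_sum fun j _ => mul_le_mul_of_nonneg_left (h j) (softmaxWeight_nonneg _ _ _)

theorem softmaxAvg_nonneg {β : ℝ} {x a : ι → ℝ} (h : ∀ j, 0 ≤ a j) : 0 ≤ softmaxAvg β x a :=
  Finset.sum_nonneg fun j _ => mul_nonneg (softmaxWeight_nonneg _ _ _) (h j)

theorem softmaxAvg_add (β : ℝ) (x a b : ι → ℝ) :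
    softmaxAvg β x (fun j => a j + b j) = softmaxAvg β x a + softmaxAvg β x b := by
  simp [softmaxAvg, mul_add, Finset.sum_add_distrib]

theorem softmaxAvg_const_mul (β c : ℝ) (x a : ι → ℝ) :
    softmaxAvg β x (fun j => c * a j) = c * softmaxAvg β x a := by
  simp only [softmaxAvg, Finset.mul_sum]
  exact Finset.sum_congr rfl fun j _ => by ring

theorem softmaxAvg_sum {κ : Type*} (s : Finset κ) (β : ℝ) (x : ι → ℝ) (a : κ → ι → ℝ) :
    softmaxAvg β x (fun j => ∑ k ∈ s, a k j) = ∑ k ∈ s, softmaxAvg β x (a k) := by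
  simp only [softmaxAvg, Finset.mul_sum]
  exact Finset.sum_comm

theorem abs_softmaxAvg_le (β : ℝ) (x a : ι → ℝ) :
    |softmaxAvg β x a| ≤ softmaxAvg β x (fun j => |a j|) := by
  refine (Finset.abs_sum_le_sum_abs _ _).trans (Finset.sum_le_sum fun j _ => ?_)
  rw [abs_mul, abs_of_nonneg (softmaxWeight_nonneg _ _ _)]

theorem partitionFn_add_le {β r : ℝ} (hβ : 0 ≤ β) {x δ : ι → ℝ} (h : ∀ j, |δ j| ≤ r) :
    partitionFn β (fun j => x j + δ j) ≤ Real.exp (β * r) * partitionFn β x := by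
  rw [partitionFn, partitionFn, Finset.mul_sum]
  refine Finset.sum_le_sum fun j _ => ?_
  rw [← Real.exp_add]
  refine Real.exp_le_exp.2 ?_
  nlinarith [mul_le_mul_of_nonneg_left ((le_abs_self _).trans (h j)) hβ]

theorem hasDerivAt_partitionFn {β t : ℝ} {x : ℝ → ι → ℝ} {x' : ι → ℝ} (a : ι → ℝ)
    (hx : ∀ j, HasDerivAt (fun s => x s j) (x' j) t) :
    HasDerivAt (fun s => ∑ j, Real.exp (β * x s j) * a j)
      (∑ j, Real.exp (β * x t j) * (β * (a j * x' j))) t := by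
  refine HasDerivAt.fun_sum fun j _ => ?_
  convert! (((hx j).const_mul β).exp.mul_const (a j)) using 1
  ring

theorem softmaxAvg_eq (β : ℝ) (x a : ι → ℝ) :
    softmaxAvg β x a = (∑ j, Real.exp (β * x j) * a j) / partitionFn β x := by
  rw [softmaxAvg, Finset.sum_div]
  exact Finset.sum_congr rfl fun j _ => by rw [softmaxWeight]; ring

variable [Nonempty ι]

theorem partitionFn_pos (β : ℝ) (x : ι → ℝ) : 0 < partitionFn β x :=
  Finset.sum_pos (fun _ _ => Real.exp_pos _) Finset.univ_nonempty

theorem sum_softmaxWeight (β : ℝ) (x : ι → ℝ) : ∑ j, softmaxWeight β x j = 1 := by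
  simp only [softmaxWeight, ← Finset.sum_div]
  exact div_self (partitionFn_pos β x).ne'

theorem softmaxAvg_const (β c : ℝ) (x : ι → ℝ) : softmaxAvg β x (fun _ => c) = c := by
  rw [softmaxAvg, ← Finset.sum_mul, sum_softmaxWeight, one_mul]

theorem le_smoothMax {β : ℝ} (hβ : 0 < β) (x : ι → ℝ) (j : ι) : x j ≤ smoothMax β x := by
  rw [smoothMax, le_div_iff₀ hβ, Real.le_log_iff_exp_le (partitionFn_pos β x), mul_comm]
  exact Finset.single_le_sum (f := fun k => Real.exp (β * x k)) (fun k _ => (Real.exp_pos _).le)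
    (Finset.mem_univ j)

theorem smoothMax_le {β m : ℝ} (hβ : 0 < β) {x : ι → ℝ} (h : ∀ j, x j ≤ m) :
    smoothMax β x ≤ m + Real.log (Fintype.card ι) / β := by
  have hc : (0 : ℝ) < Fintype.card ι := by exact_mod_cast Fintype.card_pos
  have : partitionFn β x ≤ Fintype.card ι * Real.exp (β * m) := by
    have := Finset.sum_le_sum (s := Finset.univ) fun j (_ : j ∈ Finset.univ) =>
      Real.exp_le_exp.2 (mul_le_mul_of_nonneg_left (h j) hβ.le)
    simpa [partitionFn] using this
  have h2 := Real.log_le_log (partitionFn_pos β x) this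
  rw [Real.log_mul hc.ne' (Real.exp_pos _).ne', Real.log_exp] at h2
  rw [smoothMax, div_le_iff₀ hβ, add_mul, div_mul_cancel₀ _ hβ.ne']
  linarith

theorem smoothMax_add_le {β r : ℝ} (hβ : 0 < β) {x δ : ι → ℝ} (h : ∀ j, |δ j| ≤ r) :
    smoothMax β (fun j => x j + δ j) ≤ smoothMax β x + r := by
  have h2 := Real.log_le_log (partitionFn_pos β _) (partitionFn_add_le hβ.le (x := x) h)
  rw [Real.log_mul (Real.exp_pos _).ne' (partitionFn_pos β x).ne', Real.log_exp] at h2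
  rw [smoothMax, smoothMax, div_add' _ _ _ hβ.ne']
  gcongr
  linarith

theorem abs_smoothMax_add_sub_le {β r : ℝ} (hβ : 0 < β) {x δ : ι → ℝ} (h : ∀ j, |δ j| ≤ r) :
    |smoothMax β (fun j => x j + δ j) - smoothMax β x| ≤ r := by
  have h1 := smoothMax_add_le hβ (x := x) h
  have h2 := smoothMax_add_le hβ (x := fun j => x j + δ j) (δ := fun j => - δ j) (r := r)
    (by simpa using h)
  simp only [add_neg_cancel_right] at h2
  rw [abs_le]; constructor <;> linarith

/-- The numerator and the normalizer each change by a factor of at most `exp (β r)`. This stability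
lets derivative bounds at displaced points be read off at one base point common to all draws. -/
theorem softmaxWeight_add_le {β r : ℝ} (hβ : 0 ≤ β) {x δ : ι → ℝ} (h : ∀ j, |δ j| ≤ r) (j : ι) :
    softmaxWeight β (fun j => x j + δ j) j ≤ Real.exp (2 * (β * r)) * softmaxWeight β x j := by
  have h1 := partitionFn_add_le hβ (x := fun j => x j + δ j) (δ := fun j => - δ j) (r := r)
    (by simpa using h)
  simp only [add_neg_cancel_right] at h1
  have hp := partitionFn_pos β x
  have hp' := partitionFn_pos β (fun j => x j + δ j)
  have h2 : Real.exp (β * (x j + δ j)) ≤ Real.exp (β * r) * Real.exp (β * x j) := by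
    rw [← Real.exp_add]
    refine Real.exp_le_exp.2 ?_
    nlinarith [mul_le_mul_of_nonneg_left ((le_abs_self _).trans (h j)) hβ]
  have e : Real.exp (2 * (β * r)) = Real.exp (β * r) * Real.exp (β * r) := by
    rw [← Real.exp_add]; ring_nf
  rw [softmaxWeight, softmaxWeight, ← mul_div_assoc, div_le_div_iff₀ hp' hp, e]
  calc _ ≤ (Real.exp (β * r) * Real.exp (β * x j)) *
        (Real.exp (β * r) * partitionFn β (fun j => x j + δ j)) := by gcongr
    _ = _ := by ring

theorem softmaxAvg_add_point_le {β r : ℝ} (hβ : 0 ≤ β) {x δ a : ι → ℝ} (h : ∀ j, |δ j| ≤ r)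
    (ha : ∀ j, 0 ≤ a j) :
    softmaxAvg β (fun j => x j + δ j) a ≤ Real.exp (2 * (β * r)) * softmaxAvg β x a := by
  rw [softmaxAvg, softmaxAvg, Finset.mul_sum]
  refine Finset.sum_le_sum fun j _ => ?_
  rw [← mul_assoc]
  exact mul_le_mul_of_nonneg_right (softmaxWeight_add_le hβ h j) (ha j)

theorem hasDerivAt_partitionFn' {β t : ℝ} {x : ℝ → ι → ℝ} {x' : ι → ℝ}
    (hx : ∀ j, HasDerivAt (fun s => x s j) (x' j) t) :
    HasDerivAt (fun s => partitionFn β (x s)) (partitionFn β (x t) * (β * softmaxAvg β (x t) x'))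
      t := by
  have h := hasDerivAt_partitionFn (β := β) (fun _ => 1) hx
  simp only [mul_one, one_mul] at h
  convert! h using 1
  rw [softmaxAvg_eq]
  field_simp [(partitionFn_pos β (x t)).ne']
  rw [Finset.mul_sum]
  exact Finset.sum_congr rfl fun j _ => by ring

theorem hasDerivAt_smoothMax {β t : ℝ} (hβ : 0 < β) {x : ℝ → ι → ℝ} {x' : ι → ℝ}
    (hx : ∀ j, HasDerivAt (fun s => x s j) (x' j) t) :
    HasDerivAt (fun s => smoothMax β (x s)) (softmaxAvg β (x t) x') t := by
  convert! ((hasDerivAt_partitionFn' (β := β) hx).log (partitionFn_pos β _).ne').div_const β using 1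
  field_simp [(partitionFn_pos β (x t)).ne']

theorem hasDerivAt_softmaxAvg {β t : ℝ} {x : ℝ → ι → ℝ} {x' : ι → ℝ} (a : ι → ℝ)
    (hx : ∀ j, HasDerivAt (fun s => x s j) (x' j) t) :
    HasDerivAt (fun s => softmaxAvg β (x s) a) (β * (softmaxAvg β (x t) (fun j => a j * x' j)
      - softmaxAvg β (x t) a * softmaxAvg β (x t) x')) t := by
  have h := (hasDerivAt_partitionFn (β := β) a hx).div (hasDerivAt_partitionFn' (β := β) hx)
    (partitionFn_pos β _).ne'
  simp only [softmaxAvg_eq β _ a]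
  convert! h using 1
  have hp := (partitionFn_pos β (x t)).ne'
  rw [softmaxAvg_eq β _ (fun j => a j * x' j)]
  have : ∑ j, Real.exp (β * x t j) * (β * (a j * x' j))
      = β * ∑ j, Real.exp (β * x t j) * (a j * x' j) := by
    rw [Finset.mul_sum]; exact Finset.sum_congr rfl fun j _ => by ring
  rw [this]
  field_simp

/-- Power mean bounds for the softmax average, in terms of any `m` with `⟨|u|³⟩, ⟨|w|³⟩ ≤ m³`. -/
theorem softmaxAvg_moments {β m : ℝ} (hm : 0 < m) {x u w : ι → ℝ}
    (hu : softmaxAvg β x (fun j => |u j| ^ 3) ≤ m ^ 3)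
    (hw : softmaxAvg β x (fun j => |w j| ^ 3) ≤ m ^ 3) :
    |softmaxAvg β x u| ≤ m ∧ |softmaxAvg β x w| ≤ m ∧
    |softmaxAvg β x (fun j => u j ^ 2)| ≤ m ^ 2 ∧ |softmaxAvg β x (fun j => u j * w j)| ≤ m ^ 2 ∧
    |softmaxAvg β x (fun j => u j ^ 2 * w j)| ≤ m ^ 3 := by
  -- Multiplying by `k`, a power of `m`, makes every term cubic. A coordinatewise AM-GM inequality
  -- then averages to the claim, in place of Hölder's inequality.
  have key : ∀ (a : ι → ℝ) (k c₁ c₂ c₀ : ℝ), 0 < k → 0 ≤ c₁ → 0 ≤ c₂ →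
      (∀ j, |a j| * k ≤ c₁ * |u j| ^ 3 + c₂ * |w j| ^ 3 + c₀ * m ^ 3) →
      |softmaxAvg β x a| * k ≤ (c₁ + c₂ + c₀) * m ^ 3 := by
    intro a k c₁ c₂ c₀ hk h1 h2 h
    have e := softmaxAvg_mono (β := β) (x := x) (a := fun j => k * |a j|)
      (fun j => (by simpa [mul_comm] using h j :
        k * |a j| ≤ c₁ * |u j| ^ 3 + c₂ * |w j| ^ 3 + c₀ * m ^ 3))
    rw [softmaxAvg_const_mul, softmaxAvg_add, softmaxAvg_add, softmaxAvg_const_mul,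
      softmaxAvg_const_mul, softmaxAvg_const] at e
    have e2 := mul_le_mul_of_nonneg_left (abs_softmaxAvg_le β x a) hk.le
    nlinarith [mul_le_mul_of_nonneg_left hu h1, mul_le_mul_of_nonneg_left hw h2]
  have am1 : ∀ s : ℝ, 0 ≤ s → s * m ^ 2 ≤ s ^ 3 / 3 + 2 / 3 * m ^ 3 := fun s hs => by
    nlinarith [mul_nonneg (add_nonneg hs (by positivity : 0 ≤ 2 * m)) (sq_nonneg (s - m))]
  have am2 : ∀ s : ℝ, 0 ≤ s → s ^ 2 * m ≤ 2 / 3 * s ^ 3 + m ^ 3 / 3 := fun s hs => by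
    nlinarith [mul_nonneg (add_nonneg hm.le (by positivity : 0 ≤ 2 * s)) (sq_nonneg (s - m))]
  have m2 : 0 < m ^ 2 := by positivity
  refine ⟨?_, ?_, ?_, ?_, ?_⟩
  · have := key u (m ^ 2) (1 / 3) 0 (2 / 3) m2 (by norm_num) le_rfl
      (fun j => by have := am1 _ (abs_nonneg (u j)); linarith)
    nlinarith
  · have := key w (m ^ 2) 0 (1 / 3) (2 / 3) m2 le_rfl (by norm_num)
      (fun j => by have := am1 _ (abs_nonneg (w j)); linarith)
    nlinarith
  · have := key (fun j => u j ^ 2) m (2 / 3) 0 (1 / 3) hm (by norm_num) le_rfl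
      (fun j => by have := am2 _ (abs_nonneg (u j)); rw [abs_pow]; linarith)
    nlinarith
  · have := key (fun j => u j * w j) m (1 / 3) (1 / 3) (1 / 3) hm (by norm_num) (by norm_num)
      (fun j => by
        have h1 := am2 _ (abs_nonneg (u j))
        have h2 := am2 _ (abs_nonneg (w j))
        rw [abs_mul]
        nlinarith [mul_nonneg hm.le (sq_nonneg (|u j| - |w j|))])
    nlinarith
  · have := key (fun j => u j ^ 2 * w j) 1 (2 / 3) (1 / 3) 0 one_pos (by norm_num) (by norm_num)
      (fun j => by
        have h1 := abs_nonneg (u j)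
        have h2 := abs_nonneg (w j)
        rw [abs_mul, abs_pow]
        nlinarith [mul_nonneg (by positivity : 0 ≤ 2 * |u j| + |w j|) (sq_nonneg (|u j| - |w j|))])
    linarith

end Softmax

/-! ### The smoothed orthant indicator and its derivatives. -/

section SmoothIndicator

variable {ι : Type*} [Fintype ι] {K : ℝ}

/-- The smooth approximation `g (φ F_β(x))` of the indicator of the negative orthant. -/
def smoothInd (χ : SmoothCutoff K) (φ β : ℝ) (x : ι → ℝ) : ℝ := χ.g (φ * smoothMax β x)

/-- The derivative of `smoothInd` at `x` in the direction `u`. -/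
def smoothIndD (χ : SmoothCutoff K) (φ β : ℝ) (u x : ι → ℝ) : ℝ :=
  φ * χ.g₁ (φ * smoothMax β x) * softmaxAvg β x u

/-- The second derivative of `smoothInd` at `x` in the directions `u` and `w`. -/
def smoothIndD₂ (χ : SmoothCutoff K) (φ β : ℝ) (u w x : ι → ℝ) : ℝ :=
  φ ^ 2 * χ.g₂ (φ * smoothMax β x) * (softmaxAvg β x u * softmaxAvg β x w) +
    φ * β * χ.g₁ (φ * smoothMax β x) *
      (softmaxAvg β x (fun j => u j * w j) - softmaxAvg β x u * softmaxAvg β x w)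

/-- The contraction of the Hessian of `smoothInd` at `x` with the matrix `Γ`. -/
def smoothIndTr (χ : SmoothCutoff K) (φ β : ℝ) (Γ : ι → ι → ℝ) (x : ι → ℝ) : ℝ :=
  φ ^ 2 * χ.g₂ (φ * smoothMax β x) * softmaxAvg β x (fun j => softmaxAvg β x (Γ j)) +
    φ * β * χ.g₁ (φ * smoothMax β x) *
      (softmaxAvg β x (fun j => Γ j j) - softmaxAvg β x (fun j => softmaxAvg β x (Γ j)))

/-- The region in which the derivatives of `smoothInd` live, slightly enlarged. -/
def shell (φ β : ℝ) : Set (ι → ℝ) := {x | |φ * smoothMax β x| ≤ 3}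

theorem softmaxAvg_mul_softmaxAvg (β : ℝ) (x u w : ι → ℝ) :
    softmaxAvg β x (fun j => softmaxAvg β x (fun k => u j * w k))
      = softmaxAvg β x u * softmaxAvg β x w := by
  simp only [softmaxAvg_const_mul]
  rw [mul_comm, ← softmaxAvg_const_mul]
  congr 1; ext j; ring

theorem smoothIndTr_outer (χ : SmoothCutoff K) (φ β : ℝ) (u x : ι → ℝ) :
    smoothIndTr χ φ β (fun j k => u j * u k) x = smoothIndD₂ χ φ β u u x := by
  simp only [smoothIndTr, smoothIndD₂, softmaxAvg_mul_softmaxAvg]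

theorem smoothIndTr_sum {κ : Type*} (s : Finset κ) (χ : SmoothCutoff K) (φ β : ℝ)
    (Γ : κ → ι → ι → ℝ) (x : ι → ℝ) :
    smoothIndTr χ φ β (fun j k => ∑ i ∈ s, Γ i j k) x = ∑ i ∈ s, smoothIndTr χ φ β (Γ i) x := by
  simp only [smoothIndTr, softmaxAvg_sum, Finset.sum_add_distrib, Finset.mul_sum,
    Finset.sum_sub_distrib, mul_sub]

theorem smoothIndTr_const_mul (χ : SmoothCutoff K) (φ β c : ℝ) (Γ : ι → ι → ℝ) (x : ι → ℝ) :
    smoothIndTr χ φ β (fun j k => c * Γ j k) x = c * smoothIndTr χ φ β Γ x := by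
  simp only [smoothIndTr, softmaxAvg_const_mul]
  ring

theorem smoothIndTr_sub (χ : SmoothCutoff K) (φ β : ℝ) (Γ Γ' : ι → ι → ℝ) (x : ι → ℝ) :
    smoothIndTr χ φ β (fun j k => Γ j k - Γ' j k) x
      = smoothIndTr χ φ β Γ x - smoothIndTr χ φ β Γ' x := by
  have h : ∀ a b : ι → ℝ, softmaxAvg β x (fun j => a j - b j)
      = softmaxAvg β x a - softmaxAvg β x b := fun a b => by
    simp [softmaxAvg, mul_sub]
  simp only [smoothIndTr, h]
  ring

theorem smoothIndD_add (χ : SmoothCutoff K) (φ β : ℝ) (u w x : ι → ℝ) :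
    smoothIndD χ φ β (fun j => u j + w j) x
      = smoothIndD χ φ β u x + smoothIndD χ φ β w x := by
  simp only [smoothIndD, softmaxAvg_add]; ring

theorem smoothIndD_const_mul (χ : SmoothCutoff K) (φ β c : ℝ) (u x : ι → ℝ) :
    smoothIndD χ φ β (fun j => c * u j) x = c * smoothIndD χ φ β u x := by
  simp only [smoothIndD, softmaxAvg_const_mul]; ring

theorem smoothIndD_sum {κ : Type*} (s : Finset κ) (χ : SmoothCutoff K) (φ β : ℝ)
    (u : κ → ι → ℝ) (x : ι → ℝ) :
    smoothIndD χ φ β (fun j => ∑ i ∈ s, u i j) x = ∑ i ∈ s, smoothIndD χ φ β (u i) x := by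
  simp only [smoothIndD, softmaxAvg_sum, Finset.mul_sum]

/-- The derivative of `smoothIndD₂ u u` at `x` in the direction `w`. -/
def smoothIndD₃ (χ : SmoothCutoff K) (φ β : ℝ) (u w x : ι → ℝ) : ℝ :=
  φ ^ 3 * χ.g₃ (φ * smoothMax β x) * (softmaxAvg β x w * softmaxAvg β x u ^ 2) +
  φ ^ 2 * β * χ.g₂ (φ * smoothMax β x) *
    (2 * softmaxAvg β x u * (softmaxAvg β x (fun j => u j * w j)
        - softmaxAvg β x u * softmaxAvg β x w)
      + softmaxAvg β x w * (softmaxAvg β x (fun j => u j ^ 2) - softmaxAvg β x u ^ 2)) +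
  φ * β ^ 2 * χ.g₁ (φ * smoothMax β x) *
    (softmaxAvg β x (fun j => u j ^ 2 * w j) - softmaxAvg β x (fun j => u j ^ 2) * softmaxAvg β x w
      - 2 * softmaxAvg β x u * (softmaxAvg β x (fun j => u j * w j)
        - softmaxAvg β x u * softmaxAvg β x w))

theorem smoothIndD₃_eq_zero (χ : SmoothCutoff K) {φ β : ℝ} (u w : ι → ℝ) {x : ι → ℝ}
    (hx : φ * smoothMax β x < 0 ∨ 1 < φ * smoothMax β x) : smoothIndD₃ χ φ β u w x = 0 := by
  obtain ⟨v1, v2, v3⟩ := χ.vanish _ hx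
  simp [smoothIndD₃, v1, v2, v3]

variable [Nonempty ι]

theorem smoothInd_eq_one (χ : SmoothCutoff K) {φ β : ℝ} (hφ : 0 < φ) (hβ : 0 < β) {x : ι → ℝ}
    (h : ∀ j, x j ≤ - (Real.log (Fintype.card ι) / β)) : smoothInd χ φ β x = 1 := by
  have := smoothMax_le hβ h
  exact χ.eq_one _ (mul_nonpos_of_nonneg_of_nonpos hφ.le (by linarith))

theorem smoothInd_eq_zero (χ : SmoothCutoff K) {φ β : ℝ} (hφ : 0 < φ) (hβ : 0 < β) {x : ι → ℝ}
    {j : ι} (h : 1 / φ ≤ x j) : smoothInd χ φ β x = 0 := by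
  have := h.trans (le_smoothMax hβ x j)
  exact χ.eq_zero _ (by rwa [div_le_iff₀' hφ] at this)

theorem hasDerivAt_smoothInd (χ : SmoothCutoff K) {φ β t : ℝ} (hβ : 0 < β) {x : ℝ → ι → ℝ}
    {x' : ι → ℝ} (hx : ∀ j, HasDerivAt (fun s => x s j) (x' j) t) :
    HasDerivAt (fun s => smoothInd χ φ β (x s)) (smoothIndD χ φ β x' (x t)) t := by
  convert! (χ.hasDeriv _).comp t ((hasDerivAt_smoothMax hβ hx).const_mul φ) using 1
  rw [smoothIndD]; ring

theorem hasDerivAt_smoothIndD (χ : SmoothCutoff K) {φ β t : ℝ} (hβ : 0 < β) {x : ℝ → ι → ℝ}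
    {x' : ι → ℝ} (u : ι → ℝ) (hx : ∀ j, HasDerivAt (fun s => x s j) (x' j) t) :
    HasDerivAt (fun s => smoothIndD χ φ β u (x s)) (smoothIndD₂ χ φ β u x' (x t)) t := by
  have h1 := (χ.hasDeriv₁ _).comp t ((hasDerivAt_smoothMax hβ hx).const_mul φ)
  convert! (h1.const_mul φ).mul (hasDerivAt_softmaxAvg u hx) using 1
  simp only [smoothIndD₂, Function.comp_apply]; ring

theorem abs_smoothIndD_le (χ : SmoothCutoff K) {φ β R : ℝ} (hφ : 0 ≤ φ) {u : ι → ℝ}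
    (hu : ∀ j, |u j| ≤ R) (x : ι → ℝ) : |smoothIndD χ φ β u x| ≤ φ * K * R := by
  have h1 := (abs_softmaxAvg_le β x u).trans (softmaxAvg_mono hu)
  rw [softmaxAvg_const] at h1
  rw [smoothIndD, abs_mul, abs_mul, abs_of_nonneg hφ]
  have h2 := χ.bound₁ (φ * smoothMax β x)
  exact mul_le_mul (mul_le_mul_of_nonneg_left h2 hφ) h1 (abs_nonneg _)
    (mul_nonneg hφ ((abs_nonneg _).trans h2))

/-- Softmax weights form a probability vector, so contracting with `Γ` costs only its largest entry
and no dimension factor. Since `φ ≤ β`, both terms are of size `φ β`, and off the shell the cutoff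
derivatives vanish. -/
theorem abs_smoothIndTr_le (χ : SmoothCutoff K) {φ β Δ : ℝ} (hφ : 0 ≤ φ) (hφβ : φ ≤ β)
    {Γ : ι → ι → ℝ} (hΓ : ∀ j k, |Γ j k| ≤ Δ) (x : ι → ℝ) :
    |smoothIndTr χ φ β Γ x| ≤ 3 * K * φ * β * Δ * (shell φ β).indicator 1 x := by
  have hK : 0 ≤ K := (abs_nonneg _).trans (χ.bound₁ 0)
  have a1 : |softmaxAvg β x (fun j => softmaxAvg β x (Γ j))| ≤ Δ := by
    have := (abs_softmaxAvg_le β x _).trans (softmaxAvg_mono fun j =>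
      (abs_softmaxAvg_le β x (Γ j)).trans (softmaxAvg_mono (hΓ j)))
    simpa only [softmaxAvg_const] using this
  have a2 : |softmaxAvg β x (fun j => Γ j j)| ≤ Δ := by
    have := (abs_softmaxAvg_le β x _).trans (softmaxAvg_mono fun j => hΓ j j)
    simpa only [softmaxAvg_const] using this
  have hΔ : 0 ≤ Δ := (abs_nonneg _).trans a2
  by_cases hx : x ∈ shell φ β
  · rw [Set.indicator_of_mem hx, Pi.one_apply, mul_one, smoothIndTr]
    have b1 := χ.bound₁ (φ * smoothMax β x)
    have b2 := χ.bound₂ (φ * smoothMax β x)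
    have hβ : 0 ≤ β := hφ.trans hφβ
    refine (abs_add_le _ _).trans ?_
    have c1 : |φ ^ 2 * χ.g₂ (φ * smoothMax β x) *
        softmaxAvg β x (fun j => softmaxAvg β x (Γ j))| ≤ φ * β * K * Δ := by
      rw [abs_mul, abs_mul, abs_of_nonneg (sq_nonneg φ), sq]
      gcongr
    have c2 : |φ * β * χ.g₁ (φ * smoothMax β x) * (softmaxAvg β x (fun j => Γ j j) -
        softmaxAvg β x (fun j => softmaxAvg β x (Γ j)))| ≤ φ * β * K * (Δ + Δ) := by
      rw [abs_mul, abs_mul, abs_of_nonneg (mul_nonneg hφ hβ)]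
      have := (abs_sub _ _).trans (add_le_add a2 a1)
      gcongr
    linarith
  · rw [Set.indicator_of_notMem hx, mul_zero, smoothIndTr]
    obtain ⟨v1, v2, -⟩ := χ.vanish (φ * smoothMax β x) (by
      by_contra! hc
      exact hx (abs_le.2 ⟨by linarith [hc.1], by linarith [hc.2]⟩ : |φ * smoothMax β x| ≤ 3))
    simp [v1, v2]

theorem hasDerivAt_smoothIndD₂ (χ : SmoothCutoff K) {φ β t : ℝ} (hβ : 0 < β) {x : ℝ → ι → ℝ}
    {x' : ι → ℝ} (u : ι → ℝ) (hx : ∀ j, HasDerivAt (fun s => x s j) (x' j) t) :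
    HasDerivAt (fun s => smoothIndD₂ χ φ β u u (x s)) (smoothIndD₃ χ φ β u x' (x t)) t := by
  have h0 := (hasDerivAt_smoothMax hβ hx).const_mul φ
  have h1 := (χ.hasDeriv₁ _).comp t h0
  have h2 := (χ.hasDeriv₂ _).comp t h0
  have hu := hasDerivAt_softmaxAvg (β := β) u hx
  have huu := hasDerivAt_softmaxAvg (β := β) (fun j => u j * u j) hx
  convert! ((h2.const_mul (φ ^ 2)).mul (hu.mul hu)).add
    ((h1.const_mul (φ * β)).mul (huu.sub (hu.mul hu))) using 1
  simp only [smoothIndD₃, Function.comp_apply, Pi.sub_apply, Pi.mul_apply, sq]; ring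

/-- The three groups carry `φ ^ 3`, `φ ^ 2 * β` and `φ * β ^ 2`, all at most the last because `φ ≤
β`. Counting products of averages gives `1 + 6 + 6 = 13`. -/
theorem abs_smoothIndD₃_le_of_moment (χ : SmoothCutoff K) {φ β m : ℝ} (hφ : 0 ≤ φ) (hφβ : φ ≤ β)
    (hm : 0 < m) {x u w : ι → ℝ}
    (hu : softmaxAvg β x (fun j => |u j| ^ 3) ≤ m ^ 3)
    (hw : softmaxAvg β x (fun j => |w j| ^ 3) ≤ m ^ 3) :
    |smoothIndD₃ χ φ β u w x| ≤ 13 * K * φ * β ^ 2 * m ^ 3 := by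
  obtain ⟨e1, e2, e3, e4, e5⟩ := softmaxAvg_moments hm hu hw
  have hK : 0 ≤ K := (abs_nonneg _).trans (χ.bound₁ 0)
  have hβ : 0 ≤ β := hφ.trans hφβ
  have b1 := χ.bound₁ (φ * smoothMax β x)
  have b2 := χ.bound₂ (φ * smoothMax β x)
  have b3 := χ.bound₃ (φ * smoothMax β x)
  have f1 : |softmaxAvg β x (fun j => u j * w j) - softmaxAvg β x u * softmaxAvg β x w|
      ≤ 2 * m ^ 2 := by
    refine (abs_sub _ _).trans ?_
    rw [abs_mul]
    nlinarith [mul_le_mul e1 e2 (abs_nonneg _) hm.le]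
  have f2 : |softmaxAvg β x (fun j => u j ^ 2) - softmaxAvg β x u ^ 2| ≤ 2 * m ^ 2 := by
    refine (abs_sub _ _).trans ?_
    rw [abs_pow (softmaxAvg β x u)]
    nlinarith [pow_le_pow_left₀ (abs_nonneg _) e1 2]
  have f3 : |softmaxAvg β x u * (softmaxAvg β x (fun j => u j * w j)
      - softmaxAvg β x u * softmaxAvg β x w)| ≤ 2 * m ^ 3 := by
    rw [abs_mul]
    calc _ ≤ m * (2 * m ^ 2) := by gcongr
      _ = _ := by ring
  have f4 : |softmaxAvg β x w * (softmaxAvg β x (fun j => u j ^ 2) - softmaxAvg β x u ^ 2)|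
      ≤ 2 * m ^ 3 := by
    rw [abs_mul]
    calc _ ≤ m * (2 * m ^ 2) := by gcongr
      _ = _ := by ring
  have f5 : |softmaxAvg β x (fun j => u j ^ 2) * softmaxAvg β x w| ≤ m ^ 3 := by
    rw [abs_mul]
    calc _ ≤ m ^ 2 * m := by gcongr
      _ = _ := by ring
  have f6 : |softmaxAvg β x w * softmaxAvg β x u ^ 2| ≤ m ^ 3 := by
    rw [abs_mul, abs_pow]
    calc _ ≤ m * m ^ 2 := by gcongr
      _ = _ := by ring
  have c3 : |φ ^ 3 * χ.g₃ (φ * smoothMax β x) * (softmaxAvg β x w * softmaxAvg β x u ^ 2)|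
      ≤ φ * β ^ 2 * K * m ^ 3 := by
    rw [abs_mul, abs_mul, abs_of_nonneg (by positivity : 0 ≤ φ ^ 3)]
    have : φ ^ 3 ≤ φ * β ^ 2 := by
      rw [pow_succ' φ 2]; gcongr
    gcongr
  have c2 : |φ ^ 2 * β * χ.g₂ (φ * smoothMax β x) *
      (2 * softmaxAvg β x u * (softmaxAvg β x (fun j => u j * w j)
        - softmaxAvg β x u * softmaxAvg β x w)
      + softmaxAvg β x w * (softmaxAvg β x (fun j => u j ^ 2) - softmaxAvg β x u ^ 2))|
      ≤ φ * β ^ 2 * K * (6 * m ^ 3) := by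
    rw [abs_mul, abs_mul, abs_of_nonneg (by positivity : 0 ≤ φ ^ 2 * β)]
    have : φ ^ 2 * β ≤ φ * β ^ 2 := by
      rw [sq, sq, mul_assoc]; gcongr
    have h : |2 * softmaxAvg β x u * (softmaxAvg β x (fun j => u j * w j)
        - softmaxAvg β x u * softmaxAvg β x w)
      + softmaxAvg β x w * (softmaxAvg β x (fun j => u j ^ 2) - softmaxAvg β x u ^ 2)|
        ≤ 6 * m ^ 3 := by
      rw [abs_le] at *
      constructor <;> nlinarith
    gcongr
  have c1 : |φ * β ^ 2 * χ.g₁ (φ * smoothMax β x) *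
      (softmaxAvg β x (fun j => u j ^ 2 * w j)
        - softmaxAvg β x (fun j => u j ^ 2) * softmaxAvg β x w
      - 2 * softmaxAvg β x u * (softmaxAvg β x (fun j => u j * w j)
        - softmaxAvg β x u * softmaxAvg β x w))| ≤ φ * β ^ 2 * K * (6 * m ^ 3) := by
    rw [abs_mul, abs_mul, abs_of_nonneg (by positivity : 0 ≤ φ * β ^ 2)]
    have h : |softmaxAvg β x (fun j => u j ^ 2 * w j)
        - softmaxAvg β x (fun j => u j ^ 2) * softmaxAvg β x w
      - 2 * softmaxAvg β x u * (softmaxAvg β x (fun j => u j * w j)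
        - softmaxAvg β x u * softmaxAvg β x w)| ≤ 6 * m ^ 3 := by
      rw [abs_le] at *
      constructor <;> nlinarith
    gcongr
  refine (abs_add_le _ _).trans ((add_le_add_left (abs_add_le _ _) _).trans ?_)
  linarith

theorem abs_smoothIndD₃_le (χ : SmoothCutoff K) {φ β : ℝ} (hφ : 0 ≤ φ) (hφβ : φ ≤ β)
    (u w x : ι → ℝ) :
    |smoothIndD₃ χ φ β u w x| ≤ 13 * K * φ * β ^ 2 *
      softmaxAvg β x (fun j => |u j| ^ 3 + |w j| ^ 3) := by
  set P := softmaxAvg β x (fun j => |u j| ^ 3 + |w j| ^ 3) with hP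
  have hK : 0 ≤ K := (abs_nonneg _).trans (χ.bound₁ 0)
  have hu : softmaxAvg β x (fun j => |u j| ^ 3) ≤ P := softmaxAvg_mono fun j => by
    have := pow_nonneg (abs_nonneg (w j)) 3; linarith
  have hw : softmaxAvg β x (fun j => |w j| ^ 3) ≤ P := softmaxAvg_mono fun j => by
    have := pow_nonneg (abs_nonneg (u j)) 3; linarith
  have hP0 : 0 ≤ P := softmaxAvg_nonneg fun j => by positivity
  -- The moment bound needs a positive `m`, while `P` may vanish; hence `m ^ 3 = P + ε` and a limit.
  have key : ∀ ε : ℝ, 0 < ε → |smoothIndD₃ χ φ β u w x| ≤ 13 * K * φ * β ^ 2 * (P + ε) := by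
    intro ε hε
    have hm : ((P + ε) ^ ((1 : ℝ) / 3)) ^ 3 = P + ε := by
      rw [← Real.rpow_natCast, ← Real.rpow_mul (by linarith)]; norm_num
    have := abs_smoothIndD₃_le_of_moment χ hφ hφβ (m := (P + ε) ^ ((1 : ℝ) / 3)) (by positivity)
      (x := x) (u := u) (w := w) (by rw [hm]; linarith) (by rw [hm]; linarith)
    rwa [hm] at this
  have ht : Filter.Tendsto (fun ε : ℝ => 13 * K * φ * β ^ 2 * (P + ε)) (nhdsWithin 0 (Set.Ioi 0))
      (nhds (13 * K * φ * β ^ 2 * P)) := by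
    have : Continuous fun ε : ℝ => 13 * K * φ * β ^ 2 * (P + ε) := by fun_prop
    simpa using (this.tendsto 0).mono_left nhdsWithin_le_nhds
  exact ge_of_tendsto ht (by filter_upwards [self_mem_nhdsWithin] with ε hε using key ε hε)

/-- Because `β r ≤ 1`, the weights change by at most `exp 2` and `φ F_β` moves by at most one. A
nonzero derivative at the displaced point therefore forces the base point into the shell, and the
bound may be stated entirely at the base point. -/
theorem abs_smoothIndD₃_add_le (χ : SmoothCutoff K) {φ β r : ℝ} (hφ : 0 ≤ φ) (hφβ : φ ≤ β)
    (hβ : 0 < β) {δ : ι → ℝ} (hδ : ∀ j, |δ j| ≤ r) (hr : β * r ≤ 1) (u w x : ι → ℝ) :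
    |smoothIndD₃ χ φ β u w (fun j => x j + δ j)| ≤ 13 * Real.exp 2 * K * φ * β ^ 2 *
      softmaxAvg β x (fun j => |u j| ^ 3 + |w j| ^ 3) * (shell φ β).indicator 1 x := by
  have hK : 0 ≤ K := (abs_nonneg _).trans (χ.bound₁ 0)
  by_cases hx : x ∈ shell φ β
  · rw [Set.indicator_of_mem hx, Pi.one_apply, mul_one]
    refine (abs_smoothIndD₃_le χ hφ hφβ u w _).trans ?_
    have h1 := softmaxAvg_add_point_le hβ.le (x := x) hδ
      (a := fun j => |u j| ^ 3 + |w j| ^ 3) (fun j => by positivity)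
    have h2 : Real.exp (2 * (β * r)) ≤ Real.exp 2 := Real.exp_le_exp.2 (by linarith)
    have h3 : 0 ≤ softmaxAvg β x (fun j => |u j| ^ 3 + |w j| ^ 3) :=
      softmaxAvg_nonneg fun j => by positivity
    calc _ ≤ 13 * K * φ * β ^ 2 *
          (Real.exp 2 * softmaxAvg β x (fun j => |u j| ^ 3 + |w j| ^ 3)) := by
          gcongr
          exact h1.trans (by gcongr)
      _ = _ := by ring
  · rw [Set.indicator_of_notMem hx, mul_zero, smoothIndD₃_eq_zero, abs_zero]
    by_contra! hc
    refine hx ?_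
    have h1 := abs_smoothMax_add_sub_le hβ (x := x) hδ
    have h0 : 0 ≤ r := (abs_nonneg _).trans (hδ (Classical.arbitrary ι))
    have h2 : φ * r ≤ 1 := (mul_le_mul_of_nonneg_right hφβ h0).trans hr
    have h3 := mul_le_mul_of_nonneg_left h1 hφ
    rw [← abs_of_nonneg hφ, ← abs_mul, abs_of_nonneg hφ, abs_le] at h3
    change |φ * smoothMax β x| ≤ 3
    rw [abs_le]
    constructor <;> nlinarith

theorem abs_smoothIndD₂_add_sub_le (χ : SmoothCutoff K) {φ β h R : ℝ} (hφ : 0 ≤ φ)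
    (hφβ : φ ≤ β) (hβ : 0 < β) (hh : 0 ≤ h) {w : ι → ℝ} (hw : ∀ j, |w j| ≤ R)
    (hR : β * (h * R) ≤ 1) (u x : ι → ℝ) :
    |smoothIndD₂ χ φ β u u (fun j => x j + h * w j) - smoothIndD₂ χ φ β u u x| ≤
      13 * Real.exp 2 * K * φ * β ^ 2 *
      softmaxAvg β x (fun j => |u j| ^ 3 + |w j| ^ 3) * (shell φ β).indicator 1 x * h := by
  have hd : ∀ t ∈ Set.Icc (0 : ℝ) h, HasDerivWithinAt
      (fun s => smoothIndD₂ χ φ β u u (fun j => x j + s * w j))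
      (smoothIndD₃ χ φ β u w (fun j => x j + t * w j)) (Set.Icc 0 h) t := fun t _ =>
    (hasDerivAt_smoothIndD₂ χ hβ (x := fun s j => x j + s * w j) u
      fun j => by simpa using ((hasDerivAt_id t).mul_const (w j)).const_add (x j)).hasDerivWithinAt
  have := norm_image_sub_le_of_norm_deriv_le_segment' hd (C := 13 * Real.exp 2 * K * φ * β ^ 2 *
      softmaxAvg β x (fun j => |u j| ^ 3 + |w j| ^ 3) * (shell φ β).indicator 1 x) (fun t ht => by
    refine abs_smoothIndD₃_add_le χ hφ hφβ hβ (r := h * R) (fun j => ?_) hR u w x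
    rw [abs_mul, abs_of_nonneg ht.1]
    exact mul_le_mul ht.2.le (hw j) (abs_nonneg _) hh) h ⟨hh, le_rfl⟩
  simpa using this

/-- As a function of the step, the Taylor remainder has the increment of the second derivative as
its derivative. With `w = u` the two cubes coincide, which doubles the constant 13. -/
theorem abs_smoothIndD_add_sub_le (χ : SmoothCutoff K) {φ β h R : ℝ} (hφ : 0 ≤ φ)
    (hφβ : φ ≤ β) (hβ : 0 < β) (hh : 0 ≤ h) {u : ι → ℝ} (hu : ∀ j, |u j| ≤ R)
    (hR : β * (h * R) ≤ 1) (x : ι → ℝ) :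
    |smoothIndD χ φ β u (fun j => x j + h * u j) - smoothIndD χ φ β u x
        - h * smoothIndD₂ χ φ β u u x| ≤
      26 * Real.exp 2 * K * φ * β ^ 2 *
      softmaxAvg β x (fun j => |u j| ^ 3) * (shell φ β).indicator 1 x * h ^ 2 := by
  have hK : 0 ≤ K := (abs_nonneg _).trans (χ.bound₁ 0)
  have hR0 : 0 ≤ R := (abs_nonneg _).trans (hu (Classical.arbitrary ι))
  have hd : ∀ t ∈ Set.Icc (0 : ℝ) h, HasDerivWithinAt
      (fun s => smoothIndD χ φ β u (fun j => x j + s * u j) - s * smoothIndD₂ χ φ β u u x)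
      (smoothIndD₂ χ φ β u u (fun j => x j + t * u j) - smoothIndD₂ χ φ β u u x)
      (Set.Icc 0 h) t := fun t _ => by
    refine HasDerivAt.hasDerivWithinAt ?_
    refine (hasDerivAt_smoothIndD χ hβ (x := fun s j => x j + s * u j) u fun j => by
      simpa using ((hasDerivAt_id t).mul_const (u j)).const_add (x j)).sub ?_
    simpa using (hasDerivAt_id t).mul_const (smoothIndD₂ χ φ β u u x)
  have h2 : softmaxAvg β x (fun j => |u j| ^ 3 + |u j| ^ 3)
      = 2 * softmaxAvg β x (fun j => |u j| ^ 3) := by rw [softmaxAvg_add]; ring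
  have h3 : 0 ≤ softmaxAvg β x (fun j => |u j| ^ 3) := softmaxAvg_nonneg fun j => by positivity
  have h4 : (0 : ℝ) ≤ (shell φ β).indicator 1 x := Set.indicator_nonneg (fun _ _ => zero_le_one) _
  have := norm_image_sub_le_of_norm_deriv_le_segment' hd (C := 26 * Real.exp 2 * K * φ * β ^ 2 *
      softmaxAvg β x (fun j => |u j| ^ 3) * (shell φ β).indicator 1 x * h) (fun t ht => by
    refine (abs_smoothIndD₂_add_sub_le χ hφ hφβ hβ ht.1 hu
      (le_trans (by gcongr; exact ht.2.le) hR) u x).trans ?_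
    rw [h2]
    calc _ = 26 * Real.exp 2 * K * φ * β ^ 2 *
        softmaxAvg β x (fun j => |u j| ^ 3) * (shell φ β).indicator 1 x * t := by ring
      _ ≤ _ := by gcongr; exact ht.2.le) h ⟨hh, le_rfl⟩
  have e : smoothIndD χ φ β u (fun j => x j + h * u j) - h * smoothIndD₂ χ φ β u u x
      - (smoothIndD χ φ β u (fun j => x j + 0 * u j) - 0 * smoothIndD₂ χ φ β u u x)
      = smoothIndD χ φ β u (fun j => x j + h * u j) - smoothIndD χ φ β u x
        - h * smoothIndD₂ χ φ β u u x := by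
    simp only [zero_mul, add_zero]; ring
  rw [Real.norm_eq_abs, e] at this
  refine this.trans (le_of_eq (by ring))

end SmoothIndicator

/-! ### Gaussian regression and Stein's identity. -/

section Gaussian

variable {ι Ω' : Type*} [Fintype ι] [MeasurableSpace Ω']

/-- `G` is a centered Gaussian vector with covariance matrix `Sg`. -/
structure IsCenteredGaussian (Q : Measure Ω') (G : Ω' → ι → ℝ) (Sg : ι → ι → ℝ) : Prop where
  measurable : Measurable G
  gaussian : HasGaussianLaw G Q
  centered : ∀ j, ∫ ω, G ω j ∂Q = 0
  cov : ∀ j k, ∫ ω, G ω j * G ω k ∂Q = Sg j k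

namespace IsCenteredGaussian

variable {Q : Measure Ω'} {G : Ω' → ι → ℝ} {Sg : ι → ι → ℝ}

theorem measurable_apply (h : IsCenteredGaussian Q G Sg) (j : ι) : Measurable fun ω => G ω j :=
  (measurable_pi_apply j).comp h.measurable

theorem memLp_two (h : IsCenteredGaussian Q G Sg) (j : ι) : MemLp (fun ω => G ω j) 2 Q :=
  (HasGaussianLaw.eval (X := fun i ω => G ω i) h.gaussian j).memLp_two

theorem integrable_apply (h : IsCenteredGaussian Q G Sg) (j : ι) :
    Integrable (fun ω => G ω j) Q :=
  (HasGaussianLaw.eval (X := fun i ω => G ω i) h.gaussian j).integrable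

theorem symm (h : IsCenteredGaussian Q G Sg) (j k : ι) : Sg j k = Sg k j := by
  rw [← h.cov, ← h.cov]; simp only [mul_comm]

theorem integrable_mul (h : IsCenteredGaussian Q G Sg) (j k : ι) :
    Integrable (fun ω => G ω j * G ω k) Q := (h.memLp_two j).integrable_mul (h.memLp_two k)

/-- The second moment of `G j - G k` is nonnegative. For unit variances this says that no covariance
exceeds one, which is what makes argmax cells monotone along regression lines. -/
theorem cov_le (h : IsCenteredGaussian Q G Sg) (j k : ι) : Sg j k ≤ (Sg j j + Sg k k) / 2 := by
  have h0 : 0 ≤ ∫ ω, (G ω j - G ω k) ^ 2 ∂Q := integral_nonneg fun _ => sq_nonneg _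
  have e : ∀ ω, (G ω j - G ω k) ^ 2 = (G ω j * G ω j + G ω k * G ω k) - 2 * (G ω j * G ω k) :=
    fun ω => by ring
  simp only [e] at h0
  have i1 : Integrable (fun ω => G ω j * G ω j + G ω k * G ω k) Q :=
    (h.integrable_mul j j).add (h.integrable_mul k k)
  rw [integral_sub i1 ((h.integrable_mul j k).const_mul 2), integral_const_mul] at h0
  have e2 : ∫ ω, (G ω j * G ω j + G ω k * G ω k) ∂Q = Sg j j + Sg k k := by
    rw [integral_add (h.integrable_mul j j) (h.integrable_mul k k), h.cov, h.cov]
  rw [e2, h.cov] at h0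
  linarith

/-- A linear image of a centered Gaussian vector. -/
theorem linear_image {κ : Type*} [Fintype κ] (h : IsCenteredGaussian Q G Sg)
    (c : κ → ℝ) (e : κ → ι) : IsCenteredGaussian Q (fun ω k => c k * G ω (e k))
      (fun k l => c k * c l * Sg (e k) (e l)) where
  measurable := measurable_pi_lambda _ fun k => (h.measurable_apply (e k)).const_mul (c k)
  gaussian := by
    let L : (ι → ℝ) →L[ℝ] (κ → ℝ) :=
      ContinuousLinearMap.pi fun k => c k • ContinuousLinearMap.proj (e k)
    exact (h.gaussian.map_fun L)
  centered k := by rw [integral_const_mul, h.centered, mul_zero]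
  cov k l := by
    rw [← h.cov, ← integral_const_mul]
    congr 1; ext ω; ring

/-- The regression decomposition of a Gaussian vector along its coordinate `j`: the residual is
independent of the `j`-th coordinate. -/
theorem map_eq_map_prod (h : IsCenteredGaussian Q G Sg) {j : ι} (hj : 0 < Sg j j) :
    Q.map G = (Q.prod (gaussianReal 0 1)).map (fun z k =>
      (G z.1 k - Sg k j / Sg j j * G z.1 j) + Sg k j / √(Sg j j) * z.2) := by
  have := h.gaussian.isProbabilityMeasure
  set σ := √(Sg j j) with hσ
  have hσ0 : 0 < σ := Real.sqrt_pos.2 hj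
  have hσ2 : σ ^ 2 = Sg j j := Real.sq_sqrt hj.le
  let V : ι → Ω' → ℝ := fun k ω => G ω k - Sg k j / Sg j j * G ω j
  -- The index `Unit` is there because the covariance criterion for independence compares two
  -- families of coordinates.
  let N : Unit → Ω' → ℝ := fun _ ω => σ⁻¹ * G ω j
  have mV : Measurable fun ω k => V k ω := measurable_pi_lambda _ fun k =>
    (h.measurable_apply k).sub ((h.measurable_apply j).const_mul _)
  have mN : Measurable (N ()) := (h.measurable_apply j).const_mul _
  let L : (ι → ℝ) →L[ℝ] (ι → ℝ) × (Unit → ℝ) := ContinuousLinearMap.prod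
    (ContinuousLinearMap.pi fun k => ContinuousLinearMap.proj k -
      (Sg k j / Sg j j) • ContinuousLinearMap.proj j)
    (ContinuousLinearMap.pi fun _ => σ⁻¹ • ContinuousLinearMap.proj j)
  -- Residual and coordinate are jointly Gaussian, so it suffices that they are uncorrelated.
  have hind : IndepFun (fun ω k => V k ω) (fun ω u => N u ω) Q := by
    refine HasGaussianLaw.indepFun_of_covariance_eval (h.gaussian.map_fun L) fun k _ => ?_
    have m1 : MemLp (V k) 2 Q := (h.memLp_two k).sub ((h.memLp_two j).const_mul _)
    have m2 : MemLp (N ()) 2 Q := (h.memLp_two j).const_mul _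
    rw [covariance_eq_sub m1 m2]
    have e1 : ∫ ω, N () ω ∂Q = 0 := by
      simp only [N]; rw [integral_const_mul, h.centered, mul_zero]
    have e2 : ∫ ω, (V k * N ()) ω ∂Q = 0 := by
      have : ∀ ω, (V k * N ()) ω
          = σ⁻¹ * (G ω k * G ω j - Sg k j / Sg j j * (G ω j * G ω j)) := fun ω => by
        simp only [V, N, Pi.mul_apply]; ring
      simp only [this]
      rw [integral_const_mul, integral_sub (h.integrable_mul k j)
        ((h.integrable_mul j j).const_mul _), integral_const_mul, h.cov, h.cov,
        div_mul_cancel₀ _ hj.ne', sub_self, mul_zero]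
    change ∫ ω, (V k * N ()) ω ∂Q - _ * ∫ ω, N () ω ∂Q = 0
    rw [e2, e1]; simp
  have hind2 : IndepFun (fun ω k => V k ω) (N ()) Q :=
    hind.comp measurable_id (measurable_pi_apply ())
  have hN : Q.map (N ()) = gaussianReal 0 1 := by
    have hg : HasGaussianLaw (N ()) Q :=
      h.gaussian.map_fun (σ⁻¹ • ContinuousLinearMap.proj (R := ℝ) (φ := fun _ : ι => ℝ) j)
    rw [hg.map_eq_gaussianReal]
    have e1 : ∫ ω, N () ω ∂Q = 0 := by
      simp only [N]; rw [integral_const_mul, h.centered, mul_zero]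
    have e2 : Var[N (); Q] = 1 := by
      rw [variance_of_integral_eq_zero mN.aemeasurable e1]
      have : ∀ ω, N () ω ^ 2 = σ⁻¹ ^ 2 * (G ω j * G ω j) := fun ω => by
        simp only [N]; ring
      simp only [this]
      rw [integral_const_mul, h.cov, ← hσ2]
      field_simp
    rw [e1, e2]; simp
  have hprod := (indepFun_iff_map_prod_eq_prod_map_map mV.aemeasurable mN.aemeasurable).1 hind2
  rw [hN] at hprod
  let F : (ι → ℝ) × ℝ → ι → ℝ := fun z k => z.1 k + Sg k j / σ * z.2
  have mF : Measurable F := measurable_pi_lambda _ fun k =>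
    ((measurable_pi_apply k).comp measurable_fst).add (measurable_snd.const_mul _)
  have hG : G = F ∘ fun ω => (fun k => V k ω, N () ω) := by
    ext ω k
    simp only [F, V, N, Function.comp_apply]
    rw [← hσ2]; field_simp; ring
  have hmid : (Q.map fun ω k => V k ω).prod (gaussianReal 0 1)
      = (Q.prod (gaussianReal 0 1)).map (Prod.map (fun ω k => V k ω) id) := by
    rw [← Measure.map_prod_map _ _ mV measurable_id, Measure.map_id]
  calc Q.map G = (Q.map fun ω => (fun k => V k ω, N () ω)).map F := by
        rw [Measure.map_map mF (mV.prodMk mN), ← hG]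
    _ = _ := by
        rw [hprod, hmid, Measure.map_map mF (mV.prodMap measurable_id)]
        rfl

end IsCenteredGaussian

theorem integrable_bounded_mul_gaussianPDF {h : ℝ → ℝ} (hm : Measurable h) {c : ℝ}
    (hb : ∀ u, |h u| ≤ c) : Integrable (fun u => gaussianPDFReal 0 1 u * h u) :=
  ((integrable_gaussianPDFReal 0 1).mul_bdd hm.aestronglyMeasurable (ae_of_all _ hb))

/-- Stein's identity for the standard normal law. -/
theorem integral_id_mul_gaussianReal {ψ ψ' : ℝ → ℝ} {c c' : ℝ}
    (hd : ∀ u, HasDerivAt ψ (ψ' u) u) (hm' : Measurable ψ') (hb : ∀ u, |ψ u| ≤ c)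
    (hb' : ∀ u, |ψ' u| ≤ c') :
    ∫ u, u * ψ u ∂(gaussianReal 0 1) = ∫ u, ψ' u ∂(gaussianReal 0 1) := by
  have hcont : Continuous ψ := continuous_iff_continuousAt.2 fun u => (hd u).continuousAt
  rw [integral_gaussianReal_eq_integral_smul one_ne_zero,
    integral_gaussianReal_eq_integral_smul one_ne_zero]
  simp only [smul_eq_mul]
  have hpd : ∀ u, HasDerivAt (gaussianPDFReal 0 1) (- u * gaussianPDFReal 0 1 u) u := by
    intro u
    have h1 : HasDerivAt (fun u : ℝ => -(u - 0) ^ 2 / (2 * ((1 : NNReal) : ℝ))) (-u) u := by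
      have := (((hasDerivAt_id u).sub_const 0).pow 2).neg.div_const (2 * ((1 : NNReal) : ℝ))
      convert! this using 1
      simp only [id_eq, NNReal.coe_one, Nat.cast_ofNat, Nat.add_one_sub_one, pow_one]
      ring
    have := h1.exp.const_mul (√(2 * Real.pi * ((1 : NNReal) : ℝ)))⁻¹
    convert! this using 1
    rw [gaussianPDFReal]; ring
  have i3 : Integrable (fun u => u * gaussianPDFReal 0 1 u) := by
    have h2 := integrable_mul_exp_neg_mul_sq (b := 1 / 2) (by norm_num)
    have := h2.const_mul (√(2 * Real.pi * ((1 : NNReal) : ℝ)))⁻¹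
    refine this.congr (ae_of_all _ fun u => ?_)
    simp only [gaussianPDFReal]
    have : -(u - 0) ^ 2 / (2 * ((1 : NNReal) : ℝ)) = -(1 / 2) * u ^ 2 := by simp; ring
    rw [this]; ring
  have i2 : Integrable (fun u => - u * gaussianPDFReal 0 1 u * ψ u) := by
    refine (Integrable.mul_bdd (c := c) i3.neg hcont.measurable.aestronglyMeasurable
      (ae_of_all _ hb)).congr (ae_of_all _ fun u => ?_)
    simp
  have := integral_mul_deriv_eq_deriv_mul_of_integrable (u := gaussianPDFReal 0 1) (v := ψ)
    (fun u _ => hpd u) (fun u _ => hd u)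
    (integrable_bounded_mul_gaussianPDF hm' hb') i2
    (integrable_bounded_mul_gaussianPDF hcont.measurable hb)
  rw [this, ← integral_neg]
  congr 1; ext u; ring

end Gaussian

/-! ### Gaussian integration by parts for the smoothed indicator. -/

section GaussianIBP

variable {ι Ω' : Type*} [Fintype ι] [MeasurableSpace Ω'] {K : ℝ}

theorem continuous_g (χ : SmoothCutoff K) : Continuous χ.g :=
  continuous_iff_continuousAt.2 fun u => (χ.hasDeriv u).continuousAt

theorem continuous_g₁ (χ : SmoothCutoff K) : Continuous χ.g₁ :=
  continuous_iff_continuousAt.2 fun u => (χ.hasDeriv₁ u).continuousAt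

theorem continuous_g₂ (χ : SmoothCutoff K) : Continuous χ.g₂ :=
  continuous_iff_continuousAt.2 fun u => (χ.hasDeriv₂ u).continuousAt

theorem continuous_partitionFn (β : ℝ) : Continuous (partitionFn (ι := ι) β) := by
  unfold partitionFn; fun_prop

variable [Nonempty ι]

theorem continuous_smoothMax (β : ℝ) : Continuous (smoothMax (ι := ι) β) :=
  ((continuous_partitionFn β).log fun x => (partitionFn_pos β x).ne').div_const β

theorem continuous_softmaxWeight (β : ℝ) (j : ι) : Continuous fun x => softmaxWeight β x j := by
  unfold softmaxWeight
  exact Continuous.div (by fun_prop) (continuous_partitionFn β) fun x => (partitionFn_pos β x).ne'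

theorem continuous_softmaxAvg (β : ℝ) {a : (ι → ℝ) → ι → ℝ} (ha : ∀ j, Continuous fun x => a x j) :
    Continuous fun x => softmaxAvg β x (a x) :=
  continuous_finsetSum _ fun j _ => (continuous_softmaxWeight β j).mul (ha j)

theorem continuous_smoothInd (χ : SmoothCutoff K) (φ β : ℝ) :
    Continuous (smoothInd (ι := ι) χ φ β) :=
  (continuous_g χ).comp ((continuous_smoothMax β).const_mul φ)

theorem continuous_smoothIndD (χ : SmoothCutoff K) (φ β : ℝ) {u : (ι → ℝ) → ι → ℝ}
    (hu : ∀ j, Continuous fun x => u x j) : Continuous fun x => smoothIndD χ φ β (u x) x :=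
  (continuous_const.mul ((continuous_g₁ χ).comp ((continuous_smoothMax β).const_mul φ))).mul
    (continuous_softmaxAvg β hu)

theorem continuous_smoothIndD₂ (χ : SmoothCutoff K) (φ β : ℝ) (u w : ι → ℝ) :
    Continuous (smoothIndD₂ χ φ β u w) := by
  have h1 := (continuous_g₁ χ).comp ((continuous_smoothMax (ι := ι) β).const_mul φ)
  have h2 := (continuous_g₂ χ).comp ((continuous_smoothMax (ι := ι) β).const_mul φ)
  have hc : ∀ a : ι → ℝ, Continuous fun x => softmaxAvg β x a := fun a =>
    continuous_softmaxAvg β fun _ => continuous_const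
  exact ((h2.const_mul _).mul ((hc u).mul (hc w))).add
    ((h1.const_mul _).mul ((hc _).sub ((hc u).mul (hc w))))

theorem continuous_smoothIndTr (χ : SmoothCutoff K) (φ β : ℝ) (Γ : ι → ι → ℝ) :
    Continuous (smoothIndTr χ φ β Γ) := by
  have h1 := (continuous_g₁ χ).comp ((continuous_smoothMax (ι := ι) β).const_mul φ)
  have h2 := (continuous_g₂ χ).comp ((continuous_smoothMax (ι := ι) β).const_mul φ)
  have hc : ∀ a : ι → ℝ, Continuous fun x => softmaxAvg β x a := fun a =>
    continuous_softmaxAvg β fun _ => continuous_const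
  have hcc := continuous_softmaxAvg β (a := fun x j => softmaxAvg β x (Γ j)) fun j => hc (Γ j)
  exact ((h2.const_mul _).mul hcc).add ((h1.const_mul _).mul ((hc _).sub hcc))

theorem measurableSet_shell (φ β : ℝ) : MeasurableSet (shell (ι := ι) φ β) :=
  (isClosed_le ((continuous_smoothMax β).const_mul φ).abs continuous_const).measurableSet

theorem abs_softmaxAvg_le_norm (β : ℝ) (x a : ι → ℝ) : |softmaxAvg β x a| ≤ ‖a‖ := by
  have := (abs_softmaxAvg_le β x a).trans (softmaxAvg_mono fun j => norm_le_pi_norm a j)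
  rwa [softmaxAvg_const] at this

theorem exists_bound_smoothIndD₂ (χ : SmoothCutoff K) (φ β : ℝ) (u w : ι → ℝ) :
    ∃ c, ∀ x, |smoothIndD₂ χ φ β u w x| ≤ c := by
  have hK : 0 ≤ K := (abs_nonneg _).trans (χ.bound₁ 0)
  refine ⟨φ ^ 2 * K * (‖u‖ * ‖w‖) + |φ * β| * K * (‖fun j => u j * w j‖ + ‖u‖ * ‖w‖),
    fun x => ?_⟩
  have h1 := abs_softmaxAvg_le_norm β x u
  have h2 := abs_softmaxAvg_le_norm β x w
  have h3 := abs_softmaxAvg_le_norm β x (fun j => u j * w j)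
  have b1 := χ.bound₁ (φ * smoothMax β x)
  have b2 := χ.bound₂ (φ * smoothMax β x)
  have h4 : |softmaxAvg β x u * softmaxAvg β x w| ≤ ‖u‖ * ‖w‖ := by rw [abs_mul]; gcongr
  refine (abs_add_le _ _).trans (add_le_add ?_ ?_)
  · rw [abs_mul, abs_mul, abs_of_nonneg (sq_nonneg φ)]
    gcongr
  · rw [abs_mul, abs_mul]
    have := (abs_sub (softmaxAvg β x (fun j => u j * w j)) _).trans (add_le_add h3 h4)
    gcongr

theorem smoothIndD₂_const_mul_right (χ : SmoothCutoff K) (φ β c : ℝ) (u w x : ι → ℝ) :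
    smoothIndD₂ χ φ β u (fun j => c * w j) x = c * smoothIndD₂ χ φ β u w x := by
  have : (fun j => u j * (c * w j)) = fun j => c * (u j * w j) := by ext j; ring
  simp only [smoothIndD₂, this, softmaxAvg_const_mul]
  ring

theorem sum_smoothIndD_single [DecidableEq ι] (χ : SmoothCutoff K) (φ β : ℝ) (u x : ι → ℝ) :
    ∑ j, u j * smoothIndD χ φ β (Pi.single j 1) x = smoothIndD χ φ β u x := by
  simp only [smoothIndD, softmaxAvg, Pi.single_apply, mul_ite, mul_one, mul_zero,
    Finset.sum_ite_eq', Finset.mem_univ, if_true, Finset.mul_sum]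
  exact Finset.sum_congr rfl fun j _ => by ring

theorem sum_smoothIndD₂_single [DecidableEq ι] (χ : SmoothCutoff K) (φ β : ℝ) (Γ : ι → ι → ℝ)
    (x : ι → ℝ) : ∑ j, smoothIndD₂ χ φ β (Pi.single j 1) (Γ j) x = smoothIndTr χ φ β Γ x := by
  have h1 : ∀ j, softmaxAvg β x (Pi.single j 1) = softmaxWeight β x j := fun j => by
    simp [softmaxAvg, Pi.single_apply]
  have h2 : ∀ j, softmaxAvg β x (fun k => (Pi.single j 1 : ι → ℝ) k * Γ j k)
      = softmaxWeight β x j * Γ j j := fun j => by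
    simp [softmaxAvg, Pi.single_apply]
  simp only [smoothIndD₂, h1, h2, Finset.sum_add_distrib, ← Finset.mul_sum,
    Finset.sum_sub_distrib]
  rfl

namespace IsCenteredGaussian

variable {Q : Measure Ω'} {G : Ω' → ι → ℝ} {Sg : ι → ι → ℝ}

theorem integral_comp_eq (h : IsCenteredGaussian Q G Sg) {j : ι} (hj : 0 < Sg j j)
    {F : (ι → ℝ) → ℝ} (hF : Measurable F) (hi : Integrable (fun ω => F (G ω)) Q) :
    ∫ ω, F (G ω) ∂Q = ∫ ω, ∫ u, F (fun k =>
      (G ω k - Sg k j / Sg j j * G ω j) + Sg k j / √(Sg j j) * u) ∂(gaussianReal 0 1) ∂Q := by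
  have := h.gaussian.isProbabilityMeasure
  have hmap := h.map_eq_map_prod hj
  have mT : Measurable fun (z : Ω' × ℝ) (k : ι) =>
      (G z.1 k - Sg k j / Sg j j * G z.1 j) + Sg k j / √(Sg j j) * z.2 :=
    measurable_pi_lambda _ fun k => (((h.measurable_apply k).comp measurable_fst).sub
      (((h.measurable_apply j).comp measurable_fst).const_mul _)).add (measurable_snd.const_mul _)
  have hi2 : Integrable F (Q.map G) :=
    (integrable_map_measure hF.aestronglyMeasurable h.measurable.aemeasurable).2 hi
  rw [← integral_map h.measurable.aemeasurable hF.aestronglyMeasurable, hmap,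
    integral_map mT.aemeasurable hF.aestronglyMeasurable, integral_prod]
  rw [hmap, integrable_map_measure hF.aestronglyMeasurable mT.aemeasurable] at hi2
  exact hi2

theorem continuous_shift (c : ι → ℝ) (a : ℝ) :
    Continuous fun (x : ι → ℝ) (k : ι) => c k + a * x k := by fun_prop

/-- Given the regression residual along `j`, only a standard normal `u` remains, and the point moves
in direction `Sg k j / σ`. Stein's identity in `u` produces a derivative along row `j` of the
covariance; the `σ` from the coordinate cancels the `1 / σ` of the direction. -/
theorem integral_coord_mul_smoothIndD [DecidableEq ι] (h : IsCenteredGaussian Q G Sg)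
    (χ : SmoothCutoff K) {φ β : ℝ} (hφ : 0 ≤ φ) (hβ : 0 < β) (a : ℝ) (c : ι → ℝ) {j : ι}
    (hj : 0 < Sg j j) :
    ∫ ω, G ω j * smoothIndD χ φ β (Pi.single j 1) (fun k => c k + a * G ω k) ∂Q =
      a * ∫ ω, smoothIndD₂ χ φ β (Pi.single j 1) (Sg j) (fun k => c k + a * G ω k) ∂Q := by
  have := h.gaussian.isProbabilityMeasure
  set e : ι → ℝ := Pi.single j 1 with he
  have hD : Continuous fun x : ι → ℝ => smoothIndD χ φ β e (fun k => c k + a * x k) :=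
    (continuous_smoothIndD χ φ β (u := fun _ => e) fun _ => continuous_const).comp
      (continuous_shift c a)
  have hDb : ∀ x, |smoothIndD χ φ β e x| ≤ φ * K * 1 := abs_smoothIndD_le χ hφ fun k => by
    rw [he, Pi.single_apply]; split_ifs <;> simp
  have hD2 : Continuous fun x : ι → ℝ => smoothIndD₂ χ φ β e (Sg j) (fun k => c k + a * x k) :=
    (continuous_smoothIndD₂ χ φ β e (Sg j)).comp (continuous_shift c a)
  obtain ⟨B, hB⟩ := exists_bound_smoothIndD₂ χ φ β e (Sg j)
  have i1 : Integrable (fun ω => G ω j * smoothIndD χ φ β e (fun k => c k + a * G ω k)) Q :=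
    Integrable.mul_bdd (c := φ * K * 1) (h.integrable_apply j)
      (hD.measurable.comp h.measurable).aestronglyMeasurable (ae_of_all _ fun ω => hDb _)
  have i2 : Integrable (fun ω => smoothIndD₂ χ φ β e (Sg j) (fun k => c k + a * G ω k)) Q :=
    Integrable.of_bound (hD2.measurable.comp h.measurable).aestronglyMeasurable B
      (ae_of_all _ fun ω => hB _)
  rw [h.integral_comp_eq hj
      (F := fun x => x j * smoothIndD χ φ β e (fun k => c k + a * x k))
      ((continuous_apply j).mul hD).measurable i1,
    h.integral_comp_eq hj
      (F := fun x => smoothIndD₂ χ φ β e (Sg j) (fun k => c k + a * x k)) hD2.measurable i2,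
    ← integral_const_mul]
  congr 1; ext ω
  set σ := √(Sg j j) with hσ
  have hσ0 : 0 < σ := Real.sqrt_pos.2 hj
  have hσ2 : σ * σ = Sg j j := Real.mul_self_sqrt hj.le
  set V : ι → ℝ := fun k => G ω k - Sg k j / Sg j j * G ω j with hV
  -- The residual vanishes at `j` itself, so coordinate `j` is exactly `σ * u`.
  have hVj : V j = 0 := by simp only [hV, div_self hj.ne']; ring
  obtain ⟨B', hB'⟩ := exists_bound_smoothIndD₂ χ φ β e (fun k => a * (Sg k j / σ))
  have hψ : ∀ u : ℝ, HasDerivAt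
      (fun u : ℝ => smoothIndD χ φ β e (fun k => c k + a * (V k + Sg k j / σ * u)))
      (smoothIndD₂ χ φ β e (fun k => a * (Sg k j / σ)) (fun k => c k + a * (V k + Sg k j / σ * u)))
      u := fun u =>
    hasDerivAt_smoothIndD χ hβ (x := fun u k => c k + a * (V k + Sg k j / σ * u)) e fun k => by
      simpa using ((((hasDerivAt_id u).const_mul (Sg k j / σ)).const_add (V k)).const_mul
        a).const_add (c k)
  have hcont : Continuous fun u : ℝ => smoothIndD₂ χ φ β e (fun k => a * (Sg k j / σ))
      (fun k => c k + a * (V k + Sg k j / σ * u)) :=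
    (continuous_smoothIndD₂ χ φ β e _).comp (by fun_prop)
  have st := integral_id_mul_gaussianReal hψ hcont.measurable (fun u => hDb _) (fun u => hB' _)
  have hj' : Sg j j / σ = σ := by rw [← hσ2]; field_simp
  have l1 : ∀ u : ℝ, (V j + Sg j j / σ * u) *
      smoothIndD χ φ β e (fun k => c k + a * (V k + Sg k j / σ * u))
      = σ * (u * smoothIndD χ φ β e (fun k => c k + a * (V k + Sg k j / σ * u))) := fun u => by
    rw [hVj, hj']; ring
  have l2 : (fun k => a * (Sg k j / σ)) = fun k => (a / σ) * Sg j k := by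
    ext k; rw [h.symm k j]; ring
  change ∫ u, (V j + Sg j j / σ * u) *
      smoothIndD χ φ β e (fun k => c k + a * (V k + Sg k j / σ * u)) ∂(gaussianReal 0 1) =
    a * ∫ u, smoothIndD₂ χ φ β e (Sg j) (fun k => c k + a * (V k + Sg k j / σ * u))
      ∂(gaussianReal 0 1)
  simp only [l1]
  rw [integral_const_mul, st, l2]
  simp only [smoothIndD₂_const_mul_right]
  rw [integral_const_mul, ← mul_assoc, mul_div_cancel₀ _ hσ0.ne']

theorem integral_smoothIndD (h : IsCenteredGaussian Q G Sg)
    (χ : SmoothCutoff K) {φ β : ℝ} (hφ : 0 ≤ φ) (hβ : 0 < β) (a : ℝ) (c : ι → ℝ)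
    (hj : ∀ j, 0 < Sg j j) :
    ∫ ω, smoothIndD χ φ β (G ω) (fun k => c k + a * G ω k) ∂Q =
      a * ∫ ω, smoothIndTr χ φ β Sg (fun k => c k + a * G ω k) ∂Q := by
  classical
  have := h.gaussian.isProbabilityMeasure
  simp only [← sum_smoothIndD_single χ φ β (G _), ← sum_smoothIndD₂_single χ φ β Sg]
  have hD : ∀ j, Continuous fun x : ι → ℝ =>
      smoothIndD χ φ β (Pi.single j 1) (fun k => c k + a * x k) := fun j =>
    (continuous_smoothIndD χ φ β (u := fun _ => Pi.single j 1) fun _ => continuous_const).comp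
      (continuous_shift c a)
  rw [integral_finsetSum, integral_finsetSum, Finset.mul_sum]
  · exact Finset.sum_congr rfl fun j _ => h.integral_coord_mul_smoothIndD χ hφ hβ a c (hj j)
  · intro j _
    obtain ⟨B, hB⟩ := exists_bound_smoothIndD₂ χ φ β (Pi.single j 1) (Sg j)
    exact Integrable.of_bound (((continuous_smoothIndD₂ χ φ β _ (Sg j)).comp
      (continuous_shift c a)).measurable.comp h.measurable).aestronglyMeasurable B
      (ae_of_all _ fun ω => hB _)
  · intro j _
    exact Integrable.mul_bdd (c := φ * K * 1) (h.integrable_apply j)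
      ((hD j).measurable.comp h.measurable).aestronglyMeasurable
      (ae_of_all _ fun ω => abs_smoothIndD_le χ hφ (fun k => by
        rw [Pi.single_apply]; split_ifs <;> simp) _)

end IsCenteredGaussian

end GaussianIBP

/-! ### Anti-concentration: Nazarov's inequality. -/

section AntiConcentration

theorem gaussianPDFReal_std (u : ℝ) :
    gaussianPDFReal 0 1 u = (√(2 * Real.pi))⁻¹ * Real.exp (-u ^ 2 / 2) := by
  simp [gaussianPDFReal]

theorem gaussianReal_le_of_pdf_le {s : Set ℝ} (hs : MeasurableSet s) {c : ℝ}
    (h : ∀ u ∈ s, gaussianPDFReal 0 1 u ≤ c) :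
    gaussianReal 0 1 s ≤ ENNReal.ofReal c * volume s := by
  rw [gaussianReal_apply _ one_ne_zero, ← setLIntegral_const]
  exact setLIntegral_mono' hs fun u hu => ENNReal.ofReal_le_ofReal (h u hu)

theorem le_gaussianReal_of_le_pdf {s : Set ℝ} (hs : MeasurableSet s) {c : ℝ}
    (h : ∀ u ∈ s, c ≤ gaussianPDFReal 0 1 u) :
    ENNReal.ofReal c * volume s ≤ gaussianReal 0 1 s := by
  rw [gaussianReal_apply _ one_ne_zero, ← setLIntegral_const]
  exact setLIntegral_mono' hs fun u hu => ENNReal.ofReal_le_ofReal (h u hu)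

theorem gaussianReal_Icc_le (y : ℝ) {w c : ℝ} (hc : 0 ≤ c) (hy : 0 ≤ y)
    (h : Real.exp (-y ^ 2 / 2) ≤ c) :
    gaussianReal 0 1 (Set.Icc y (y + w)) ≤ ENNReal.ofReal (c * w) := by
  refine (gaussianReal_le_of_pdf_le measurableSet_Icc (c := c) fun u hu => ?_).trans ?_
  · rw [gaussianPDFReal_std]
    have h1 : (√(2 * Real.pi))⁻¹ ≤ 1 := by
      refine inv_le_one_of_one_le₀ (Real.one_le_sqrt.2 ?_)
      nlinarith [Real.pi_gt_three]
    have h2 : Real.exp (-u ^ 2 / 2) ≤ Real.exp (-y ^ 2 / 2) := by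
      refine Real.exp_le_exp.2 ?_
      have := pow_le_pow_left₀ hy hu.1 2
      linarith
    calc _ ≤ 1 * Real.exp (-u ^ 2 / 2) := by gcongr
      _ ≤ c := by linarith
  · rw [Real.volume_Icc, ← ENNReal.ofReal_mul hc]
    exact ENNReal.ofReal_le_ofReal (le_of_eq (by ring))

/-- The hazard rate of the standard normal law is at most linear. -/
theorem gaussianReal_Icc_le_mul_Ioi {θ τ w : ℝ} (hτ : 1 ≤ τ) (hθ : θ ≤ 2 * τ) (hw : 0 ≤ w) :
    gaussianReal 0 1 (Set.Icc θ (θ + w)) ≤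
      ENNReal.ofReal (Real.exp 3 * w * τ) * gaussianReal 0 1 (Set.Ioi θ) := by
  -- On `[θ, ∞)` the density is largest at `s`.
  set s := max θ 0 with hs
  have hs0 : 0 ≤ s := le_max_right _ _
  have hs2 : s ≤ 2 * τ := max_le hθ (by linarith)
  have hτ0 : 0 < τ := by linarith
  set p := gaussianPDFReal 0 1 s with hp
  have hp0 : 0 < p := gaussianPDFReal_pos _ _ _ one_ne_zero
  have h1 : gaussianReal 0 1 (Set.Icc θ (θ + w)) ≤ ENNReal.ofReal (p * w) := by
    refine (gaussianReal_le_of_pdf_le measurableSet_Icc (c := p) fun u hu => ?_).trans ?_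
    · rw [hp, gaussianPDFReal_std, gaussianPDFReal_std]
      gcongr ?_ * Real.exp ?_
      have : s ^ 2 ≤ u ^ 2 := by
        rcases le_total θ 0 with h | h
        · rw [hs, max_eq_right h]; exact (by norm_num : (0:ℝ) ^ 2 = 0).symm ▸ sq_nonneg u
        · rw [hs, max_eq_left h]; exact pow_le_pow_left₀ h hu.1 2
      linarith
    · rw [Real.volume_Icc, ← ENNReal.ofReal_mul hp0.le]
      exact ENNReal.ofReal_le_ofReal (le_of_eq (by ring))
  have h2 : ENNReal.ofReal (p * Real.exp (-3) * τ⁻¹) ≤ gaussianReal 0 1 (Set.Ioi θ) := by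
    -- On this window the density falls by a factor of at most `exp (5 / 2)`, since `s ≤ 2 τ` and `τ
    -- ≥ 1`; this is within `exp 3`.
    have hsub : Set.Ioc s (s + τ⁻¹) ⊆ Set.Ioi θ := fun u hu => (le_max_left θ 0).trans_lt hu.1
    refine le_trans ?_ (measure_mono hsub)
    refine le_trans ?_ (le_gaussianReal_of_le_pdf measurableSet_Ioc (c := p * Real.exp (-3))
      fun u hu => ?_)
    · rw [Real.volume_Ioc, ← ENNReal.ofReal_mul (mul_pos hp0 (Real.exp_pos _)).le]
      exact ENNReal.ofReal_le_ofReal (le_of_eq (by ring))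
    · rw [hp, gaussianPDFReal_std, gaussianPDFReal_std, mul_assoc, ← Real.exp_add]
      gcongr ?_ * Real.exp ?_
      have hi : τ⁻¹ ≤ 1 := inv_le_one_of_one_le₀ hτ
      have hi0 : 0 < τ⁻¹ := by positivity
      have hst : s * τ⁻¹ ≤ 2 := by
        calc s * τ⁻¹ ≤ 2 * τ * τ⁻¹ := by gcongr
          _ = 2 := by field_simp
      have hu2 : u ^ 2 ≤ (s + τ⁻¹) ^ 2 := pow_le_pow_left₀ (hs0.trans hu.1.le) hu.2 2
      nlinarith
  calc _ ≤ ENNReal.ofReal (p * w) := h1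
    _ = ENNReal.ofReal (Real.exp 3 * w * τ) * ENNReal.ofReal (p * Real.exp (-3) * τ⁻¹) := by
      rw [← ENNReal.ofReal_mul (by positivity), Real.exp_neg]
      congr 1
      have := (Real.exp_pos 3).ne'
      field_simp
    _ ≤ _ := by gcongr

/-- The part of `U` above `y` is a half line with end point `θ`, up to that point, so the hazard
bound applies. If `U` meets the window then `θ ≤ y + w ≤ τ + 1 ≤ 2 τ`, as that bound requires. -/
theorem gaussianReal_upperSet_inter_Icc_le {U : Set ℝ} (hU : IsUpperSet U) {y τ w : ℝ}
    (hτ : 1 ≤ τ) (hy : y ≤ τ) (hw : 0 ≤ w) (hw1 : w ≤ 1) :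
    gaussianReal 0 1 (U ∩ Set.Icc y (y + w)) ≤
      ENNReal.ofReal (Real.exp 3 * w * τ) * gaussianReal 0 1 U := by
  rcases (U ∩ Set.Icc y (y + w)).eq_empty_or_nonempty with he | ⟨u₀, hu₀U, hu₀⟩
  · rw [he]; simp
  set H := U ∩ Set.Ici y with hH
  have hne : H.Nonempty := ⟨u₀, hu₀U, hu₀.1⟩
  have hbdd : BddBelow H := ⟨y, fun u hu => hu.2⟩
  set θ := sInf H with hθ
  have hyθ : y ≤ θ := le_csInf hne fun u hu => hu.2
  have hθu : θ ≤ u₀ := csInf_le hbdd ⟨hu₀U, hu₀.1⟩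
  have hsub : U ∩ Set.Icc y (y + w) ⊆ Set.Icc θ (θ + w) := fun u hu =>
    ⟨csInf_le hbdd ⟨hu.1, hu.2.1⟩, by linarith [hu.2.2]⟩
  have hsub2 : Set.Ioi θ ⊆ U := fun u hu => by
    obtain ⟨v, hv, hvu⟩ := exists_lt_of_csInf_lt hne hu
    exact hU hvu.le hv.1
  refine (measure_mono hsub).trans ((gaussianReal_Icc_le_mul_Ioi hτ ?_ hw).trans ?_)
  · linarith [hu₀.2]
  · gcongr

variable {ι Ω' : Type*} [Fintype ι] [MeasurableSpace Ω']

/-- The cell of points whose coordinate `j` is the first to attain `max_k (x_k - y_k)`. -/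
def argmaxCell (e : ι → ℕ) (y : ι → ℝ) (j : ι) : Set (ι → ℝ) :=
  {x | ∀ k, x k - y k < x j - y j ∨ (x k - y k = x j - y j ∧ e j ≤ e k)}

theorem measurableSet_argmaxCell (e : ι → ℕ) (y : ι → ℝ) (j : ι) :
    MeasurableSet (argmaxCell e y j) := by
  have : argmaxCell e y j = ⋂ k, ({x : ι → ℝ | x k - y k < x j - y j} ∪
      ({x : ι → ℝ | x k - y k = x j - y j} ∩ {_x | e j ≤ e k})) := by
    ext x; simp [argmaxCell]
  rw [this]
  refine MeasurableSet.iInter fun k => ?_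
  refine (measurableSet_lt (by fun_prop) (by fun_prop)).union
    ((measurableSet_eq_fun (by fun_prop) (by fun_prop)).inter (MeasurableSet.const _))

/-- Ties are broken by the injective labels `e`, so the cells are exactly disjoint and the
covariance matrix may be degenerate. -/
theorem pairwise_disjoint_argmaxCell {e : ι → ℕ} (he : Function.Injective e) (y : ι → ℝ) :
    Pairwise (Function.onFun Disjoint (argmaxCell e y)) := by
  intro i j hij
  refine Set.disjoint_left.2 fun x hi hj => hij (he ?_)
  rcases hi j with h1 | h1 <;> rcases hj i with h2 | h2
  · linarith
  · linarith [h2.1]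
  · linarith [h1.1]
  · exact le_antisymm h1.2 h2.2

theorem exists_mem_argmaxCell [Nonempty ι] (e : ι → ℕ) (y x : ι → ℝ) :
    ∃ j, x ∈ argmaxCell e y j := by
  obtain ⟨m, -, hm⟩ := Finset.exists_max_image Finset.univ (fun k => x k - y k)
    Finset.univ_nonempty
  obtain ⟨j, hj, hjm⟩ := Finset.exists_min_image
    (Finset.univ.filter fun k => x k - y k = x m - y m) e ⟨m, by simp⟩
  rw [Finset.mem_filter] at hj
  refine ⟨j, fun k => ?_⟩
  rcases (hm k (Finset.mem_univ k)).lt_or_eq with h | h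
  · left; rw [hj.2]; exact h
  · right; exact ⟨by rw [hj.2, h], hjm k (by simp [h])⟩

/-- Coordinate `j` has the largest slope, so as `u` grows it gains on every competitor. A tie
persists only when the slopes agree, and then the label comparison is unchanged. -/
theorem isUpperSet_argmaxCell_slice (e : ι → ℕ) (y : ι → ℝ) {j : ι} {v r : ι → ℝ}
    (hr : ∀ k, r k ≤ r j) : IsUpperSet {u : ℝ | (fun k => v k + r k * u) ∈ argmaxCell e y j} := by
  intro u u' huu' hu k
  have h1 : 0 ≤ (r j - r k) * (u' - u) := mul_nonneg (by linarith [hr k]) (by linarith)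
  rcases hu k with h | ⟨h, h'⟩
  · left; simp only at h ⊢; nlinarith
  · simp only at h ⊢
    rcases h1.lt_or_eq with h1 | h1
    · left; nlinarith
    · right; exact ⟨by linarith, h'⟩

namespace IsCenteredGaussian

variable {Q : Measure Ω'} {G : Ω' → ι → ℝ} {Sg : ι → ι → ℝ}

theorem measure_preimage_eq_lintegral (h : IsCenteredGaussian Q G Sg) {j : ι} (hj : 0 < Sg j j)
    {E : Set (ι → ℝ)} (hE : MeasurableSet E) :
    Q (G ⁻¹' E) = ∫⁻ ω, gaussianReal 0 1 {u | (fun k =>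
      (G ω k - Sg k j / Sg j j * G ω j) + Sg k j / √(Sg j j) * u) ∈ E} ∂Q := by
  have := h.gaussian.isProbabilityMeasure
  have mT : Measurable fun (z : Ω' × ℝ) (k : ι) =>
      (G z.1 k - Sg k j / Sg j j * G z.1 j) + Sg k j / √(Sg j j) * z.2 :=
    measurable_pi_lambda _ fun k => (((h.measurable_apply k).comp measurable_fst).sub
      (((h.measurable_apply j).comp measurable_fst).const_mul _)).add (measurable_snd.const_mul _)
  rw [← Measure.map_apply h.measurable hE, h.map_eq_map_prod hj, Measure.map_apply mT hE,
    Measure.prod_apply (mT hE)]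
  rfl

/-- Conditionally on the residual along `j`, the cell is an upper set in the remaining normal
variable, because with unit variances the slopes are correlations. The factor `Q (G ⁻¹' argmaxCell e
y j)` is kept on the right so that summing over the disjoint cells costs nothing. -/
theorem measure_cell_le (h : IsCenteredGaussian Q G Sg) (h1 : ∀ j, Sg j j = 1) (e : ι → ℕ)
    (y : ι → ℝ) {j : ι} {τ w : ℝ} (hτ : 1 ≤ τ) (hy : y j ≤ τ) (hw : 0 ≤ w) (hw1 : w ≤ 1) :
    Q (G ⁻¹' (argmaxCell e y j ∩ {x | x j ∈ Set.Icc (y j) (y j + w)})) ≤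
      ENNReal.ofReal (Real.exp 3 * w * τ) * Q (G ⁻¹' argmaxCell e y j) := by
  have hj : 0 < Sg j j := by rw [h1]; exact one_pos
  have hm := measurableSet_argmaxCell e y j
  have hS : MeasurableSet {x : ι → ℝ | x j ∈ Set.Icc (y j) (y j + w)} :=
    measurable_pi_apply j measurableSet_Icc
  rw [h.measure_preimage_eq_lintegral hj hm, h.measure_preimage_eq_lintegral hj
    (hm.inter hS), ← lintegral_const_mul']
  · refine lintegral_mono fun ω => ?_
    refine le_trans (measure_mono ?_) (gaussianReal_upperSet_inter_Icc_le
      (isUpperSet_argmaxCell_slice e y (j := j)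
        (v := fun k => G ω k - Sg k j / Sg j j * G ω j) (r := fun k => Sg k j / √(Sg j j))
        fun k => ?_) hτ hy hw hw1)
    · rintro u ⟨hu1, hu2⟩
      refine ⟨hu1, ?_⟩
      simpa [h1] using hu2
    · have := h.cov_le k j
      rw [h1, h1] at this
      simp only [h1]
      norm_num at this ⊢
      exact this
  · exact ENNReal.ofReal_ne_top

theorem measure_coord_le (h : IsCenteredGaussian Q G Sg) (h1 : ∀ j, Sg j j = 1) {j : ι}
    {y w c : ℝ} (hc : 0 ≤ c) (hy : 0 ≤ y) (hyc : Real.exp (-y ^ 2 / 2) ≤ c) :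
    Q (G ⁻¹' {x | x j ∈ Set.Icc y (y + w)}) ≤ ENNReal.ofReal (c * w) := by
  have := h.gaussian.isProbabilityMeasure
  have hj : 0 < Sg j j := by rw [h1]; exact one_pos
  have hS : MeasurableSet {x : ι → ℝ | x j ∈ Set.Icc y (y + w)} :=
    measurable_pi_apply j measurableSet_Icc
  rw [h.measure_preimage_eq_lintegral hj hS]
  calc _ ≤ ∫⁻ _ω, ENNReal.ofReal (c * w) ∂Q := lintegral_mono fun ω => by
        refine le_trans (measure_mono ?_) (gaussianReal_Icc_le y hc hy hyc)
        intro u hu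
        simpa [h1] using hu
    _ = _ := by simp

/-- Nazarov's inequality for unit variances and short intervals. -/
theorem nazarov_unit [Nonempty ι] (h : IsCenteredGaussian Q G Sg) (h1 : ∀ j, Sg j j = 1)
    (y : ι → ℝ) {ℓ w : ℝ} (hℓ : 1 ≤ ℓ) (hcard : Real.log (Fintype.card ι) ≤ ℓ) (hw : 0 ≤ w)
    (hw1 : w ≤ 1) :
    Q {ω | (∀ j, G ω j ≤ y j + w) ∧ ∃ j, y j ≤ G ω j} ≤
      ENNReal.ofReal (3 * Real.exp 3 * w * √ℓ) := by
  have := h.gaussian.isProbabilityMeasure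
  let e : ι → ℕ := fun i => Fintype.equivFin ι i
  have he : Function.Injective e := Fin.val_injective.comp (Fintype.equivFin ι).injective
  -- With this choice `exp (-τ ^ 2 / 2) = exp (-ℓ)` is at most one over the dimension. Thresholds
  -- below `τ` use the cell bound, and thresholds above `τ` a plain union bound.
  set τ := √(2 * ℓ) with hτ
  have hτ1 : 1 ≤ τ := Real.one_le_sqrt.2 (by linarith)
  have hτ2 : τ ^ 2 = 2 * ℓ := Real.sq_sqrt (by linarith)
  have hcp : (0 : ℝ) < Fintype.card ι := by exact_mod_cast Fintype.card_pos
  set c := Real.exp (-ℓ) with hc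
  let Cell := argmaxCell e y
  have hsub : {ω | (∀ j, G ω j ≤ y j + w) ∧ ∃ j, y j ≤ G ω j} ⊆
      ⋃ j, G ⁻¹' (Cell j ∩ {x | x j ∈ Set.Icc (y j) (y j + w)}) := by
    rintro ω ⟨ha, k, hk⟩
    obtain ⟨j, hj⟩ := exists_mem_argmaxCell e y (G ω)
    refine Set.mem_iUnion.2 ⟨j, hj, ?_, ha j⟩
    rcases hj k with h | ⟨h, -⟩ <;> linarith
  have hb : ∀ j, Q (G ⁻¹' (Cell j ∩ {x | x j ∈ Set.Icc (y j) (y j + w)})) ≤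
      ENNReal.ofReal (Real.exp 3 * w * τ) * Q (G ⁻¹' Cell j) + ENNReal.ofReal (c * w) := by
    intro j
    rcases le_total (y j) τ with hy | hy
    · exact (h.measure_cell_le h1 e y hτ1 hy hw hw1).trans le_self_add
    · refine le_trans (measure_mono (Set.preimage_mono Set.inter_subset_right))
        ((h.measure_coord_le h1 (Real.exp_pos _).le (by linarith) ?_).trans le_add_self)
      refine Real.exp_le_exp.2 ?_
      have := pow_le_pow_left₀ (by linarith) hy 2
      linarith
  have hsum : ∑ j, Q (G ⁻¹' Cell j) ≤ 1 := by
    rw [← tsum_fintype (L := .unconditional _), ← measure_iUnion]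
    · exact prob_le_one
    · intro i j hij
      exact (pairwise_disjoint_argmaxCell he y hij).preimage G
    · exact fun j => h.measurable (measurableSet_argmaxCell e y j)
  calc _ ≤ ∑ j, Q (G ⁻¹' (Cell j ∩ {x | x j ∈ Set.Icc (y j) (y j + w)})) :=
        (measure_mono hsub).trans (measure_iUnion_fintype_le _ _)
    _ ≤ ∑ j, (ENNReal.ofReal (Real.exp 3 * w * τ) * Q (G ⁻¹' Cell j) + ENNReal.ofReal (c * w)) :=
        Finset.sum_le_sum fun j _ => hb j
    _ ≤ ENNReal.ofReal (Real.exp 3 * w * τ) * 1 + ENNReal.ofReal (Fintype.card ι * (c * w)) := by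
        rw [Finset.sum_add_distrib, ← Finset.mul_sum, Finset.sum_const, Finset.card_univ,
          ENNReal.ofReal_mul hcp.le, ENNReal.ofReal_natCast, nsmul_eq_mul]
        gcongr
    _ ≤ _ := by
        rw [mul_one, ← ENNReal.ofReal_add (by positivity) (by positivity)]
        refine ENNReal.ofReal_le_ofReal ?_
        have h2 : Fintype.card ι * c ≤ 1 := by
          rw [hc, Real.exp_neg, ← div_eq_mul_inv, div_le_one (Real.exp_pos _)]
          rwa [← Real.log_le_iff_le_exp hcp]
        have h3 : τ ≤ 2 * √ℓ := by
          rw [hτ, Real.sqrt_mul (by norm_num)]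
          gcongr
          rw [Real.sqrt_le_left (by norm_num)]; norm_num
        have h4 : 1 ≤ √ℓ := Real.one_le_sqrt.2 hℓ
        have h5 : 1 ≤ Real.exp 3 := Real.one_le_exp (by norm_num)
        have h6 : w * 1 ≤ w * (Real.exp 3 * √ℓ) := by
          gcongr; exact one_le_mul_of_one_le_of_one_le h5 h4
        have h7 : Real.exp 3 * w * τ ≤ Real.exp 3 * w * (2 * √ℓ) := by gcongr
        have h8 : Fintype.card ι * c * w ≤ 1 * w := by gcongr
        nlinarith

/-- Nazarov's inequality: a Gaussian vector with variances at least `b` puts little mass near the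
boundary of an orthant. -/
theorem nazarov [Nonempty ι] (h : IsCenteredGaussian Q G Sg) {b : ℝ} (hb : 0 < b)
    (hbS : ∀ j, b ≤ Sg j j) (y : ι → ℝ) {ℓ w : ℝ} (hℓ : 1 ≤ ℓ)
    (hcard : Real.log (Fintype.card ι) ≤ ℓ) (hw : 0 ≤ w) :
    Q.real {ω | (∀ j, G ω j ≤ y j + w) ∧ ∃ j, y j ≤ G ω j} ≤
      3 * Real.exp 3 * (w / √b) * √ℓ := by
  have := h.gaussian.isProbabilityMeasure
  have hsb : 0 < √b := Real.sqrt_pos.2 hb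
  have h4 : 1 ≤ √ℓ := Real.one_le_sqrt.2 hℓ
  have h5 : 1 ≤ Real.exp 3 := Real.one_le_exp (by norm_num)
  have hw0 : 0 ≤ w / √b := by positivity
  -- Standardizing shrinks each window to at most `w / √b`; if this exceeds one, the right side
  -- exceeds one and there is nothing to prove.
  rcases le_or_gt (w / √b) 1 with hw1 | hw1
  · have hs : ∀ j, 0 < √(Sg j j) := fun j => Real.sqrt_pos.2 (hb.trans_le (hbS j))
    have hN := h.linear_image (fun j => (√(Sg j j))⁻¹) id
    have := hN.nazarov_unit (fun j => by
      have := Real.mul_self_sqrt (hb.le.trans (hbS j))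
      have h0 := (hs j).ne'
      simp only [id]
      nth_rw 3 [← this]
      field_simp) (fun j => (√(Sg j j))⁻¹ * y j) hℓ hcard hw0 hw1
    refine ENNReal.toReal_le_of_le_ofReal (by positivity) (le_trans (measure_mono ?_) this)
    rintro ω ⟨ha, j, hj⟩
    refine ⟨fun k => ?_, j, mul_le_mul_of_nonneg_left hj (inv_nonneg.2 (hs j).le)⟩
    have h1 := mul_le_mul_of_nonneg_left (ha k) (inv_nonneg.2 (hs k).le)
    refine h1.trans ?_
    rw [mul_add, add_le_add_iff_left, div_eq_inv_mul]
    gcongr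
    exact hbS k
  · refine measureReal_le_one.trans ?_
    have := one_le_mul_of_one_le_of_one_le (one_le_mul_of_one_le_of_one_le h5 hw1.le) h4
    nlinarith

end IsCenteredGaussian

end AntiConcentration

/-! ### Averages over resampled indices. -/

section Resampling

/-- The average over all resampling schemes `κ : Fin n → Fin n`. -/
def resampleMean {n : ℕ} (F : (Fin n → Fin n) → ℝ) : ℝ := (∑ κ, F κ) / (n : ℝ) ^ n

variable {n : ℕ}

theorem resampleMean_add (F F' : (Fin n → Fin n) → ℝ) :
    resampleMean (fun κ => F κ + F' κ) = resampleMean F + resampleMean F' := by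
  simp [resampleMean, Finset.sum_add_distrib, add_div]

theorem resampleMean_const_mul (c : ℝ) (F : (Fin n → Fin n) → ℝ) :
    resampleMean (fun κ => c * F κ) = c * resampleMean F := by
  simp [resampleMean, ← Finset.mul_sum, mul_div_assoc]

theorem resampleMean_sum {α : Type*} (s : Finset α) (F : α → (Fin n → Fin n) → ℝ) :
    resampleMean (fun κ => ∑ a ∈ s, F a κ) = ∑ a ∈ s, resampleMean (F a) := by
  simp only [resampleMean]
  rw [Finset.sum_comm, Finset.sum_div]

theorem resampleMean_mono {F F' : (Fin n → Fin n) → ℝ} (h : ∀ κ, F κ ≤ F' κ) :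
    resampleMean F ≤ resampleMean F' := by
  unfold resampleMean
  gcongr with κ _
  exact h κ

theorem abs_resampleMean_le (F : (Fin n → Fin n) → ℝ) :
    |resampleMean F| ≤ resampleMean fun κ => |F κ| := by
  unfold resampleMean
  rw [abs_div, abs_of_nonneg (by positivity : (0 : ℝ) ≤ (n : ℝ) ^ n)]
  gcongr
  exact Finset.abs_sum_le_sum_abs _ _

theorem resampleMean_const (hn : 0 < n) (c : ℝ) : resampleMean (fun _ : Fin n → Fin n => c) = c := by
  have : (n : ℝ) ≠ 0 := by positivity
  simp [resampleMean, this]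

/-- Redrawing one of the resampled indices does not change the average. -/
theorem resampleMean_update (hn : 0 < n) (i : Fin n) (F : (Fin n → Fin n) → ℝ) :
    resampleMean F = resampleMean fun κ => (∑ m, F (Function.update κ i m)) / n := by
  have hn' : (n : ℝ) ≠ 0 := by positivity
  -- The involution that exchanges the old draw at `i` with the fresh one.
  let e : (Fin n → Fin n) × Fin n ≃ (Fin n → Fin n) × Fin n :=
    { toFun := fun z => (Function.update z.1 i z.2, z.1 i)
      invFun := fun z => (Function.update z.1 i z.2, z.1 i)
      left_inv := fun z => by simp
      right_inv := fun z => by simp }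
  have h1 : ∑ κ, ∑ m, F (Function.update κ i m) = n * ∑ κ, F κ := by
    rw [← Fintype.sum_prod_type' (f := fun κ m => F (Function.update κ i m)),
      Fintype.sum_equiv e (fun z => F (Function.update z.1 i z.2)) (fun z => F z.1) (fun z => rfl), Fintype.sum_prod_type]
    simp [Finset.mul_sum]
  rw [resampleMean, resampleMean, ← Finset.sum_div, h1, mul_div_cancel_left₀ _ hn']

end Resampling

/-! ### Leave-one-out expansion of the resampled sum. -/

section Comparison

variable {ι Ω' : Type*} [Fintype ι] [Nonempty ι] [MeasurableSpace Ω'] {K : ℝ} {n : ℕ}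

/-- The normalized sum of the resampled points. -/
def resampleSum (v : Fin n → ι → ℝ) (κ : Fin n → Fin n) : ι → ℝ :=
  fun j => (∑ i, v (κ i) j) / √n

/-- The empirical second moment matrix. -/
def secondMoment (v : Fin n → ι → ℝ) : ι → ι → ℝ := fun j k => (∑ i, v i j * v i k) / n

theorem smoothIndTr_secondMoment (χ : SmoothCutoff K) (φ β : ℝ) (v : Fin n → ι → ℝ) (x : ι → ℝ) :
    smoothIndTr χ φ β (secondMoment v) x = (∑ m, smoothIndD₂ χ φ β (v m) (v m) x) / n := by
  have : secondMoment v = fun j k => (n : ℝ)⁻¹ * ∑ i, v i j * v i k := by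
    ext j k; rw [secondMoment]; ring
  rw [this, smoothIndTr_const_mul, smoothIndTr_sum, div_eq_inv_mul]
  simp only [smoothIndTr_outer]

theorem sum_smoothIndD_eq_zero (χ : SmoothCutoff K) (φ β : ℝ) {v : Fin n → ι → ℝ}
    (hv : ∀ j, ∑ i, v i j = 0) (x : ι → ℝ) : ∑ m, smoothIndD χ φ β (v m) x = 0 := by
  rw [← smoothIndD_sum]
  simp [hv, smoothIndD, softmaxAvg]

/-- All draws are averaged with the same weights, so the sum over draws can be taken first. Hence
only coordinatewise third moments enter, and not the third moment of the largest coordinate. -/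
theorem sum_softmaxAvg_cube_le {v : Fin n → ι → ℝ} {L : ℝ} (hn : 0 < n)
    (hL : ∀ j, (∑ i, |v i j| ^ 3) / n ≤ L) (β : ℝ) (x : ι → ℝ) :
    (∑ m, softmaxAvg β x fun j => |v m j| ^ 3) ≤ n * L := by
  have hn' : (0 : ℝ) < n := by positivity
  rw [← softmaxAvg_sum]
  refine (softmaxAvg_mono (b := fun _ => n * L) fun j => ?_).trans (le_of_eq (softmaxAvg_const _ _ _))
  have := hL j
  rw [div_le_iff₀ hn'] at this
  linarith

/-- One step of the leave-one-out expansion: averaging over a single redrawn point. -/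
theorem abs_sum_single_draw_le (χ : SmoothCutoff K) {φ β h M L : ℝ} (hn : 0 < n) (hφ : 0 ≤ φ)
    (hφβ : φ ≤ β) (hβ : 0 < β) (hh : 0 ≤ h) {v : Fin n → ι → ℝ} (hv0 : ∀ j, ∑ i, v i j = 0)
    (hM : ∀ i j, |v i j| ≤ M) (hL : ∀ j, (∑ i, |v i j| ^ 3) / n ≤ L) (hR : β * (h * M) ≤ 1)
    (x : ι → ℝ) :
    |(∑ m, (smoothIndD χ φ β (v m) (fun j => x j + h * v m j)
        - h * smoothIndTr χ φ β (secondMoment v) (fun j => x j + h * v m j))) / n| ≤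
      52 * Real.exp 2 * K * φ * β ^ 2 * L * h ^ 2 * (shell φ β).indicator 1 x := by
  have hn' : (0 : ℝ) < n := by positivity
  have hK : 0 ≤ K := (abs_nonneg _).trans (χ.bound₁ 0)
  set I : ℝ := (shell φ β).indicator 1 x with hI
  have hI0 : 0 ≤ I := Set.indicator_nonneg (fun _ _ => zero_le_one) _
  set T := smoothIndTr χ φ β (secondMoment v) with hT
  set A := fun m => softmaxAvg β x fun j => |v m j| ^ 3 with hA
  set c := Real.exp 2 * K * φ * β ^ 2 * I with hc
  have hc0 : 0 ≤ c := by positivity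
  have hA0 : ∀ m, 0 ≤ A m := fun m => softmaxAvg_nonneg fun j => by positivity
  have hAs : ∑ m, A m ≤ n * L := sum_softmaxAvg_cube_le hn hL β x
  -- Centring kills the first derivatives at `x`, and the second derivatives there sum to `n * T x`;
  -- only Taylor remainders are left.
  have e1 : ∑ m, (smoothIndD χ φ β (v m) (fun j => x j + h * v m j)
        - h * T (fun j => x j + h * v m j)) =
      ∑ m, (smoothIndD χ φ β (v m) (fun j => x j + h * v m j) - smoothIndD χ φ β (v m) x
        - h * smoothIndD₂ χ φ β (v m) (v m) x) - h * ∑ m, (T (fun j => x j + h * v m j) - T x) := by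
    have : ∑ m, smoothIndD₂ χ φ β (v m) (v m) x = n * T x := by
      rw [hT, smoothIndTr_secondMoment, mul_div_cancel₀ _ hn'.ne']
    simp only [Finset.sum_sub_distrib, ← Finset.mul_sum, sum_smoothIndD_eq_zero χ φ β hv0, this,
      Finset.sum_const, Finset.card_univ, Fintype.card_fin, nsmul_eq_mul]
    ring
  have b1 : |∑ m, (smoothIndD χ φ β (v m) (fun j => x j + h * v m j) - smoothIndD χ φ β (v m) x
        - h * smoothIndD₂ χ φ β (v m) (v m) x)| ≤ 26 * c * h ^ 2 * (n * L) := by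
    refine (Finset.abs_sum_le_sum_abs _ _).trans ?_
    calc _ ≤ ∑ m, 26 * c * h ^ 2 * A m := Finset.sum_le_sum fun m _ =>
          (abs_smoothIndD_add_sub_le χ hφ hφβ hβ hh (hM m) hR x).trans
            (le_of_eq (by rw [hc]; ring))
      _ = 26 * c * h ^ 2 * ∑ m, A m := by rw [Finset.mul_sum]
      _ ≤ _ := by gcongr
  have b2 : ∀ m, |T (fun j => x j + h * v m j) - T x| ≤ 13 * c * h * (L + A m) := by
    intro m
    rw [hT, smoothIndTr_secondMoment, smoothIndTr_secondMoment, ← sub_div,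
      ← Finset.sum_sub_distrib, abs_div, abs_of_pos hn', div_le_iff₀ hn']
    refine (Finset.abs_sum_le_sum_abs _ _).trans ?_
    calc _ ≤ ∑ l, 13 * c * h * (A l + A m) := Finset.sum_le_sum fun l _ =>
          (abs_smoothIndD₂_add_sub_le χ hφ hφβ hβ hh (hM m) hR (v l) x).trans
            (le_of_eq (by rw [hc, softmaxAvg_add]; ring))
      _ = 13 * c * h * (∑ l, A l + n * A m) := by
          rw [← Finset.mul_sum, Finset.sum_add_distrib]; simp
      _ ≤ 13 * c * h * (n * L + n * A m) := by gcongr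
      _ = _ := by ring
  have b3 : |∑ m, (T (fun j => x j + h * v m j) - T x)| ≤ 26 * c * h * (n * L) := by
    refine (Finset.abs_sum_le_sum_abs _ _).trans ?_
    calc _ ≤ ∑ m, 13 * c * h * (L + A m) := Finset.sum_le_sum fun m _ => b2 m
      _ = 13 * c * h * (n * L + ∑ m, A m) := by
          rw [← Finset.mul_sum, Finset.sum_add_distrib]; simp
      _ ≤ 13 * c * h * (n * L + n * L) := by gcongr
      _ = _ := by ring
  rw [e1, abs_div, abs_of_pos hn', div_le_iff₀ hn']
  refine (abs_sub _ _).trans ?_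
  rw [abs_mul, abs_of_nonneg hh]
  calc _ ≤ 26 * c * h ^ 2 * (n * L) + h * (26 * c * h * (n * L)) := by gcongr
    _ = _ := by rw [hc]; ring

theorem resampleSum_update (v : Fin n → ι → ℝ) (κ : Fin n → Fin n) (i m : Fin n) (j : ι) :
    resampleSum v (Function.update κ i m) j
      = resampleSum v κ j - v (κ i) j / √n + v m j / √n := by
  have : ∑ l, v (Function.update κ i m l) j = ∑ l, v (κ l) j - v (κ i) j + v m j := by
    rw [← Finset.add_sum_erase _ _ (Finset.mem_univ i), ← Finset.add_sum_erase (a := i) _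
      (fun l => v (κ l) j) (Finset.mem_univ i), Function.update_self]
    have : ∑ l ∈ Finset.univ.erase i, v (Function.update κ i m l) j
        = ∑ l ∈ Finset.univ.erase i, v (κ l) j := Finset.sum_congr rfl fun l hl => by
      rw [Function.update_of_ne (Finset.ne_of_mem_erase hl)]
    rw [this]; ring
  rw [resampleSum, this, resampleSum]; ring

/-- The leave-one-out expansion of the first order term. -/
theorem abs_resampleMean_expansion_le (χ : SmoothCutoff K) {φ β s M L : ℝ} (hn : 0 < n)
    (hφ : 0 ≤ φ) (hφβ : φ ≤ β) (hβ : 0 < β) (hs : 0 ≤ s) {v : Fin n → ι → ℝ}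
    (hv0 : ∀ j, ∑ i, v i j = 0) (hM : ∀ i j, |v i j| ≤ M)
    (hL : ∀ j, (∑ i, |v i j| ^ 3) / n ≤ L) (hR : β * (s / √n * M) ≤ 1) (z : ι → ℝ) :
    |resampleMean (fun κ =>
        smoothIndD χ φ β (resampleSum v κ) (fun j => z j + s * resampleSum v κ j)
        - s * smoothIndTr χ φ β (secondMoment v) (fun j => z j + s * resampleSum v κ j))| ≤
      52 * Real.exp 2 * K * φ * β ^ 2 * L * s ^ 2 / √n * resampleMean (fun κ =>
        (∑ i, (shell φ β).indicator 1
          (fun j => z j + s * (resampleSum v κ j - v (κ i) j / √n))) / n) := by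
  have hn' : (0 : ℝ) < n := by positivity
  have hsn : 0 < √(n : ℝ) := Real.sqrt_pos.2 hn'
  have hsn2 : √(n : ℝ) * √n = n := Real.mul_self_sqrt hn'.le
  set h := s / √n with hh
  have hh0 : 0 ≤ h := by positivity
  set T := smoothIndTr χ φ β (secondMoment v) with hT
  let Z : (Fin n → Fin n) → ι → ℝ := fun κ j => z j + s * resampleSum v κ j
  let X : Fin n → (Fin n → Fin n) → ι → ℝ := fun i κ j =>
    z j + s * (resampleSum v κ j - v (κ i) j / √n)
  have hZ : ∀ i κ m, Z (Function.update κ i m) = fun j => X i κ j + h * v m j := by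
    intro i κ m; ext j
    simp only [Z, X, resampleSum_update, hh]; ring
  have hsplit : ∀ κ, smoothIndD χ φ β (resampleSum v κ) (Z κ) - s * T (Z κ)
      = ∑ i, (√n)⁻¹ * (smoothIndD χ φ β (v (κ i)) (Z κ) - h * T (Z κ)) := by
    intro κ
    have e : resampleSum v κ = fun j => (√n)⁻¹ * ∑ i, v (κ i) j := by
      ext j; rw [resampleSum]; ring
    rw [e, smoothIndD_const_mul, smoothIndD_sum, ← Finset.mul_sum, Finset.sum_sub_distrib, mul_sub]
    simp only [Finset.sum_const, Finset.card_univ, Fintype.card_fin, nsmul_eq_mul, hh]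
    congr 1
    have : (n : ℝ) = √n * √n := hsn2.symm
    rw [this, Real.sqrt_mul_self hsn.le]
    field_simp
  have hi : ∀ i, |resampleMean (fun κ =>
      (√n)⁻¹ * (smoothIndD χ φ β (v (κ i)) (Z κ) - h * T (Z κ)))| ≤
      (√n)⁻¹ * (52 * Real.exp 2 * K * φ * β ^ 2 * L * h ^ 2 *
        resampleMean (fun κ => (shell φ β).indicator 1 (X i κ))) := by
    intro i
    rw [resampleMean_const_mul, abs_mul, abs_of_nonneg (by positivity : 0 ≤ (√(n : ℝ))⁻¹)]
    gcongr
    -- After index `i` is redrawn, the base point `X i κ`, which omits the draw at `i`, is free of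
    -- the fresh draw `m`.
    rw [resampleMean_update hn i, ← resampleMean_const_mul]
    refine (abs_resampleMean_le _).trans (resampleMean_mono fun κ => ?_)
    simp only [hZ, Function.update_self]
    exact abs_sum_single_draw_le χ hn hφ hφβ hβ hh0 hv0 hM hL hR (X i κ)
  change |resampleMean (fun κ => smoothIndD χ φ β (resampleSum v κ) (Z κ) - s * T (Z κ))| ≤ _
  simp only [hsplit]
  rw [resampleMean_sum]
  refine (Finset.abs_sum_le_sum_abs _ _).trans ((Finset.sum_le_sum fun i _ => hi i).trans
    (le_of_eq ?_))
  have e2 : (fun κ => (∑ i, (shell φ β).indicator (1 : (ι → ℝ) → ℝ)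
      (fun j => z j + s * (resampleSum v κ j - v (κ i) j / √n))) / n)
      = fun κ => (n : ℝ)⁻¹ * ∑ i, (shell φ β).indicator 1 (X i κ) := by
    ext κ; rw [div_eq_inv_mul]
  rw [e2, resampleMean_const_mul, resampleMean_sum, Finset.mul_sum, Finset.mul_sum]
  refine Finset.sum_congr rfl fun i _ => ?_
  rw [hh, ← hsn2, Real.sqrt_mul_self hsn.le]
  field_simp

end Comparison

/-! ### Trigonometric interpolation between the resampled sum and the Gaussian vector. -/

section Interpolation

variable {ι Ω' : Type*} [Fintype ι] [Nonempty ι] [MeasurableSpace Ω'] {K : ℝ} {n : ℕ}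
  {Q : Measure Ω'} {G : Ω' → ι → ℝ} {Sg : ι → ι → ℝ}

/-- The smooth maximum exceeds the maximum by at most `1 / φ`, so in the shell the maximum of `c + a
G` lies between `-4 / φ` and `3 / φ`. Solving for `G` stretches this window to `7 / (φ a)`, and the
factor `a` on the left cancels the stretch uniformly as `a` tends to zero. -/
theorem IsCenteredGaussian.measure_shell_le (h : IsCenteredGaussian Q G Sg) {b : ℝ} (hb : 0 < b)
    (hbS : ∀ j, b ≤ Sg j j) {φ ℓ a : ℝ} (hφ : 0 < φ) (hℓ : 1 ≤ ℓ)
    (hcard : Real.log (Fintype.card ι) ≤ ℓ) (ha : 0 ≤ a) (c : ι → ℝ) :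
    a * Q.real {ω | (fun j => c j + a * G ω j) ∈ shell φ (φ * ℓ)} ≤
      21 * Real.exp 3 * √ℓ / (φ * √b) := by
  have := h.gaussian.isProbabilityMeasure
  have hsb : 0 < √b := Real.sqrt_pos.2 hb
  have hβ : 0 < φ * ℓ := by positivity
  rcases ha.eq_or_lt with rfl | ha
  · rw [zero_mul]; positivity
  have hlog : Real.log (Fintype.card ι) / (φ * ℓ) ≤ 1 / φ := by
    rw [div_le_div_iff₀ hβ hφ]; nlinarith
  have hN := h.nazarov hb hbS (fun j => (-4 / φ - c j) / a) hℓ hcard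
    (w := 7 / (φ * a)) (by positivity)
  have hsub : {ω | (fun j => c j + a * G ω j) ∈ shell φ (φ * ℓ)} ⊆
      {ω | (∀ j, G ω j ≤ (-4 / φ - c j) / a + 7 / (φ * a)) ∧ ∃ j, (-4 / φ - c j) / a ≤ G ω j} := by
    intro ω hω
    have hω' : |φ * smoothMax (φ * ℓ) (fun j => c j + a * G ω j)| ≤ 3 := hω
    rw [abs_le] at hω'
    set m := smoothMax (φ * ℓ) (fun j => c j + a * G ω j) with hm
    have hm1 : m ≤ 3 / φ := by rw [le_div_iff₀ hφ]; linarith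
    have hm2 : -3 / φ ≤ m := by rw [div_le_iff₀ hφ]; linarith
    refine ⟨fun j => ?_, ?_⟩
    · have h1 := (le_smoothMax hβ (fun j => c j + a * G ω j) j).trans hm1
      have : (-4 / φ - c j) / a + 7 / (φ * a) = (3 / φ - c j) / a := by field_simp; ring
      rw [this, le_div_iff₀ ha]
      linarith
    · by_contra! hc
      obtain ⟨j₀, -, hj₀⟩ := Finset.exists_max_image Finset.univ (fun j => c j + a * G ω j)
        Finset.univ_nonempty
      have h1 := smoothMax_le hβ (x := fun j => c j + a * G ω j)
        (m := c j₀ + a * G ω j₀) fun j => hj₀ j (Finset.mem_univ j)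
      have h2 := hc j₀
      rw [lt_div_iff₀ ha] at h2
      have : -3 / φ = -4 / φ + 1 / φ := by ring
      linarith
  have h1 := (measureReal_mono hsub (measure_ne_top _ _)).trans hN
  calc _ ≤ a * (3 * Real.exp 3 * (7 / (φ * a) / √b) * √ℓ) := by gcongr
    _ = _ := by field_simp; ring

theorem integral_indicator_shell {φ β : ℝ} {X : Ω' → ι → ℝ} (hX : Measurable X) :
    ∫ ω, (shell φ β).indicator (1 : (ι → ℝ) → ℝ) (X ω) ∂Q = Q.real {ω | X ω ∈ shell φ β} := by
  have hm : MeasurableSet {ω | X ω ∈ shell φ β} := hX (measurableSet_shell φ β)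
  rw [← integral_indicator_one hm]
  rfl

/-- The point at angle `θ` on the interpolation path between `c + w` and `c + g`. -/
def interp (c w g : ι → ℝ) (θ : ℝ) : ι → ℝ := fun j => c j + Real.sin θ * w j + Real.cos θ * g j

theorem interp_zero (c w g : ι → ℝ) : interp c w g 0 = fun j => c j + g j := by
  ext j; simp [interp]

theorem interp_pi_div_two (c w g : ι → ℝ) :
    interp c w g (Real.pi / 2) = fun j => c j + w j := by
  ext j; simp [interp]

theorem continuous_interp (c w : ι → ℝ) (θ : ℝ) : Continuous fun g => interp c w g θ := by
  unfold interp; fun_prop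

theorem hasDerivAt_integral_interp (h : IsCenteredGaussian Q G Sg) (χ : SmoothCutoff K) {φ β : ℝ}
    (hφ : 0 ≤ φ) (hβ : 0 < β) (c w : ι → ℝ) (θ : ℝ) :
    HasDerivAt (fun θ => ∫ ω, smoothInd χ φ β (interp c w (G ω) θ) ∂Q)
      (∫ ω, smoothIndD χ φ β (fun j => Real.cos θ * w j + -Real.sin θ * G ω j)
        (interp c w (G ω) θ) ∂Q) θ := by
  have := h.gaussian.isProbabilityMeasure
  have hm : ∀ θ, AEStronglyMeasurable (fun ω => smoothInd χ φ β (interp c w (G ω) θ)) Q := fun θ =>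
    (((continuous_smoothInd χ φ β).comp (continuous_interp c w θ)).measurable.comp
      h.measurable).aestronglyMeasurable
  refine (hasDerivAt_integral_of_dominated_loc_of_deriv_le (s := Set.univ)
    (F' := fun θ ω => smoothIndD χ φ β (fun j => Real.cos θ * w j + -Real.sin θ * G ω j)
      (interp c w (G ω) θ))
    (bound := fun ω => φ * K * (‖w‖ + ‖G ω‖)) Filter.univ_mem
    (Filter.Eventually.of_forall hm) ?_ ?_ ?_ ?_ ?_).2
  · refine Integrable.of_bound (hm θ) 1 (ae_of_all _ fun ω => ?_)
    rw [Real.norm_eq_abs, smoothInd, abs_of_nonneg (χ.nonneg _)]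
    exact χ.le_one _
  · have hc : Continuous fun x : ι → ℝ => interp c w x θ := continuous_interp c w θ
    refine Measurable.aestronglyMeasurable ?_
    have : Continuous fun g : ι → ℝ => smoothIndD χ φ β
        (fun j => Real.cos θ * w j + -Real.sin θ * g j) (interp c w g θ) :=
      (continuous_const.mul ((continuous_g₁ χ).comp
        (((continuous_smoothMax β).comp hc).const_mul φ))).mul
        (continuous_finsetSum _ fun j _ =>
          ((continuous_softmaxWeight β j).comp hc).mul (by fun_prop))
    exact this.measurable.comp h.measurable
  · refine ae_of_all _ fun ω t _ => abs_smoothIndD_le χ hφ (fun j => ?_) _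
    have h1 := norm_le_pi_norm w j
    have h2 := norm_le_pi_norm (G ω) j
    rw [Real.norm_eq_abs] at h1 h2
    refine (abs_add_le _ _).trans (add_le_add ?_ ?_)
    · rw [abs_mul]
      exact (mul_le_of_le_one_left (abs_nonneg _) (Real.abs_cos_le_one t)).trans h1
    · rw [abs_mul, abs_neg]
      exact (mul_le_of_le_one_left (abs_nonneg _) (Real.abs_sin_le_one t)).trans h2
  · exact ((integrable_const _).add (HasGaussianLaw.integrable h.gaussian).norm).const_mul _
  · refine ae_of_all _ fun ω t _ => hasDerivAt_smoothInd χ hβ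
      (x := fun s => interp c w (G ω) s) fun j => ?_
    have h1 := ((Real.hasDerivAt_sin t).mul_const (w j)).const_add (c j)
    exact h1.add ((Real.hasDerivAt_cos t).mul_const (G ω j))

/-- The factor `cos θ` comes out of both contributions: directly for the resampled sum, and through
integration by parts for the Gaussian part. It pays for the loss of anti-concentration when little
Gaussian noise is left on the path. -/
theorem abs_deriv_interp_le (h : IsCenteredGaussian Q G Sg) (χ : SmoothCutoff K)
    {φ ℓ b M L Δ θ : ℝ} (hn : 0 < n) (hφ : 0 < φ) (hℓ : 1 ≤ ℓ)
    (hcard : Real.log (Fintype.card ι) ≤ ℓ) (hb : 0 < b) (hbS : ∀ j, b ≤ Sg j j)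
    {v : Fin n → ι → ℝ} (hv0 : ∀ j, ∑ i, v i j = 0) (hM : ∀ i j, |v i j| ≤ M)
    (hL : ∀ j, (∑ i, |v i j| ^ 3) / n ≤ L) (hΔ : ∀ j k, |secondMoment v j k - Sg j k| ≤ Δ)
    (hR : φ * ℓ * M ≤ √n) (c : ι → ℝ) (hs : 0 ≤ Real.sin θ) (ha : 0 ≤ Real.cos θ) :
    |resampleMean fun κ => ∫ ω, smoothIndD χ φ (φ * ℓ)
        (fun j => Real.cos θ * resampleSum v κ j + -Real.sin θ * G ω j)
        (interp c (resampleSum v κ) (G ω) θ) ∂Q| ≤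
      (52 * Real.exp 2 * K * φ * (φ * ℓ) ^ 2 * L / √n + 3 * K * φ * (φ * ℓ) * Δ) *
        (21 * Real.exp 3 * √ℓ / (φ * √b)) := by
  have := h.gaussian.isProbabilityMeasure
  have hn' : (0 : ℝ) < n := by positivity
  have hsn : 0 < √(n : ℝ) := Real.sqrt_pos.2 hn'
  have hK : 0 ≤ K := (abs_nonneg _).trans (χ.bound₁ 0)
  obtain ⟨j₀⟩ := (inferInstance : Nonempty ι)
  have hM0 : 0 ≤ M := (abs_nonneg _).trans (hM ⟨0, hn⟩ j₀)
  have hL0 : 0 ≤ L := le_trans (by positivity) (hL j₀)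
  have hΔ0 : 0 ≤ Δ := (abs_nonneg _).trans (hΔ j₀ j₀)
  set β := φ * ℓ with hβd
  have hβ : 0 < β := by positivity
  have hφβ : φ ≤ β := le_mul_of_one_le_right hφ.le hℓ
  set s := Real.sin θ with hsd
  set a := Real.cos θ with had
  have hs1 : s ≤ 1 := Real.sin_le_one θ
  set P := 21 * Real.exp 3 * √ℓ / (φ * √b) with hP
  have hP0 : 0 ≤ P := by positivity
  let W := resampleSum v
  let Z : (Fin n → Fin n) → Ω' → ι → ℝ := fun κ ω => interp c (W κ) (G ω) θ
  have hZm : ∀ κ, Measurable (Z κ) := fun κ =>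
    (continuous_interp c (W κ) θ).measurable.comp h.measurable
  have hshell : ∀ d : ι → ℝ, a * ∫ ω, (shell φ β).indicator (1 : (ι → ℝ) → ℝ)
      (fun j => d j + a * G ω j) ∂Q ≤ P := by
    intro d
    rw [integral_indicator_shell (measurable_pi_lambda _ fun j =>
      ((h.measurable_apply j).const_mul a).const_add (d j))]
    exact h.measure_shell_le hb hbS hφ hℓ hcard ha d
  have iD : ∀ κ (u : ι → ℝ), Integrable (fun ω => smoothIndD χ φ β u (Z κ ω)) Q := fun κ u =>
    Integrable.of_bound (((continuous_smoothIndD χ φ β (u := fun _ => u)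
      fun _ => continuous_const).measurable.comp (hZm κ)).aestronglyMeasurable) (φ * K * ‖u‖)
      (ae_of_all _ fun ω => abs_smoothIndD_le χ hφ.le (fun j => norm_le_pi_norm u j) _)
  have iTr : ∀ κ (Γ : ι → ι → ℝ), Integrable (fun ω => smoothIndTr χ φ β Γ (Z κ ω)) Q := fun κ Γ =>
    Integrable.of_bound (((continuous_smoothIndTr χ φ β Γ).measurable.comp
      (hZm κ)).aestronglyMeasurable) (3 * K * φ * β * ‖Γ‖) (ae_of_all _ fun ω => by
        refine (abs_smoothIndTr_le χ hφ.le hφβ (Δ := ‖Γ‖) (fun j k =>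
          (norm_le_pi_norm (Γ j) k).trans (norm_le_pi_norm Γ j)) _).trans ?_
        refine mul_le_of_le_one_right (by positivity) ?_
        exact Set.indicator_le_self' (fun _ _ => zero_le_one) _)
  have iG : ∀ κ, Integrable (fun ω => smoothIndD χ φ β (G ω) (Z κ ω)) Q := by
    intro κ
    refine Integrable.mono' ((HasGaussianLaw.integrable h.gaussian).norm.const_mul (φ * K)) ?_
      (ae_of_all _ fun ω => abs_smoothIndD_le χ hφ.le (fun j => norm_le_pi_norm (G ω) j) _)
    refine Measurable.aestronglyMeasurable ?_
    have hc : Continuous fun x : ι → ℝ => interp c (W κ) x θ := continuous_interp c (W κ) θ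
    have : Continuous fun g : ι → ℝ => smoothIndD χ φ β g (interp c (W κ) g θ) :=
      (continuous_const.mul ((continuous_g₁ χ).comp
        (((continuous_smoothMax β).comp hc).const_mul φ))).mul
        (continuous_finsetSum _ fun j _ =>
          ((continuous_softmaxWeight β j).comp hc).mul (by fun_prop))
    exact this.measurable.comp h.measurable
  -- integration by parts in the Gaussian direction
  have hibp : ∀ κ, ∫ ω, smoothIndD χ φ β (G ω) (Z κ ω) ∂Q
      = a * ∫ ω, smoothIndTr χ φ β Sg (Z κ ω) ∂Q := fun κ =>
    h.integral_smoothIndD χ hφ.le hβ a (fun j => c j + s * W κ j)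
      fun j => hb.trans_le (hbS j)
  -- The contraction with the empirical covariance is added and subtracted. The first integral is
  -- the leave-one-out remainder, the second the covariance mismatch.
  have hsplit : ∀ κ, ∫ ω, smoothIndD χ φ β (fun j => a * W κ j + -s * G ω j) (Z κ ω) ∂Q
      = a * ((∫ ω, (smoothIndD χ φ β (W κ) (Z κ ω)
          - s * smoothIndTr χ φ β (secondMoment v) (Z κ ω)) ∂Q)
        + s * ∫ ω, smoothIndTr χ φ β (fun j k => secondMoment v j k - Sg j k) (Z κ ω) ∂Q) := by
    intro κ
    have e1 : ∫ ω, smoothIndD χ φ β (fun j => a * W κ j + -s * G ω j) (Z κ ω) ∂Q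
        = a * ∫ ω, smoothIndD χ φ β (W κ) (Z κ ω) ∂Q
          + -s * ∫ ω, smoothIndD χ φ β (G ω) (Z κ ω) ∂Q := by
      rw [← integral_const_mul, ← integral_const_mul,
        ← integral_add ((iD κ _).const_mul a) ((iG κ).const_mul (-s))]
      congr 1; ext ω
      rw [smoothIndD_add χ φ β (fun j => a * W κ j) (fun j => -s * G ω j),
        smoothIndD_const_mul, smoothIndD_const_mul]
    have e2 : ∫ ω, smoothIndTr χ φ β (fun j k => secondMoment v j k - Sg j k) (Z κ ω) ∂Q
        = ∫ ω, smoothIndTr χ φ β (secondMoment v) (Z κ ω) ∂Q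
          - ∫ ω, smoothIndTr χ φ β Sg (Z κ ω) ∂Q := by
      rw [← integral_sub (iTr κ _) (iTr κ _)]
      congr 1; ext ω; rw [smoothIndTr_sub]
    rw [e1, e2, hibp, integral_sub (iD κ _) ((iTr κ _).const_mul s), integral_const_mul]
    ring
  have hE1 : ∀ ω, |resampleMean fun κ => smoothIndD χ φ β (W κ) (Z κ ω)
          - s * smoothIndTr χ φ β (secondMoment v) (Z κ ω)| ≤
      52 * Real.exp 2 * K * φ * β ^ 2 * L / √n * resampleMean (fun κ =>
        (∑ i, (shell φ β).indicator 1 (fun j =>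
          (c j + s * (resampleSum v κ j - v (κ i) j / √n)) + a * G ω j)) / n) := by
    intro ω
    have hR' : β * (s / √n * M) ≤ 1 := by
      calc β * (s / √n * M) = s * (β * M / √n) := by ring
        _ ≤ 1 * 1 := by
          gcongr
          rw [div_le_one hsn]; exact hR
        _ = 1 := one_mul 1
    have := abs_resampleMean_expansion_le χ hn hφ.le hφβ hβ hs hv0 hM hL hR'
      (fun j => c j + a * G ω j)
    have eZ : ∀ κ, (fun j => c j + a * G ω j + s * resampleSum v κ j) = Z κ ω := fun κ => by
      ext j; simp only [Z, interp, W]; ring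
    have eX : ∀ κ i, (fun j => c j + a * G ω j + s * (resampleSum v κ j - v (κ i) j / √n))
        = fun j => (c j + s * (resampleSum v κ j - v (κ i) j / √n)) + a * G ω j := fun κ i => by
      ext j; ring
    simp only [eZ, eX] at this
    refine this.trans (mul_le_mul_of_nonneg_right ?_ ?_)
    · rw [div_eq_mul_inv, div_eq_mul_inv]
      refine mul_le_mul_of_nonneg_right (mul_le_of_le_one_right (by positivity) ?_) (by positivity)
      exact pow_le_one₀ hs hs1
    · refine div_nonneg (Finset.sum_nonneg fun κ _ => div_nonneg (Finset.sum_nonneg fun i _ => ?_)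
        (by positivity)) (by positivity)
      exact Set.indicator_nonneg (fun _ _ => zero_le_one) _
  have iI : ∀ d : ι → ℝ, Integrable (fun ω => (shell φ β).indicator (1 : (ι → ℝ) → ℝ)
      (fun j => d j + a * G ω j)) Q := by
    intro d
    have hm : Measurable fun ω j => d j + a * G ω j := measurable_pi_lambda _ fun j =>
      ((h.measurable_apply j).const_mul a).const_add (d j)
    refine Integrable.of_bound (((measurable_const (a := (1 : ℝ))).indicator
      (measurableSet_shell φ β)).comp hm).aestronglyMeasurable 1 (ae_of_all _ fun ω => ?_)
    have h0 : (0 : ℝ) ≤ (shell φ β).indicator (1 : (ι → ℝ) → ℝ) (fun j => d j + a * G ω j) :=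
      Set.indicator_nonneg (fun _ _ => zero_le_one) _
    rw [Real.norm_eq_abs, abs_of_nonneg h0]
    exact Set.indicator_le_self' (fun _ _ => zero_le_one) _
  have iR : ∀ {F : (Fin n → Fin n) → Ω' → ℝ}, (∀ κ, Integrable (F κ) Q) →
      Integrable (fun ω => resampleMean fun κ => F κ ω) Q ∧
      ∫ ω, (resampleMean fun κ => F κ ω) ∂Q = resampleMean fun κ => ∫ ω, F κ ω ∂Q := by
    intro F hF
    refine ⟨(integrable_finsetSum _ fun κ _ => hF κ).div_const _, ?_⟩
    simp only [resampleMean]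
    rw [integral_div, integral_finsetSum _ fun κ _ => hF κ]
  -- The expansion holds for each fixed `ω`. Its shell indicators are then integrated over `G` with
  -- `κ` fixed, the leave-one-out sum being a constant shift.
  have hT1 : a * |resampleMean fun κ => ∫ ω, (smoothIndD χ φ β (W κ) (Z κ ω)
          - s * smoothIndTr χ φ β (secondMoment v) (Z κ ω)) ∂Q| ≤
      52 * Real.exp 2 * K * φ * β ^ 2 * L / √n * P := by
    have hF := iR (F := fun κ ω => smoothIndD χ φ β (W κ) (Z κ ω)
          - s * smoothIndTr χ φ β (secondMoment v) (Z κ ω))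
      fun κ => (iD κ _).sub ((iTr κ _).const_mul s)
    have hS := iR (F := fun κ ω => (∑ i, (shell φ β).indicator (1 : (ι → ℝ) → ℝ) (fun j =>
          (c j + s * (resampleSum v κ j - v (κ i) j / √n)) + a * G ω j)) / n)
      fun κ => (integrable_finsetSum _ fun i _ => iI _).div_const _
    rw [← hF.2]
    have h1 : |∫ ω, (resampleMean fun κ => smoothIndD χ φ β (W κ) (Z κ ω)
          - s * smoothIndTr χ φ β (secondMoment v) (Z κ ω)) ∂Q| ≤
        ∫ ω, 52 * Real.exp 2 * K * φ * β ^ 2 * L / √n * resampleMean (fun κ =>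
        (∑ i, (shell φ β).indicator 1 (fun j =>
          (c j + s * (resampleSum v κ j - v (κ i) j / √n)) + a * G ω j)) / n) ∂Q :=
      (abs_integral_le_integral_abs).trans
        (integral_mono hF.1.abs (hS.1.const_mul _) hE1)
    rw [integral_const_mul, hS.2] at h1
    calc _ ≤ a * _ := mul_le_mul_of_nonneg_left h1 ha
      _ = 52 * Real.exp 2 * K * φ * β ^ 2 * L / √n * resampleMean (fun κ =>
          a * ∫ ω, (∑ i, (shell φ β).indicator (1 : (ι → ℝ) → ℝ) (fun j =>
          (c j + s * (resampleSum v κ j - v (κ i) j / √n)) + a * G ω j)) / n ∂Q) := by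
          rw [resampleMean_const_mul]; ring
      _ ≤ 52 * Real.exp 2 * K * φ * β ^ 2 * L / √n * resampleMean (fun _ : Fin n → Fin n => P) := by
          gcongr
          refine resampleMean_mono fun κ => ?_
          rw [integral_div, integral_finsetSum _ fun i _ => iI _, ← mul_div_assoc,
            div_le_iff₀ hn', Finset.mul_sum]
          refine (Finset.sum_le_sum fun i _ => hshell _).trans ?_
          simp [mul_comm]
      _ = _ := by rw [resampleMean_const hn]
  have hT2 : ∀ κ, a * |s * ∫ ω, smoothIndTr χ φ β (fun j k => secondMoment v j k - Sg j k)
      (Z κ ω) ∂Q| ≤ 3 * K * φ * β * Δ * P := by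
    intro κ
    have h1 : |∫ ω, smoothIndTr χ φ β (fun j k => secondMoment v j k - Sg j k) (Z κ ω) ∂Q| ≤
        ∫ ω, 3 * K * φ * β * Δ * (shell φ β).indicator 1
          (fun j => (c j + s * W κ j) + a * G ω j) ∂Q :=
      (abs_integral_le_integral_abs).trans (integral_mono (iTr κ _).abs ((iI _).const_mul _)
        fun ω => abs_smoothIndTr_le χ hφ.le hφβ hΔ _)
    rw [integral_const_mul] at h1
    rw [abs_mul, abs_of_nonneg hs]
    have h2 := hshell (fun j => c j + s * W κ j)
    set I := ∫ ω, (shell φ β).indicator (1 : (ι → ℝ) → ℝ)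
          (fun j => (c j + s * W κ j) + a * G ω j) ∂Q with hI
    calc _ ≤ a * (1 * (3 * K * φ * β * Δ * I)) := by gcongr
      _ = 3 * K * φ * β * Δ * (a * I) := by ring
      _ ≤ _ := by gcongr
  change |resampleMean fun κ => ∫ ω, smoothIndD χ φ β (fun j => a * W κ j + -s * G ω j)
    (Z κ ω) ∂Q| ≤ _
  simp only [hsplit]
  rw [resampleMean_const_mul, abs_mul, abs_of_nonneg ha, resampleMean_add]
  have hT2' : a * |resampleMean fun κ => s * ∫ ω,
      smoothIndTr χ φ β (fun j k => secondMoment v j k - Sg j k) (Z κ ω) ∂Q| ≤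
      3 * K * φ * β * Δ * P := by
    calc _ ≤ a * resampleMean _ := mul_le_mul_of_nonneg_left (abs_resampleMean_le _) ha
      _ = resampleMean fun κ => a * _ := by rw [← resampleMean_const_mul]
      _ ≤ resampleMean fun _ : Fin n → Fin n => 3 * K * φ * β * Δ * P :=
          resampleMean_mono fun κ => hT2 κ
      _ = _ := by rw [resampleMean_const hn]
  calc _ ≤ a * (_ + _) := mul_le_mul_of_nonneg_left (abs_add_le _ _) ha
    _ = a * _ + a * _ := mul_add _ _ _
    _ ≤ _ := by rw [add_mul]; exact add_le_add hT1 hT2'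

/-- The mean value inequality on `[0, π / 2]`, whose length is at most 2. -/
theorem abs_resampleMean_sub_integral_le (h : IsCenteredGaussian Q G Sg) (χ : SmoothCutoff K)
    {φ ℓ b M L Δ : ℝ} (hn : 0 < n) (hφ : 0 < φ) (hℓ : 1 ≤ ℓ)
    (hcard : Real.log (Fintype.card ι) ≤ ℓ) (hb : 0 < b) (hbS : ∀ j, b ≤ Sg j j)
    {v : Fin n → ι → ℝ} (hv0 : ∀ j, ∑ i, v i j = 0) (hM : ∀ i j, |v i j| ≤ M)
    (hL : ∀ j, (∑ i, |v i j| ^ 3) / n ≤ L) (hΔ : ∀ j k, |secondMoment v j k - Sg j k| ≤ Δ)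
    (hR : φ * ℓ * M ≤ √n) (c : ι → ℝ) :
    |resampleMean (fun κ => smoothInd χ φ (φ * ℓ) (fun j => c j + resampleSum v κ j)) -
      ∫ ω, smoothInd χ φ (φ * ℓ) (fun j => c j + G ω j) ∂Q| ≤
      2 * ((52 * Real.exp 2 * K * φ * (φ * ℓ) ^ 2 * L / √n + 3 * K * φ * (φ * ℓ) * Δ) *
        (21 * Real.exp 3 * √ℓ / (φ * √b))) := by
  have := h.gaussian.isProbabilityMeasure
  have hβ : 0 < φ * ℓ := by positivity
  set B := (52 * Real.exp 2 * K * φ * (φ * ℓ) ^ 2 * L / √n + 3 * K * φ * (φ * ℓ) * Δ) *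
        (21 * Real.exp 3 * √ℓ / (φ * √b)) with hB
  let Ψ : ℝ → ℝ := fun θ => resampleMean fun κ : Fin n → Fin n =>
    ∫ ω, smoothInd χ φ (φ * ℓ) (interp c (resampleSum v κ) (G ω) θ) ∂Q
  have hd : ∀ θ ∈ Set.Icc 0 (Real.pi / 2), HasDerivWithinAt Ψ
      (resampleMean fun κ => ∫ ω, smoothIndD χ φ (φ * ℓ)
        (fun j => Real.cos θ * resampleSum v κ j + -Real.sin θ * G ω j)
        (interp c (resampleSum v κ) (G ω) θ) ∂Q) (Set.Icc 0 (Real.pi / 2)) θ := fun θ _ =>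
    ((HasDerivAt.fun_sum fun κ _ =>
      hasDerivAt_integral_interp h χ hφ.le hβ c (resampleSum v κ) θ).div_const _).hasDerivWithinAt
  have hB' : ∀ θ ∈ Set.Ico 0 (Real.pi / 2), |resampleMean fun κ => ∫ ω, smoothIndD χ φ (φ * ℓ)
        (fun j => Real.cos θ * resampleSum v κ j + -Real.sin θ * G ω j)
        (interp c (resampleSum v κ) (G ω) θ) ∂Q| ≤ B := fun θ hθ =>
    abs_deriv_interp_le h χ hn hφ hℓ hcard hb hbS hv0 hM hL hΔ hR c
      (Real.sin_nonneg_of_nonneg_of_le_pi hθ.1 (by linarith [hθ.2, Real.pi_pos]))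
      (Real.cos_nonneg_of_neg_pi_div_two_le_of_le (by linarith [hθ.1, Real.pi_pos]) hθ.2.le)
  have hpi : 0 < Real.pi / 2 := by positivity
  have key := norm_image_sub_le_of_norm_deriv_le_segment' hd hB' (Real.pi / 2) ⟨hpi.le, le_rfl⟩
  have hB0 : 0 ≤ B := (abs_nonneg _).trans (hB' 0 ⟨le_rfl, hpi⟩)
  have e1 : Ψ (Real.pi / 2) =
      resampleMean fun κ => smoothInd χ φ (φ * ℓ) (fun j => c j + resampleSum v κ j) := by
    simp only [Ψ, interp_pi_div_two]
    simp
  have e0 : Ψ 0 = ∫ ω, smoothInd χ φ (φ * ℓ) (fun j => c j + G ω j) ∂Q := by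
    simp only [Ψ, interp_zero]
    exact resampleMean_const hn _
  rw [e1, e0, Real.norm_eq_abs] at key
  refine key.trans ?_
  nlinarith [Real.pi_le_four]

end Interpolation

/-! ### From smoothed indicators back to orthants. -/

section Orthant

variable {ι Ω' : Type*} [Fintype ι] [Nonempty ι] [MeasurableSpace Ω'] {K : ℝ} {n : ℕ}
  {Q : Measure Ω'} {G : Ω' → ι → ℝ} {Sg : ι → ι → ℝ}

theorem IsCenteredGaussian.measurableSet_orthant (h : IsCenteredGaussian Q G Sg) (y : ι → ℝ) :
    MeasurableSet {ω | ∀ j, G ω j ≤ y j} := by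
  have : {ω | ∀ j, G ω j ≤ y j} = ⋂ j, {ω | G ω j ≤ y j} := by ext; simp
  rw [this]
  exact MeasurableSet.iInter fun j => measurableSet_le (h.measurable_apply j) measurable_const

theorem IsCenteredGaussian.integrable_smoothInd (h : IsCenteredGaussian Q G Sg)
    (χ : SmoothCutoff K) (φ β : ℝ) (c : ι → ℝ) :
    Integrable (fun ω => smoothInd χ φ β (fun j => c j + G ω j)) Q := by
  have := h.gaussian.isProbabilityMeasure
  refine Integrable.of_bound (((continuous_smoothInd χ φ β).measurable.comp
    (measurable_pi_lambda _ fun j =>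
      (h.measurable_apply j).const_add (c j))).aestronglyMeasurable) 1 (ae_of_all _ fun ω => ?_)
  rw [Real.norm_eq_abs, smoothInd, abs_of_nonneg (χ.nonneg _)]
  exact χ.le_one _

theorem IsCenteredGaussian.orthant_le_add (h : IsCenteredGaussian Q G Sg) {b : ℝ} (hb : 0 < b)
    (hbS : ∀ j, b ≤ Sg j j) (y : ι → ℝ) {ℓ w : ℝ} (hℓ : 1 ≤ ℓ)
    (hcard : Real.log (Fintype.card ι) ≤ ℓ) (hw : 0 ≤ w) :
    Q.real {ω | ∀ j, G ω j ≤ y j + w} ≤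
      Q.real {ω | ∀ j, G ω j ≤ y j} + 3 * Real.exp 3 * (w / √b) * √ℓ := by
  have := h.gaussian.isProbabilityMeasure
  have hsub : {ω | ∀ j, G ω j ≤ y j + w} ⊆ {ω | ∀ j, G ω j ≤ y j} ∪
      {ω | (∀ j, G ω j ≤ y j + w) ∧ ∃ j, y j ≤ G ω j} := by
    intro ω hω
    by_cases hc : ∀ j, G ω j ≤ y j
    · exact Or.inl hc
    · push Not at hc
      obtain ⟨j, hj⟩ := hc
      exact Or.inr ⟨hω, j, hj.le⟩
  refine (measureReal_mono hsub (measure_ne_top _ _)).trans ((measureReal_union_le _ _).trans ?_)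
  gcongr
  exact h.nazarov hb hbS y hℓ hcard hw

open Classical in
/-- Gaussian approximation of the resampling distribution on an orthant, for deterministic data. -/
theorem abs_resampleMean_orthant_sub_le (h : IsCenteredGaussian Q G Sg) (χ : SmoothCutoff K)
    (hK1 : 1 ≤ K) {ℓ b M L Δ r : ℝ} (hn : 0 < n) (hr : 0 < r) (hℓ : 1 ≤ ℓ)
    (hcard : Real.log (Fintype.card ι) ≤ ℓ) (hb : 0 < b) (hbS : ∀ j, b ≤ Sg j j)
    {v : Fin n → ι → ℝ} (hv0 : ∀ j, ∑ i, v i j = 0) (hM : ∀ i j, |v i j| ≤ M)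
    (hL : ∀ j, (∑ i, |v i j| ^ 3) / n ≤ L) (hΔ : ∀ j k, |secondMoment v j k - Sg j k| ≤ Δ)
    (hr1 : L * ℓ ^ 2 / √n ≤ r ^ 3) (hr2 : Δ * ℓ ≤ r ^ 2) (hr3 : M * ℓ / √n ≤ r) (y : ι → ℝ) :
    |resampleMean (fun κ => if ∀ j, resampleSum v κ j ≤ y j then 1 else 0) -
      Q.real {ω | ∀ j, G ω j ≤ y j}| ≤ 2500 * Real.exp 5 * K / √b * √ℓ * r := by
  have := h.gaussian.isProbabilityMeasure
  have hsn : 0 < √(n : ℝ) := Real.sqrt_pos.2 (by positivity)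
  have hsb : 0 < √b := Real.sqrt_pos.2 hb
  have hΔ0 : 0 ≤ Δ := (abs_nonneg _).trans (hΔ (Classical.arbitrary ι) (Classical.arbitrary ι))
  -- `r` is the smoothing width: the cutoff and the overshoot of the smooth maximum each cost at
  -- most `r`.
  set φ := 1 / r with hφd
  have hφ : 0 < φ := by positivity
  have hφi : 1 / φ = r := by rw [hφd, one_div_one_div]
  have hβ : 0 < φ * ℓ := by positivity
  have hlog : Real.log (Fintype.card ι) / (φ * ℓ) ≤ r := by
    rw [← hφi, div_le_div_iff₀ hβ hφ]; nlinarith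
  have hR : φ * ℓ * M ≤ √n := by
    rw [div_le_iff₀ hsn] at hr3
    rw [hφd, one_div, mul_assoc, inv_mul_le_iff₀ hr]
    linarith
  -- Here `2310 = 42 * (52 + 3)`; the two sandwich windows below add 6.
  set E := 2310 * Real.exp 5 * K / √b * √ℓ * r with hE
  have hcmp : ∀ c : ι → ℝ,
      |resampleMean (fun κ => smoothInd χ φ (φ * ℓ) (fun j => c j + resampleSum v κ j)) -
      ∫ ω, smoothInd χ φ (φ * ℓ) (fun j => c j + G ω j) ∂Q| ≤ E := by
    intro c
    refine (abs_resampleMean_sub_integral_le h χ hn hφ hℓ hcard hb hbS hv0 hM hL hΔ hR c).trans ?_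
    have e : 2 * ((52 * Real.exp 2 * K * φ * (φ * ℓ) ^ 2 * L / √n + 3 * K * φ * (φ * ℓ) * Δ) *
        (21 * Real.exp 3 * √ℓ / (φ * √b))) =
        42 * K / √b * √ℓ * (52 * (Real.exp 2 * Real.exp 3) * ((L * ℓ ^ 2 / √n) * φ ^ 2)
          + 3 * Real.exp 3 * ((Δ * ℓ) * φ)) := by
      field_simp
      ring
    rw [e, ← Real.exp_add]
    have a1 : (L * ℓ ^ 2 / √n) * φ ^ 2 ≤ r := by
      calc _ ≤ r ^ 3 * φ ^ 2 := by gcongr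
        _ = r := by rw [hφd]; field_simp
    have a2 : (Δ * ℓ) * φ ≤ r := by
      calc _ ≤ r ^ 2 * φ := by gcongr
        _ = r := by rw [hφd]; field_simp
    have a3 : Real.exp 3 ≤ Real.exp 5 := Real.exp_le_exp.2 (by norm_num)
    calc _ ≤ 42 * K / √b * √ℓ * (52 * Real.exp (2 + 3) * r + 3 * Real.exp 5 * r) := by gcongr
      _ = E := by rw [hE]; norm_num; ring
  have hwin : 3 * Real.exp 3 * ((2 * r) / √b) * √ℓ ≤ 6 * Real.exp 5 * K / √b * √ℓ * r := by
    have a3 : Real.exp 3 ≤ Real.exp 5 := Real.exp_le_exp.2 (by norm_num)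
    calc _ = 6 * Real.exp 3 * 1 / √b * √ℓ * r := by ring
      _ ≤ _ := by gcongr
  have htot : E + 6 * Real.exp 5 * K / √b * √ℓ * r ≤ 2500 * Real.exp 5 * K / √b * √ℓ * r := by
    have : 0 ≤ Real.exp 5 * K / √b * √ℓ * r := by positivity
    rw [hE]
    have e1 : 2310 * Real.exp 5 * K / √b * √ℓ * r = 2310 * (Real.exp 5 * K / √b * √ℓ * r) := by ring
    have e2 : 6 * Real.exp 5 * K / √b * √ℓ * r = 6 * (Real.exp 5 * K / √b * √ℓ * r) := by ring
    have e3 : 2500 * Real.exp 5 * K / √b * √ℓ * r = 2500 * (Real.exp 5 * K / √b * √ℓ * r) := by ring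
    rw [e1, e2, e3]; linarith
  -- Shifting by `t = -r` puts the smoothed indicator above the orthant indicator, and `t = r` puts
  -- it below. The resulting Gaussian thresholds differ from `y` by `2 r`.
  have hupG : ∀ t : ℝ, ∫ ω, smoothInd χ φ (φ * ℓ) (fun j => (-(y j) + t) + G ω j) ∂Q ≤
      Q.real {ω | ∀ j, G ω j ≤ y j + (r - t)} := by
    intro t
    rw [← integral_indicator_one (h.measurableSet_orthant fun j => y j + (r - t))]
    refine integral_mono (h.integrable_smoothInd χ φ _ _)
      ((integrable_const (1 : ℝ)).indicator (h.measurableSet_orthant _)) fun ω => ?_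
    by_cases hω : ∀ j, G ω j ≤ y j + (r - t)
    · rw [Set.indicator_of_mem (by exact hω)]; exact χ.le_one _
    · rw [Set.indicator_of_notMem (by exact hω)]
      push Not at hω
      obtain ⟨j, hj⟩ := hω
      exact (smoothInd_eq_zero χ hφ hβ (j := j) (by rw [hφi]; linarith)).le
  have hloG : ∀ t : ℝ, Q.real {ω | ∀ j, G ω j ≤ y j - (r + t)} ≤
      ∫ ω, smoothInd χ φ (φ * ℓ) (fun j => (-(y j) + t) + G ω j) ∂Q := by
    intro t
    rw [← integral_indicator_one (h.measurableSet_orthant fun j => y j - (r + t))]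
    refine integral_mono ((integrable_const (1 : ℝ)).indicator (h.measurableSet_orthant _))
      (h.integrable_smoothInd χ φ _ _) fun ω => ?_
    by_cases hω : ∀ j, G ω j ≤ y j - (r + t)
    · rw [Set.indicator_of_mem (by exact hω), smoothInd_eq_one χ hφ hβ fun j => by linarith [hω j]]
      rfl
    · rw [Set.indicator_of_notMem (by exact hω)]; exact χ.nonneg _
  have hloW : resampleMean (fun κ => if ∀ j, resampleSum v κ j ≤ y j then (1 : ℝ) else 0) ≤
      resampleMean (fun κ => smoothInd χ φ (φ * ℓ) (fun j => (-(y j) + -r) + resampleSum v κ j)) := by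
    refine resampleMean_mono fun κ => ?_
    split_ifs with hκ
    · rw [smoothInd_eq_one χ hφ hβ fun j => by linarith [hκ j]]
    · exact χ.nonneg _
  have hupW : resampleMean (fun κ => smoothInd χ φ (φ * ℓ)
      (fun j => (-(y j) + r) + resampleSum v κ j)) ≤
      resampleMean (fun κ => if ∀ j, resampleSum v κ j ≤ y j then (1 : ℝ) else 0) := by
    refine resampleMean_mono fun κ => ?_
    split_ifs with hκ
    · exact χ.le_one _
    · push Not at hκ
      obtain ⟨j, hj⟩ := hκ
      exact (smoothInd_eq_zero χ hφ hβ (j := j) (by rw [hφi]; linarith)).le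
  have n1 := h.orthant_le_add hb hbS y hℓ hcard (w := 2 * r) (by positivity)
  have n2 := h.orthant_le_add hb hbS (fun j => y j - 2 * r) hℓ hcard (w := 2 * r) (by positivity)
  have c1 := abs_le.1 (hcmp fun j => -(y j) + -r)
  have c2 := abs_le.1 (hcmp fun j => -(y j) + r)
  have u1 := hupG (-r)
  have u2 := hloG r
  have e1 : r - -r = 2 * r := by ring
  have e2 : r + r = 2 * r := by ring
  rw [e1] at u1
  rw [e2] at u2
  simp only [sub_add_cancel] at n2
  rw [abs_le]
  constructor
  · linarith [c2.1]
  · linarith [c1.2]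

end Orthant

/-! ### The bootstrap law as a resampling average, and hyperrectangles as orthants. -/

section Bootstrap

variable {n p : ℕ}

/-- The uniform distribution on the indices `1, …, n`. -/
def uniformIndex (n : ℕ) : Measure (Fin n) := (n : ℝ≥0∞)⁻¹ • ∑ i, Measure.dirac i

theorem isProbabilityMeasure_uniformIndex (hn : 0 < n) : IsProbabilityMeasure (uniformIndex n) := by
  refine ⟨?_⟩
  have : (n : ℝ≥0∞) ≠ 0 := by simpa using hn.ne'
  simp [uniformIndex, ENNReal.inv_mul_cancel this (ENNReal.natCast_ne_top n)]

theorem empiricalMeasure_eq_map (x : Fin n → Fin p → ℝ) :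
    empiricalMeasure x = (uniformIndex n).map x := by
  ext s hs
  rw [Measure.map_apply (measurable_of_finite x) hs]
  simp [empiricalMeasure, uniformIndex, Measure.dirac_apply' _ hs]
  rfl

theorem pi_uniformIndex_real_singleton (κ : Fin n → Fin n) (hn : 0 < n) :
    (Measure.pi fun _ : Fin n => uniformIndex n).real {κ} = ((n : ℝ) ^ n)⁻¹ := by
  have := isProbabilityMeasure_uniformIndex hn
  have h1 : ∀ i : Fin n, uniformIndex n {i} = (n : ℝ≥0∞)⁻¹ := fun i => by
    simp only [uniformIndex, Measure.smul_apply, Measure.finsetSum_apply, smul_eq_mul]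
    rw [Finset.sum_eq_single i]
    · simp
    · intro j _ hj; simp [hj]
    · simp
  rw [measureReal_def, Measure.pi_singleton]
  simp [h1]

theorem resampleSum_sub_sampleMean (x : Fin n → Fin p → ℝ) (κ : Fin n → Fin n) :
    normalizedSum (fun i => x (κ i) - sampleMean x)
      = resampleSum (fun i => x i - sampleMean x) κ := rfl

theorem measurable_normalizedSum_sub (z : Fin p → ℝ) :
    Measurable fun xs : Fin n → Fin p → ℝ => normalizedSum (fun i => xs i - z) := by
  unfold normalizedSum
  simp only [Pi.sub_apply]
  fun_prop

-- The empirical distribution is the image of a uniform index, so the bootstrap sample law is the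
-- image of the uniform law on index maps. Each map has mass `n ^ (-n)`, even when data points
-- coincide.
open Classical in
theorem bootstrapProb_eq (hn : 0 < n) (x : Fin n → Fin p → ℝ) {A : Set (Fin p → ℝ)}
    (hA : MeasurableSet A) : bootstrapProb x A =
      resampleMean fun κ => if resampleSum (fun i => x i - sampleMean x) κ ∈ A then 1 else 0 := by
  have := isProbabilityMeasure_uniformIndex hn
  have h1 : bootstrapSampleLaw x =
      (Measure.pi fun _ : Fin n => uniformIndex n).map (fun κ i => x (κ i)) := by
    have : ∀ i : Fin n, SigmaFinite ((uniformIndex n).map x) := fun i => by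
      have := Measure.isProbabilityMeasure_map (μ := uniformIndex n)
        (measurable_of_finite x).aemeasurable
      infer_instance
    rw [bootstrapSampleLaw, empiricalMeasure_eq_map]
    exact (Measure.pi_map_pi (f := fun _ => x) fun _ => (measurable_of_finite x).aemeasurable).symm
  have hm := measurable_normalizedSum_sub (n := n) (sampleMean x) hA
  rw [bootstrapProb, h1, measureReal_def]
  erw [Measure.map_apply (measurable_of_finite _) hm]
  rw [← measureReal_def]
  set S := (fun (κ : Fin n → Fin n) i => x (κ i)) ⁻¹'
    ((fun xs : Fin n → Fin p → ℝ => normalizedSum fun i => xs i - sampleMean x) ⁻¹' A) with hS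
  have h2 : S = ((Finset.univ.filter fun κ : Fin n → Fin n =>
      resampleSum (fun i => x i - sampleMean x) κ ∈ A : Finset _) : Set (Fin n → Fin n)) := by
    ext κ; simp [hS, resampleSum_sub_sampleMean]
  rw [h2, ← sum_measureReal_singleton]
  simp only [pi_uniformIndex_real_singleton _ hn]
  rw [resampleMean, Finset.sum_boole, Finset.sum_const, nsmul_eq_mul, div_eq_mul_inv]

/-- The finite sides of a hyperrectangle: upper end points on the left, lower ones on the right. -/
def FiniteSide (a b : Fin p → EReal) : Type :=
  {z : Fin p ⊕ Fin p // Sum.elim (fun j => b j ≠ ⊤) (fun j => a j ≠ ⊥) z}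

instance (a b : Fin p → EReal) : Fintype (FiniteSide a b) := by
  classical
  unfold FiniteSide
  infer_instance

/-- The coordinate a side belongs to. -/
def FiniteSide.coord {a b : Fin p → EReal} (k : FiniteSide a b) : Fin p := Sum.elim id id k.1

/-- The sign of a side: `1` for upper and `-1` for lower end points. -/
def FiniteSide.sign {a b : Fin p → EReal} (k : FiniteSide a b) : ℝ :=
  Sum.elim (fun _ => 1) (fun _ => -1) k.1

/-- The threshold of a side. -/
def FiniteSide.bound {a b : Fin p → EReal} (k : FiniteSide a b) : ℝ :=
  Sum.elim (fun j => (b j).toReal) (fun j => -(a j).toReal) k.1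

theorem FiniteSide.abs_sign {a b : Fin p → EReal} (k : FiniteSide a b) : |k.sign| = 1 := by
  obtain ⟨z | z, hz⟩ := k <;> simp [FiniteSide.sign]

theorem FiniteSide.card_le (a b : Fin p → EReal) : Fintype.card (FiniteSide a b) ≤ 2 * p := by
  classical
  have := Fintype.card_le_of_injective (fun k : FiniteSide a b => k.1) Subtype.val_injective
  simpa [two_mul] using this

/-- Infinite end points impose no constraint, and dropping them leaves real thresholds. Lower end
points become upper ones after a change of sign. -/
theorem mem_rectangle_iff {a b : Fin p → EReal} (ha : ∀ j, a j ≠ ⊤) (hb : ∀ j, b j ≠ ⊥)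
    (w : Fin p → ℝ) : (∀ j, a j ≤ (w j : EReal) ∧ (w j : EReal) ≤ b j) ↔
      ∀ k : FiniteSide a b, k.sign * w k.coord ≤ k.bound := by
  constructor
  · rintro h ⟨j | j, hj⟩
    · have := (h j).2
      change b j ≠ ⊤ at hj
      rw [← EReal.coe_toReal hj (hb j), EReal.coe_le_coe_iff] at this
      simpa [FiniteSide.sign, FiniteSide.coord, FiniteSide.bound] using this
    · have := (h j).1
      change a j ≠ ⊥ at hj
      rw [← EReal.coe_toReal (ha j) hj, EReal.coe_le_coe_iff] at this
      simpa [FiniteSide.sign, FiniteSide.coord, FiniteSide.bound] using this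
  · intro h j
    constructor
    · by_cases hj : a j = ⊥
      · rw [hj]; exact bot_le
      · have := h ⟨Sum.inr j, hj⟩
        rw [← EReal.coe_toReal (ha j) hj, EReal.coe_le_coe_iff]
        simpa [FiniteSide.sign, FiniteSide.coord, FiniteSide.bound] using this
    · by_cases hj : b j = ⊤
      · rw [hj]; exact le_top
      · have := h ⟨Sum.inl j, hj⟩
        rw [← EReal.coe_toReal hj (hb j), EReal.coe_le_coe_iff]
        simpa [FiniteSide.sign, FiniteSide.coord, FiniteSide.bound] using this

theorem measurableSet_of_mem_hyperrectangles {A : Set (Fin p → ℝ)} (hA : A ∈ hyperrectangles p) :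
    MeasurableSet A := by
  obtain ⟨a, b, -, rfl⟩ := hA
  have : {w : Fin p → ℝ | ∀ j, a j ≤ (w j : EReal) ∧ (w j : EReal) ≤ b j} =
      ⋂ j, {w | a j ≤ (w j : EReal)} ∩ {w | (w j : EReal) ≤ b j} := by ext; simp
  rw [this]
  exact MeasurableSet.iInter fun j =>
    (measurableSet_le measurable_const (measurable_pi_apply j).coe_real_ereal).inter
      (measurableSet_le (measurable_pi_apply j).coe_real_ereal measurable_const)

variable {Ω' : Type*} [MeasurableSpace Ω'] {Q : Measure Ω'} {K : ℝ}

/-- Gaussian approximation of the bootstrap distribution on hyperrectangles, for deterministic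
data. -/
theorem abs_bootstrapProb_sub_le {S : Ω' → Fin p → ℝ} {Sg : Fin p → Fin p → ℝ}
    (h : IsCenteredGaussian Q S Sg) (χ : SmoothCutoff K)
    (hK1 : 1 ≤ K) {ℓ b M L Δ r : ℝ} (hn : 0 < n) (hr : 0 < r) (hℓ : 1 ≤ ℓ)
    (hcard : Real.log (2 * p) ≤ ℓ) (hb : 0 < b) (hbS : ∀ j, b ≤ Sg j j)
    {x : Fin n → Fin p → ℝ} (hM : ∀ i j, |x i j - sampleMean x j| ≤ M)
    (hL : ∀ j, (∑ i, |x i j - sampleMean x j| ^ 3) / n ≤ L)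
    (hΔ : ∀ j k, |secondMoment (fun i => x i - sampleMean x) j k - Sg j k| ≤ Δ)
    (hr1 : L * ℓ ^ 2 / √n ≤ r ^ 3) (hr2 : Δ * ℓ ≤ r ^ 2) (hr3 : M * ℓ / √n ≤ r)
    {A : Set (Fin p → ℝ)} (hA : A ∈ hyperrectangles p) :
    |bootstrapProb x A - Q.real {ω | S ω ∈ A}| ≤ 2500 * Real.exp 5 * K / √b * √ℓ * r := by
  classical
  have := h.gaussian.isProbabilityMeasure
  have hC : 0 ≤ 2500 * Real.exp 5 * K / √b * √ℓ * r := by positivity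
  have hn' : (0 : ℝ) < n := by positivity
  rw [bootstrapProb_eq hn x (measurableSet_of_mem_hyperrectangles hA)]
  obtain ⟨a, c, -, rfl⟩ := hA
  -- End points of this kind are allowed, but no real vector meets them and the set is empty.
  by_cases ha : ∃ j, a j = ⊤ ∨ c j = ⊥
  · obtain ⟨j, hj⟩ := ha
    have he : {w : Fin p → ℝ | ∀ j, a j ≤ (w j : EReal) ∧ (w j : EReal) ≤ c j} = ∅ := by
      ext w
      simp only [Set.mem_ofPred_eq, Set.mem_empty_iff_false, iff_false]
      intro hw
      rcases hj with hj | hj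
      · have := (hw j).1; rw [hj, top_le_iff] at this; exact EReal.coe_ne_top _ this
      · have := (hw j).2; rw [hj, le_bot_iff] at this; exact EReal.coe_ne_bot _ this
    rw [he]
    simpa [resampleMean] using hC
  push Not at ha
  have hmem := mem_rectangle_iff (fun j => (ha j).1) (fun j => (ha j).2)
  have hAeq : {w : Fin p → ℝ | ∀ j, a j ≤ (w j : EReal) ∧ (w j : EReal) ≤ c j}
      = {w | ∀ k : FiniteSide a c, k.sign * w k.coord ≤ k.bound} := Set.ext hmem
  rw [hAeq]
  -- Without finite sides the set is the whole space; the softmax estimates need a nonempty index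
  -- type.
  rcases isEmpty_or_nonempty (FiniteSide a c) with he | hne
  · simp only [IsEmpty.forall_iff, Set.ofPred_true, Set.mem_univ, if_true]
    rw [resampleMean_const hn, probReal_univ, sub_self, abs_zero]
    exact hC
  set v : Fin n → FiniteSide a c → ℝ := fun i k => k.sign * (x i k.coord - sampleMean x k.coord)
    with hv
  have hvabs : ∀ i k, |v i k| = |x i k.coord - sampleMean x k.coord| := fun i k => by
    rw [hv, abs_mul, k.abs_sign, one_mul]
  have hG := h.linear_image (fun k : FiniteSide a c => k.sign) fun k => k.coord
  have hcard' : Real.log (Fintype.card (FiniteSide a c)) ≤ ℓ := by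
    refine le_trans (Real.log_le_log (by exact_mod_cast Fintype.card_pos) ?_) hcard
    exact_mod_cast FiniteSide.card_le a c
  have hsum0 : ∀ j, ∑ i, (x i j - sampleMean x j) = 0 := fun j => by
    rw [Finset.sum_sub_distrib, Finset.sum_const, Finset.card_univ, Fintype.card_fin, nsmul_eq_mul,
      sampleMean, mul_div_cancel₀ _ hn'.ne', sub_self]
  have hsgn : ∀ k : FiniteSide a c, k.sign * k.sign = 1 := fun k => by
    rw [← abs_mul_abs_self, k.abs_sign, one_mul]
  have key := abs_resampleMean_orthant_sub_le hG χ hK1 hn hr hℓ hcard' hb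
    (fun k => by rw [hsgn, one_mul]; exact hbS _) (v := v) (M := M) (L := L) (Δ := Δ)
    (fun k => by simp only [hv]; rw [← Finset.mul_sum, hsum0, mul_zero])
    (fun i k => by rw [hvabs]; exact hM _ _)
    (fun k => by simp only [hvabs]; exact hL _)
    (fun k l => by
      have : secondMoment v k l = k.sign * l.sign *
          secondMoment (fun i => x i - sampleMean x) k.coord l.coord := by
        simp only [secondMoment, hv, Pi.sub_apply]
        rw [← mul_div_assoc, Finset.mul_sum]
        congr 1
        exact Finset.sum_congr rfl fun i _ => by ring
      rw [this, ← mul_sub, abs_mul, abs_mul, k.abs_sign, l.abs_sign, one_mul, one_mul]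
      exact hΔ _ _) hr1 hr2 hr3 (fun k => k.bound)
  have e : ∀ κ (k : FiniteSide a c), resampleSum v κ k =
      k.sign * resampleSum (fun i => x i - sampleMean x) κ k.coord := fun κ k => by
    simp only [resampleSum, hv, Pi.sub_apply]
    rw [← mul_div_assoc, Finset.mul_sum]
  simp only [e] at key
  convert! key

end Bootstrap

/-! ### Bernstein's inequality and truncation. -/

section Concentration

variable {Ω : Type*} [MeasurableSpace Ω] {P : Measure Ω} [IsProbabilityMeasure P] {n p : ℕ}

/-- Integrate `exp x ≤ 1 + x + x ^ 2`, valid for `|x| ≤ 1`, and use `1 + y ≤ exp y`. -/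
theorem mgf_le_of_bounded {X : Ω → ℝ} (hX : Measurable X) {R lam : ℝ}
    (hR : ∀ ω, |X ω| ≤ R) (hlam : 0 ≤ lam) (h1 : lam * R ≤ 1) :
    mgf X P lam ≤ Real.exp (lam * ∫ ω, X ω ∂P + lam ^ 2 * ∫ ω, X ω ^ 2 ∂P) := by
  have i1 : Integrable X P := Integrable.of_bound hX.aestronglyMeasurable R (ae_of_all _ hR)
  have i2 : Integrable (fun ω => X ω ^ 2) P :=
    Integrable.of_bound (hX.pow_const 2).aestronglyMeasurable (R ^ 2) (ae_of_all _ fun ω => by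
      rw [Real.norm_eq_abs, abs_pow]; exact pow_le_pow_left₀ (abs_nonneg _) (hR ω) 2)
  have hb : ∀ ω, |lam * X ω| ≤ 1 := fun ω => by
    rw [abs_mul, abs_of_nonneg hlam]
    exact (mul_le_mul_of_nonneg_left (hR ω) hlam).trans h1
  have h2 : ∀ ω, Real.exp (lam * X ω) ≤ 1 + (lam * X ω + lam ^ 2 * X ω ^ 2) := fun ω => by
    have := (abs_le.1 (Real.abs_exp_sub_one_sub_id_le (hb ω))).2
    nlinarith
  have i3 : Integrable (fun ω => lam * X ω + lam ^ 2 * X ω ^ 2) P :=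
    (i1.const_mul lam).add (i2.const_mul _)
  have i4 : Integrable (fun ω => Real.exp (lam * X ω)) P :=
    Integrable.of_bound (hX.const_mul lam).exp.aestronglyMeasurable (Real.exp 1)
      (ae_of_all _ fun ω => by
        rw [Real.norm_eq_abs, Real.abs_exp]
        exact Real.exp_le_exp.2 ((le_abs_self _).trans (hb ω)))
  calc mgf X P lam ≤ ∫ ω, (1 + (lam * X ω + lam ^ 2 * X ω ^ 2)) ∂P :=
        integral_mono i4 ((integrable_const _).add i3) h2
    _ = (lam * ∫ ω, X ω ∂P + lam ^ 2 * ∫ ω, X ω ^ 2 ∂P) + 1 := by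
        rw [integral_add (integrable_const _) i3, integral_add (i1.const_mul lam) (i2.const_mul _),
          integral_const_mul, integral_const_mul]
        simp; ring
    _ ≤ _ := Real.add_one_le_exp _

/-- Bernstein's inequality in the Chernoff form. -/
theorem measure_sum_ge_le {X : Fin n → Ω → ℝ} (hX : ∀ i, Measurable (X i)) (hind : iIndepFun X P)
    {R V lam t : ℝ} (hR : ∀ i ω, |X i ω| ≤ R) (hV : ∑ i, ∫ ω, X i ω ^ 2 ∂P ≤ V)
    (hlam : 0 < lam) (h1 : lam * R ≤ 1) :
    P.real {ω | ∑ i, ∫ ω, X i ω ∂P + (lam * V + t / lam) ≤ ∑ i, X i ω} ≤ Real.exp (-t) := by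
  have hm : Measurable (∑ i, X i) := by
    have : (∑ i, X i) = fun ω => ∑ i, X i ω := by ext; simp
    rw [this]; exact Finset.measurable_fun_sum _ fun i _ => hX i
  have hint : Integrable (fun ω => Real.exp (lam * (∑ i, X i) ω)) P := by
    refine Integrable.of_bound (hm.const_mul lam).exp.aestronglyMeasurable (Real.exp (lam * (n * R)))
      (ae_of_all _ fun ω => ?_)
    rw [Real.norm_eq_abs, Real.abs_exp, Finset.sum_apply]
    gcongr
    calc ∑ i, X i ω ≤ ∑ _i : Fin n, R := Finset.sum_le_sum fun i _ => (le_abs_self _).trans (hR i ω)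
      _ = n * R := by simp
  have h := measure_ge_le_exp_mul_mgf (μ := P) (X := ∑ i, X i)
    (∑ i, ∫ ω, X i ω ∂P + (lam * V + t / lam)) hlam.le hint
  simp only [Finset.sum_apply] at h
  refine h.trans ?_
  rw [hind.mgf_sum hX]
  calc _ ≤ Real.exp (-lam * (∑ i, ∫ ω, X i ω ∂P + (lam * V + t / lam))) *
        ∏ i, Real.exp (lam * ∫ ω, X i ω ∂P + lam ^ 2 * ∫ ω, X i ω ^ 2 ∂P) := by
        gcongr with i _
        · exact fun i _ => mgf_nonneg
        · exact mgf_le_of_bounded (hX i) (hR i) hlam.le h1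
    _ ≤ Real.exp (-t) := by
        rw [← Real.exp_sum, ← Real.exp_add, Finset.sum_add_distrib, ← Finset.mul_sum,
          ← Finset.mul_sum]
        refine Real.exp_le_exp.2 ?_
        have e : lam * (t / lam) = t := mul_div_cancel₀ t hlam.ne'
        have := mul_le_mul_of_nonneg_left hV (sq_nonneg lam)
        nlinarith

/-- The coordinates of `z`, together with a constant coordinate `1`. -/
def extCoord (z : Fin p → ℝ) : Option (Fin p) → ℝ
  | none => 1
  | some j => z j

theorem measurable_extCoord (a : Option (Fin p)) : Measurable fun z : Fin p → ℝ => extCoord z a := by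
  cases a with
  | none => exact measurable_const
  | some j => exact measurable_pi_apply j

open Classical in
/-- The indicator of the cube of radius `M`. -/
def cubeInd (M : ℝ) (z : Fin p → ℝ) : ℝ := if ∀ j, |z j| ≤ M then 1 else 0

theorem measurableSet_cube (M : ℝ) : MeasurableSet {z : Fin p → ℝ | ∀ j, |z j| ≤ M} := by
  have : {z : Fin p → ℝ | ∀ j, |z j| ≤ M} = ⋂ j, {z | |z j| ≤ M} := by ext; simp
  rw [this]
  exact MeasurableSet.iInter fun j => measurableSet_le (by fun_prop) measurable_const

theorem measurable_cubeInd (M : ℝ) : Measurable (cubeInd (p := p) M) :=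
  Measurable.ite (measurableSet_cube M) measurable_const measurable_const

theorem cubeInd_eq_one {M : ℝ} {z : Fin p → ℝ} (h : ∀ j, |z j| ≤ M) : cubeInd M z = 1 := if_pos h

theorem cubeInd_mem (M : ℝ) (z : Fin p → ℝ) : cubeInd M z = 0 ∨ cubeInd M z = 1 := by
  unfold cubeInd; split_ifs <;> simp

theorem abs_cubeInd_mul_le {M R : ℝ} (hR : 0 ≤ R) {z : Fin p → ℝ} {c : ℝ}
    (h : (∀ j, |z j| ≤ M) → |c| ≤ R) : |cubeInd M z * c| ≤ R := by
  unfold cubeInd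
  split_ifs with hz
  · rw [one_mul]; exact h hz
  · simpa using hR

theorem abs_cubeInd_mul_le_abs (M : ℝ) (z : Fin p → ℝ) (c : ℝ) : |cubeInd M z * c| ≤ |c| := by
  rcases cubeInd_mem M z with h | h <;> simp [h]

theorem abs_extCoord_le {M : ℝ} (hM : 1 ≤ M) {z : Fin p → ℝ} (hz : ∀ j, |z j| ≤ M)
    (a : Option (Fin p)) : |extCoord z a| ≤ M := by
  cases a with
  | none => simpa [extCoord] using hM
  | some j => exact hz j

variable {X : Fin n → Ω → Fin p → ℝ} {B : ℝ}

theorem integrable_extCoord_pow_four (h2 : CondM2 P X B) (i : Fin n) (a : Option (Fin p)) :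
    Integrable (fun ω => extCoord (X i ω) a ^ 4) P := by
  cases a with
  | none => simp [extCoord]
  | some j =>
    have := (h2 j 2 (Or.inr rfl)).1 i
    refine this.congr (ae_of_all _ fun ω => ?_)
    exact (even_two_mul 2).pow_abs (X i ω j)

theorem sum_extCoord_pow_four_le (hn : 0 < n) (hB : 1 ≤ B) (h2 : CondM2 P X B)
    (a : Option (Fin p)) : ∑ i, ∫ ω, extCoord (X i ω) a ^ 4 ∂P ≤ n * B ^ 2 := by
  have hn' : (0 : ℝ) < n := by positivity
  cases a with
  | none =>
    simp only [extCoord, one_pow, integral_const, probReal_univ, smul_eq_mul, mul_one,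
      Finset.sum_const, Finset.card_univ, Fintype.card_fin, nsmul_eq_mul]
    exact le_mul_of_one_le_right hn'.le (one_le_pow₀ hB)
  | some j =>
    have := (h2 j 2 (Or.inr rfl)).2
    rw [div_le_iff₀ hn'] at this
    have e : ∀ i, ∫ ω, extCoord (X i ω) (some j) ^ 4 ∂P = ∫ ω, |X i ω j| ^ (2 + 2) ∂P := fun i =>
      integral_congr_ae (ae_of_all _ fun ω => ((even_two_mul 2).pow_abs (X i ω j)).symm)
    simp only [e]
    linarith

theorem integrable_extCoord_mul_sq (hX : IsCenteredSample P X) (h2 : CondM2 P X B) (i : Fin n)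
    (a c : Option (Fin p)) :
    Integrable (fun ω => (extCoord (X i ω) a * extCoord (X i ω) c) ^ 2) P := by
  refine Integrable.mono' ((integrable_extCoord_pow_four h2 i a).add
    (integrable_extCoord_pow_four h2 i c)) ?_ (ae_of_all _ fun ω => ?_)
  · exact ((((measurable_extCoord a).comp (hX.measurable i)).mul
      ((measurable_extCoord c).comp (hX.measurable i))).pow_const 2).aestronglyMeasurable
  · rw [Real.norm_eq_abs, abs_of_nonneg (sq_nonneg _)]
    simp only [Pi.add_apply]
    nlinarith [sq_nonneg (extCoord (X i ω) a ^ 2 - extCoord (X i ω) c ^ 2),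
      sq_nonneg (extCoord (X i ω) a ^ 2), sq_nonneg (extCoord (X i ω) c ^ 2)]

theorem sum_extCoord_mul_sq_le (hn : 0 < n) (hB : 1 ≤ B) (hX : IsCenteredSample P X)
    (h2 : CondM2 P X B) (a c : Option (Fin p)) :
    ∑ i, ∫ ω, (extCoord (X i ω) a * extCoord (X i ω) c) ^ 2 ∂P ≤ n * B ^ 2 := by
  have ha := sum_extCoord_pow_four_le hn hB h2 a
  have hc := sum_extCoord_pow_four_le hn hB h2 c
  calc _ ≤ ∑ i, (1 / 2 * ∫ ω, extCoord (X i ω) a ^ 4 ∂P + 1 / 2 * ∫ ω, extCoord (X i ω) c ^ 4 ∂P) := by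
        refine Finset.sum_le_sum fun i _ => ?_
        rw [← integral_const_mul, ← integral_const_mul,
          ← integral_add ((integrable_extCoord_pow_four h2 i a).const_mul _)
            ((integrable_extCoord_pow_four h2 i c).const_mul _)]
        refine integral_mono (integrable_extCoord_mul_sq hX h2 i a c)
          (((integrable_extCoord_pow_four h2 i a).const_mul _).add
            ((integrable_extCoord_pow_four h2 i c).const_mul _)) fun ω => ?_
        nlinarith [sq_nonneg (extCoord (X i ω) a ^ 2 - extCoord (X i ω) c ^ 2)]
    _ ≤ _ := by
        rw [Finset.sum_add_distrib, ← Finset.mul_sum, ← Finset.mul_sum]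
        linarith

theorem integrable_extCoord_mul (hX : IsCenteredSample P X) (h2 : CondM2 P X B) (i : Fin n)
    (a c : Option (Fin p)) : Integrable (fun ω => extCoord (X i ω) a * extCoord (X i ω) c) P := by
  refine Integrable.mono' ((integrable_const (1 : ℝ)).add (integrable_extCoord_mul_sq hX h2 i a c))
    ?_ (ae_of_all _ fun ω => ?_)
  · exact (((measurable_extCoord a).comp (hX.measurable i)).mul
      ((measurable_extCoord c).comp (hX.measurable i))).aestronglyMeasurable
  · simp only [Pi.add_apply, Real.norm_eq_abs]
    have := sq_abs (extCoord (X i ω) a * extCoord (X i ω) c)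
    nlinarith [sq_nonneg (|extCoord (X i ω) a * extCoord (X i ω) c| - 1),
      sq_nonneg (extCoord (X i ω) a * extCoord (X i ω) c)]

/-- The bias caused by truncation. -/
theorem abs_sum_truncation_bias_le (hn : 0 < n) (hB : 1 ≤ B) (hX : IsCenteredSample P X)
    (h2 : CondM2 P X B) {M α : ℝ} (hα : α ≤ 1)
    (hM : ∑ i, P.real {ω | ¬ ∀ j, |X i ω j| ≤ M} ≤ α) (a c : Option (Fin p)) :
    |∑ i, ∫ ω, cubeInd M (X i ω) * (extCoord (X i ω) a * extCoord (X i ω) c) ∂P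
      - ∑ i, ∫ ω, extCoord (X i ω) a * extCoord (X i ω) c ∂P| ≤ B * √n := by
  have hn' : (0 : ℝ) < n := by positivity
  have hsn : 0 < √(n : ℝ) := Real.sqrt_pos.2 hn'
  have hsn2 : √(n : ℝ) ^ 2 = n := Real.sq_sqrt hn'.le
  have hB0 : 0 < B := by linarith
  -- The weight in `|Y| ≤ η / 2 * Y ^ 2 + 1 / (2 * η)`, chosen to balance the second moment sum `n *
  -- B ^ 2` against a total tail probability of at most one.
  set η := 1 / (B * √n) with hη
  have hη0 : 0 < η := by positivity
  let Y : Fin n → Ω → ℝ := fun i ω => extCoord (X i ω) a * extCoord (X i ω) c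
  have hbad : ∀ i, MeasurableSet {ω | ¬ ∀ j, |X i ω j| ≤ M} := fun i =>
    (hX.measurable i (measurableSet_cube M)).compl
  have hcm : ∀ i, Measurable fun ω => cubeInd M (X i ω) := fun i =>
    (measurable_cubeInd M).comp (hX.measurable i)
  have iY : ∀ i, Integrable (Y i) P := fun i => integrable_extCoord_mul hX h2 i a c
  have iY2 : ∀ i, Integrable (fun ω => Y i ω ^ 2) P := fun i =>
    integrable_extCoord_mul_sq hX h2 i a c
  have iT : ∀ i, Integrable (fun ω => cubeInd M (X i ω) * Y i ω) P := fun i =>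
    (iY i).mono ((hcm i).aestronglyMeasurable.mul (iY i).aestronglyMeasurable)
      (ae_of_all _ fun ω => abs_cubeInd_mul_le_abs _ _ _)
  have iI : ∀ i, Integrable ({ω | ¬ ∀ j, |X i ω j| ≤ M}.indicator (1 : Ω → ℝ)) P := fun i =>
    (integrable_const (1 : ℝ)).indicator (hbad i)
  have hi : ∀ i, |∫ ω, cubeInd M (X i ω) * Y i ω ∂P - ∫ ω, Y i ω ∂P| ≤
      η / 2 * ∫ ω, Y i ω ^ 2 ∂P + 1 / (2 * η) * P.real {ω | ¬ ∀ j, |X i ω j| ≤ M} := by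
    intro i
    rw [← integral_sub (iT i) (iY i), ← integral_indicator_one (hbad i), ← integral_const_mul,
      ← integral_const_mul, ← integral_add ((iY2 i).const_mul _) ((iI i).const_mul _)]
    refine abs_integral_le_integral_abs.trans (integral_mono ((iT i).sub (iY i)).abs
      (((iY2 i).const_mul _).add ((iI i).const_mul _)) fun ω => ?_)
    simp only
    by_cases hω : ∀ j, |X i ω j| ≤ M
    · rw [cubeInd_eq_one hω, one_mul, sub_self, abs_zero]
      have : (0 : ℝ) ≤ {ω | ¬ ∀ j, |X i ω j| ≤ M}.indicator (1 : Ω → ℝ) ω :=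
        Set.indicator_nonneg (fun _ _ => zero_le_one) _
      positivity
    · rw [Set.indicator_of_mem (by exact hω)]
      have : cubeInd M (X i ω) = 0 := if_neg hω
      rw [this, zero_mul, zero_sub, abs_neg, Pi.one_apply, mul_one, ← sq_abs (Y i ω)]
      have e : η / 2 * |Y i ω| ^ 2 + 1 / (2 * η) - |Y i ω| = (η * |Y i ω| - 1) ^ 2 / (2 * η) := by
        field_simp; ring
      have : 0 ≤ (η * |Y i ω| - 1) ^ 2 / (2 * η) := by positivity
      linarith
  rw [← Finset.sum_sub_distrib]
  calc _ ≤ ∑ i, (η / 2 * ∫ ω, Y i ω ^ 2 ∂P + 1 / (2 * η) * P.real {ω | ¬ ∀ j, |X i ω j| ≤ M}) :=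
        (Finset.abs_sum_le_sum_abs _ _).trans (Finset.sum_le_sum fun i _ => hi i)
    _ ≤ η / 2 * (n * B ^ 2) + 1 / (2 * η) * 1 := by
        rw [Finset.sum_add_distrib, ← Finset.mul_sum, ← Finset.mul_sum]
        gcongr
        · exact sum_extCoord_mul_sq_le hn hB hX h2 a c
        · exact hM.trans hα
    _ = B * √n := by
        rw [hη]; field_simp; rw [hsn2]; ring

end Concentration

/-! ### The event on which the empirical moments are controlled. -/

section GoodEvent

variable {Ω : Type*} [MeasurableSpace Ω] {P : Measure Ω} [IsProbabilityMeasure P] {n p : ℕ}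
  {X : Fin n → Ω → Fin p → ℝ} {B : ℝ}

theorem measure_truncated_product_ge_le (hn : 0 < n) (hB : 1 ≤ B) (hX : IsCenteredSample P X)
    (h2 : CondM2 P X B) {M t : ℝ} (hM1 : 1 ≤ M) (ht : 0 < t) {ε : ℝ} (hε : |ε| = 1)
    (a c : Option (Fin p)) :
    P.real {ω | ε * ∑ i, ∫ ω, cubeInd M (X i ω) * (extCoord (X i ω) a * extCoord (X i ω) c) ∂P
        + (2 * B * √(n * t) + t * M ^ 2) ≤
      ε * ∑ i, cubeInd M (X i ω) * (extCoord (X i ω) a * extCoord (X i ω) c)} ≤ Real.exp (-t) := by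
  have hn' : (0 : ℝ) < n := by positivity
  have hB0 : 0 < B := by linarith
  have hε2 : ε ^ 2 = 1 := by rw [← sq_abs, hε, one_pow]
  let F : (Fin p → ℝ) → ℝ := fun z => ε * (cubeInd M z * (extCoord z a * extCoord z c))
  have hF : Measurable F := ((measurable_cubeInd M).mul
    ((measurable_extCoord a).mul (measurable_extCoord c))).const_mul ε
  -- Adding the variance scale and the range scale in the denominator gives the variance term at
  -- most `B * √(n * t)`, the deviation term `t / lam = B * √(n * t) + t * M ^ 2`, and `lam * M ^ 2
  -- ≤ 1`, without minimizing over cases.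
  set lam := 1 / (B * √(n / t) + M ^ 2) with hlam
  have hden : 0 < B * √(n / t) + M ^ 2 := by positivity
  have hlam0 : 0 < lam := by positivity
  have hb : ∀ i ω, |F (X i ω)| ≤ M ^ 2 := fun i ω => by
    simp only [F]
    rw [abs_mul, hε, one_mul]
    refine abs_cubeInd_mul_le (by positivity) fun hz => ?_
    rw [abs_mul, sq]
    exact mul_le_mul (abs_extCoord_le hM1 hz a) (abs_extCoord_le hM1 hz c) (abs_nonneg _)
      (by linarith)
  have hV : ∑ i, ∫ ω, F (X i ω) ^ 2 ∂P ≤ n * B ^ 2 := by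
    refine (Finset.sum_le_sum fun i _ => ?_).trans (sum_extCoord_mul_sq_le hn hB hX h2 a c)
    refine integral_mono_of_nonneg (ae_of_all _ fun ω => sq_nonneg _)
      (integrable_extCoord_mul_sq hX h2 i a c) (ae_of_all _ fun ω => ?_)
    simp only [F, mul_pow, hε2, one_mul]
    rcases cubeInd_mem M (X i ω) with h | h <;> rw [h]
    · have := sq_nonneg (extCoord (X i ω) a * extCoord (X i ω) c)
      rw [mul_pow] at this
      simpa using this
    · simp
  have h1 : lam * M ^ 2 ≤ 1 := by
    rw [hlam, one_div_mul_eq_div, div_le_one hden]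
    have : 0 ≤ B * √(n / t) := by positivity
    linarith
  have key := measure_sum_ge_le (X := fun i ω => F (X i ω)) (fun i => hF.comp (hX.measurable i))
    (hX.indep.comp (fun _ => F) fun _ => hF) hb hV hlam0 h1 (t := t)
  refine le_trans (measureReal_mono (fun ω hω => ?_) (measure_ne_top _ _)) key
  have hst : √(n / t) * t = √(n * t) := by
    rw [← Real.sqrt_mul_self ht.le, ← Real.sqrt_mul (by positivity)]
    congr 1
    rw [Real.sqrt_mul_self ht.le]; field_simp
  have hst2 : √(n / t) * √(n * t) = n := by
    rw [← Real.sqrt_mul (by positivity)]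
    have : (n : ℝ) / t * (n * t) = n * n := by field_simp
    rw [this, Real.sqrt_mul_self hn'.le]
  have e1 : t / lam = B * √(n * t) + t * M ^ 2 := by
    rw [hlam, div_div_eq_mul_div, div_one, ← hst]; ring
  have e2 : lam * (n * B ^ 2) ≤ B * √(n * t) := by
    rw [hlam, one_div_mul_eq_div, div_le_iff₀ hden]
    have : 0 ≤ B * √(n * t) * M ^ 2 := by positivity
    calc (n : ℝ) * B ^ 2 = B * √(n * t) * (B * √(n / t)) := by
          linear_combination (-(B ^ 2)) * hst2
      _ ≤ _ := by rw [mul_add]; linarith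
  rw [Set.mem_ofPred_eq] at hω
  change ∑ i, ∫ ω, F (X i ω) ∂P + (lam * (n * B ^ 2) + t / lam) ≤ ∑ i, F (X i ω)
  simp only [F, integral_const_mul, ← Finset.mul_sum]
  linarith

/-- The second moment of a truncated cube is at most `M ^ 3` times its mean. With `lam = 1 / M ^ 3`
the variance term of Bernstein's bound is then a second copy of the bound `n * B` on the mean, so no
sixth moments are needed. -/
theorem measure_truncated_cube_ge_le (hn : 0 < n) (hX : IsCenteredSample P X)
    (h2 : CondM2 P X B) {M t : ℝ} (hM1 : 1 ≤ M) (j : Fin p) :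
    P.real {ω | 2 * (n * B) + M ^ 3 * t ≤ ∑ i, cubeInd M (X i ω) * |X i ω j| ^ 3}
      ≤ Real.exp (-t) := by
  have hn' : (0 : ℝ) < n := by positivity
  have hM0 : 0 < M := by linarith
  let F : (Fin p → ℝ) → ℝ := fun z => cubeInd M z * |z j| ^ 3
  have hF : Measurable F := (measurable_cubeInd M).mul (by fun_prop)
  have hF0 : ∀ z, 0 ≤ F z := fun z => by
    rcases cubeInd_mem M z with h | h <;> simp only [F, h]
    · simp
    · positivity
  have hb : ∀ i ω, |F (X i ω)| ≤ M ^ 3 := fun i ω =>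
    abs_cubeInd_mul_le (by positivity) fun hz => by
      rw [abs_pow, abs_abs]; exact pow_le_pow_left₀ (abs_nonneg _) (hz j) 3
  have iX : ∀ i, Integrable (fun ω => |X i ω j| ^ 3) P := fun i => (h2 j 1 (Or.inl rfl)).1 i
  have hsum : ∑ i, ∫ ω, |X i ω j| ^ 3 ∂P ≤ n * B := by
    have := (h2 j 1 (Or.inl rfl)).2
    rw [div_le_iff₀ hn', pow_one] at this
    linarith
  have iF : ∀ i, Integrable (fun ω => F (X i ω)) P := fun i =>
    Integrable.of_bound (hF.comp (hX.measurable i)).aestronglyMeasurable _ (ae_of_all _ (hb i))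
  have hE : ∑ i, ∫ ω, F (X i ω) ∂P ≤ n * B := by
    refine (Finset.sum_le_sum fun i _ => integral_mono (iF i) (iX i) fun ω => ?_).trans hsum
    have := abs_cubeInd_mul_le_abs M (X i ω) (|X i ω j| ^ 3)
    rw [abs_of_nonneg (hF0 (X i ω)), abs_pow, abs_abs] at this
    exact this
  have hV : ∑ i, ∫ ω, F (X i ω) ^ 2 ∂P ≤ M ^ 3 * (n * B) := by
    refine le_trans (Finset.sum_le_sum (g := fun i => M ^ 3 * ∫ ω, F (X i ω) ∂P) fun i _ => ?_) ?_
    · rw [← integral_const_mul]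
      refine integral_mono_of_nonneg (ae_of_all _ fun ω => sq_nonneg _) ((iF i).const_mul _)
        (ae_of_all _ fun ω => ?_)
      have := hb i ω
      rw [abs_of_nonneg (hF0 _)] at this
      simp only [sq]
      exact mul_le_mul_of_nonneg_right this (hF0 _)
    · rw [← Finset.mul_sum]; gcongr
  have key := measure_sum_ge_le (X := fun i ω => F (X i ω)) (fun i => hF.comp (hX.measurable i))
    (hX.indep.comp (fun _ => F) fun _ => hF) hb hV (lam := 1 / M ^ 3) (by positivity)
    (by rw [one_div_mul_cancel (by positivity)]) (t := t)
  refine le_trans (measureReal_mono (fun ω hω => ?_) (measure_ne_top _ _)) key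
  have e : 1 / M ^ 3 * (M ^ 3 * (n * B)) + t / (1 / M ^ 3) = n * B + M ^ 3 * t := by field_simp
  have hω' : 2 * (n * B) + M ^ 3 * t ≤ ∑ i, F (X i ω) := hω
  change ∑ i, ∫ ω, F (X i ω) ∂P + (1 / M ^ 3 * (M ^ 3 * (n * B)) + t / (1 / M ^ 3)) ≤
    ∑ i, F (X i ω)
  rw [e]
  linarith

/-- Outside an event of small probability the data are bounded, and their empirical moments are
close to the population moments. -/
theorem exists_bad_event (hn : 0 < n) (hB : 1 ≤ B) (hX : IsCenteredSample P X)
    (h2 : CondM2 P X B) {M t α : ℝ} (hM1 : 1 ≤ M) (ht : 0 < t) (hα : α ≤ 1)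
    (hM : ∑ i, P.real {ω | ¬ ∀ j, |X i ω j| ≤ M} ≤ α) :
    ∃ bad : Set Ω, P.real bad ≤ α + 3 * ((p : ℝ) + 1) ^ 2 * Real.exp (-t) ∧ ∀ ω ∉ bad,
      (∀ i j, |X i ω j| ≤ M) ∧
      (∀ a c, |∑ i, extCoord (X i ω) a * extCoord (X i ω) c
        - ∑ i, ∫ ω, extCoord (X i ω) a * extCoord (X i ω) c ∂P| ≤
          2 * B * √(n * t) + t * M ^ 2 + B * √n) ∧
      ∀ j, ∑ i, |X i ω j| ^ 3 ≤ 2 * (n * B) + M ^ 3 * t := by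
  let T : Option (Fin p) → Option (Fin p) → Ω → ℝ := fun a c ω =>
    ∑ i, cubeInd M (X i ω) * (extCoord (X i ω) a * extCoord (X i ω) c)
  let m : Option (Fin p) → Option (Fin p) → ℝ := fun a c =>
    ∑ i, ∫ ω, cubeInd M (X i ω) * (extCoord (X i ω) a * extCoord (X i ω) c) ∂P
  set D := 2 * B * √(n * t) + t * M ^ 2 with hD
  let E₁ : Set Ω := ⋃ i, {ω | ¬ ∀ j, |X i ω j| ≤ M}
  let E₂ : Set Ω := ⋃ a, ⋃ c, ({ω | 1 * m a c + D ≤ 1 * T a c ω} ∪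
    {ω | -1 * m a c + D ≤ -1 * T a c ω})
  let E₃ : Set Ω := ⋃ j, {ω | 2 * (n * B) + M ^ 3 * t ≤ ∑ i, cubeInd M (X i ω) * |X i ω j| ^ 3}
  have h₁ : P.real E₁ ≤ α := (measureReal_iUnion_fintype_le _).trans hM
  have h₂ : P.real E₂ ≤ 2 * ((p : ℝ) + 1) ^ 2 * Real.exp (-t) := by
    calc P.real E₂ ≤ ∑ _a : Option (Fin p), ∑ _c : Option (Fin p),
          (Real.exp (-t) + Real.exp (-t)) := by
          refine (measureReal_iUnion_fintype_le _).trans (Finset.sum_le_sum fun a _ => ?_)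
          refine (measureReal_iUnion_fintype_le _).trans (Finset.sum_le_sum fun c _ => ?_)
          refine (measureReal_union_le _ _).trans (add_le_add ?_ ?_)
          · exact measure_truncated_product_ge_le hn hB hX h2 hM1 ht (by simp) a c
          · exact measure_truncated_product_ge_le hn hB hX h2 hM1 ht (by simp) a c
      _ = _ := by simp; ring
  have h₃ : P.real E₃ ≤ ((p : ℝ) + 1) ^ 2 * Real.exp (-t) := by
    calc P.real E₃ ≤ ∑ _j : Fin p, Real.exp (-t) :=
          (measureReal_iUnion_fintype_le _).trans (Finset.sum_le_sum fun j _ =>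
            measure_truncated_cube_ge_le hn hX h2 hM1 j)
      _ = p * Real.exp (-t) := by simp
      _ ≤ _ := by
          gcongr
          nlinarith [(Nat.cast_nonneg p : (0 : ℝ) ≤ p)]
  refine ⟨E₁ ∪ E₂ ∪ E₃, ?_, fun ω hω => ?_⟩
  · have := measureReal_union_le (μ := P) (E₁ ∪ E₂) E₃
    have := measureReal_union_le (μ := P) E₁ E₂
    linarith
  · have hω₁ : ω ∉ E₁ := fun h => hω (Or.inl (Or.inl h))
    have hω₂ : ω ∉ E₂ := fun h => hω (Or.inl (Or.inr h))
    have hω₃ : ω ∉ E₃ := fun h => hω (Or.inr h)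
    have hbd : ∀ i j, |X i ω j| ≤ M := by
      intro i
      by_contra hc
      exact hω₁ (Set.mem_iUnion.2 ⟨i, hc⟩)
    refine ⟨hbd, fun a c => ?_, fun j => ?_⟩
    · have hT : T a c ω = ∑ i, extCoord (X i ω) a * extCoord (X i ω) c :=
        Finset.sum_congr rfl fun i _ => by rw [cubeInd_eq_one (hbd i), one_mul]
      have hbias := abs_le.1 (abs_sum_truncation_bias_le hn hB hX h2 hα hM a c)
      have u1 : T a c ω < m a c + D := by
        by_contra! hc
        exact hω₂ (Set.mem_iUnion₂.2 ⟨a, c, Or.inl (by simpa using hc)⟩)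
      have u2 : m a c - D < T a c ω := by
        by_contra! hc
        refine hω₂ (Set.mem_iUnion₂.2 ⟨a, c, Or.inr ?_⟩)
        change -1 * m a c + D ≤ -1 * T a c ω
        linarith
      rw [← hT, abs_le]
      change -(B * √n) ≤ m a c - _ ∧ m a c - _ ≤ B * √n at hbias
      constructor <;> linarith [hbias.1, hbias.2]
    · by_contra! hc
      refine hω₃ (Set.mem_iUnion.2 ⟨j, ?_⟩)
      change _ ≤ ∑ i, cubeInd M (X i ω) * |X i ω j| ^ 3
      simp only [cubeInd_eq_one (hbd _), one_mul]
      exact hc.le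

end GoodEvent

/-! ### The Gaussian normalized sum and trivial bounds on the error. -/

section Analogue

variable {Ω Ω' : Type*} [MeasurableSpace Ω] [MeasurableSpace Ω'] {P : Measure Ω} {Q : Measure Ω'}
  [IsProbabilityMeasure Q] {n p : ℕ} {X : Fin n → Ω → Fin p → ℝ} {Y : Fin n → Ω' → Fin p → ℝ}

theorem IsGaussianAnalogue.memLp_two (hY : IsGaussianAnalogue P X Q Y) (i : Fin n) (j : Fin p) :
    MemLp (fun ω => Y i ω j) 2 Q :=
  (HasGaussianLaw.eval (X := fun j ω => Y i ω j) (hY.gaussian i) j).memLp_two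

theorem IsGaussianAnalogue.integral_mul_of_ne (hY : IsGaussianAnalogue P X Q Y) {i l : Fin n}
    (hil : i ≠ l) (j k : Fin p) : ∫ ω, Y i ω j * Y l ω k ∂Q = 0 := by
  have hind : IndepFun (fun ω => Y i ω j) (fun ω => Y l ω k) Q :=
    (hY.indep.indepFun hil).comp (measurable_pi_apply j) (measurable_pi_apply k)
  have := hind.integral_fun_mul_eq_mul_integral (hY.memLp_two i j).1 (hY.memLp_two l k).1
  rw [this, hY.centered, zero_mul]

/-- The normalized sum of the Gaussian analogue is centered Gaussian with the averaged covariance. -/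
theorem IsGaussianAnalogue.isCenteredGaussian (hn : 0 < n) (hY : IsGaussianAnalogue P X Q Y) :
    IsCenteredGaussian Q (fun ω => normalizedSum fun i => Y i ω)
      (fun j k => (∑ i, ∫ ω, X i ω j * X i ω k ∂P) / n) where
  measurable := by
    refine measurable_pi_iff.2 fun j => ?_
    refine Measurable.div_const (Finset.measurable_fun_sum _ fun i _ => ?_) _
    exact (measurable_pi_apply j).comp (hY.measurable i)
  gaussian := by
    have h := (hY.indep.hasGaussianLaw_fun_sum hY.gaussian).map_fun
      ((√n)⁻¹ • ContinuousLinearMap.id ℝ (Fin p → ℝ))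
    have e : (fun ω => normalizedSum fun i => Y i ω) =
        fun ω => ((√n)⁻¹ • ContinuousLinearMap.id ℝ (Fin p → ℝ)) (∑ i, Y i ω) := by
      ext ω j
      simp [normalizedSum, div_eq_inv_mul, Finset.mul_sum]
    rw [e]
    exact h
  centered j := by
    simp only [normalizedSum, integral_div]
    rw [integral_finsetSum _ fun i _ => (hY.memLp_two i j).integrable one_le_two]
    simp [hY.centered]
  cov j k := by
    have hn' : (0 : ℝ) < n := by positivity
    have e : ∀ ω, normalizedSum (fun i => Y i ω) j * normalizedSum (fun i => Y i ω) k
        = (∑ i, ∑ l, Y i ω j * Y l ω k) / n := fun ω => by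
      simp only [normalizedSum]
      rw [div_mul_div_comm, Real.mul_self_sqrt hn'.le, Finset.sum_mul_sum]
    have hint : ∀ i l, Integrable (fun ω => Y i ω j * Y l ω k) Q := fun i l =>
      (hY.memLp_two i j).integrable_mul (hY.memLp_two l k)
    simp only [e, integral_div]
    congr 1
    rw [integral_finsetSum _ fun i _ => integrable_finsetSum _ fun l _ => hint i l]
    refine Finset.sum_congr rfl fun i _ => ?_
    rw [integral_finsetSum _ fun l _ => hint i l, Finset.sum_eq_single i
      (fun l _ hl => hY.integral_mul_of_ne hl.symm j k) (by simp), hY.covariance]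

theorem bootstrapProb_nonneg (x : Fin n → Fin p → ℝ) (A : Set (Fin p → ℝ)) :
    0 ≤ bootstrapProb x A := measureReal_nonneg

theorem bootstrapProb_le_one (hn : 0 < n) (x : Fin n → Fin p → ℝ) {A : Set (Fin p → ℝ)}
    (hA : A ∈ hyperrectangles p) : bootstrapProb x A ≤ 1 := by
  rw [bootstrapProb_eq hn x (measurableSet_of_mem_hyperrectangles hA)]
  refine (resampleMean_mono fun κ => ?_).trans_eq (resampleMean_const hn 1)
  split_ifs <;> norm_num

theorem rhoEB_le {x : Fin n → Fin p → ℝ} {c : ℝ}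
    (h : ∀ A ∈ hyperrectangles p,
      |bootstrapProb x A - Q.real {ω' | normalizedSum (fun i => Y i ω') ∈ A}| ≤ c) :
    rhoEB Q Y (hyperrectangles p) x ≤ c := by
  have : Nonempty (hyperrectangles p) := ⟨⟨_, ⟨fun _ => ⊥, fun _ => ⊤, fun _ => bot_le, rfl⟩⟩⟩
  exact ciSup_le fun A => h A A.2

theorem rhoEB_le_one (hn : 0 < n) (x : Fin n → Fin p → ℝ) :
    rhoEB Q Y (hyperrectangles p) x ≤ 1 := by
  refine rhoEB_le fun A hA => ?_
  have h1 := bootstrapProb_nonneg x A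
  have h2 := bootstrapProb_le_one hn x hA
  have h3 : 0 ≤ Q.real {ω' | normalizedSum (fun i => Y i ω') ∈ A} := measureReal_nonneg
  have h4 : Q.real {ω' | normalizedSum (fun i => Y i ω') ∈ A} ≤ 1 := measureReal_le_one
  rw [abs_le]
  constructor <;> linarith

end Analogue

/-! ### Empirical moments after centring at the sample mean. -/

section Empirical

variable {n p : ℕ}

theorem secondMoment_sub_sampleMean (hn : 0 < n) (x : Fin n → Fin p → ℝ) (j k : Fin p) :
    secondMoment (fun i => x i - sampleMean x) j k
      = (∑ i, x i j * x i k) / n - sampleMean x j * sampleMean x k := by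
  have hn' : (n : ℝ) ≠ 0 := by positivity
  have e : ∀ i, (x i - sampleMean x) j * (x i - sampleMean x) k = x i j * x i k
      - sampleMean x k * x i j - sampleMean x j * x i k + sampleMean x j * sampleMean x k :=
    fun i => by simp only [Pi.sub_apply]; ring
  simp only [secondMoment, e, Finset.sum_add_distrib, Finset.sum_sub_distrib, ← Finset.mul_sum]
  simp only [Finset.sum_const, Finset.card_univ, Fintype.card_fin, nsmul_eq_mul]
  simp only [sampleMean]
  field_simp
  ring

theorem abs_sampleMean_cube_le (hn : 0 < n) (x : Fin n → Fin p → ℝ) (j : Fin p) :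
    |sampleMean x j| ^ 3 ≤ (∑ i, |x i j| ^ 3) / n := by
  have hn' : (0 : ℝ) < n := by positivity
  have h := pow_sum_div_card_le_sum_pow (s := Finset.univ) (f := fun i => |x i j|)
    (fun i _ => abs_nonneg _) 2
  rw [Finset.card_univ, Fintype.card_fin] at h
  have h1 : |sampleMean x j| ≤ (∑ i, |x i j|) / n := by
    rw [sampleMean, abs_div, abs_of_pos hn']
    gcongr
    exact Finset.abs_sum_le_sum_abs _ _
  calc |sampleMean x j| ^ 3 ≤ ((∑ i, |x i j|) / n) ^ 3 := by gcongr
    _ = (∑ i, |x i j|) ^ (2 + 1) / (n : ℝ) ^ 2 / n := by field_simp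
    _ ≤ _ := by gcongr

theorem sum_abs_sub_sampleMean_cube_le (hn : 0 < n) (x : Fin n → Fin p → ℝ) (j : Fin p) :
    (∑ i, |x i j - sampleMean x j| ^ 3) / n ≤ 8 * ((∑ i, |x i j| ^ 3) / n) := by
  have hn' : (0 : ℝ) < n := by positivity
  have hc : ∀ u v : ℝ, |u - v| ^ 3 ≤ 4 * (|u| ^ 3 + |v| ^ 3) := fun u v => by
    have h : |u - v| ≤ |u| + |v| := abs_sub u v
    have h3 : |u - v| ^ 3 ≤ (|u| + |v|) ^ 3 := by gcongr
    nlinarith [mul_nonneg (add_nonneg (abs_nonneg u) (abs_nonneg v)) (sq_nonneg (|u| - |v|))]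
  calc (∑ i, |x i j - sampleMean x j| ^ 3) / n
      ≤ (∑ i, 4 * (|x i j| ^ 3 + |sampleMean x j| ^ 3)) / n := by
        gcongr with i _; exact hc _ _
    _ = 4 * ((∑ i, |x i j| ^ 3) / n) + 4 * |sampleMean x j| ^ 3 := by
        rw [← Finset.mul_sum, Finset.sum_add_distrib]
        simp only [Finset.sum_const, Finset.card_univ, Fintype.card_fin, nsmul_eq_mul]
        field_simp
    _ ≤ _ := by linarith [abs_sampleMean_cube_le hn x j]

end Empirical

/-! ### Choice of the smoothing scale. -/

section Rates

/-- The rate computation behind the choice of the smoothing scale. Here `s = √(log (p n))`,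
`N = √n`, and `d`, `e` are the two terms of the final rate. -/
theorem rate_bounds {s N c d e B M Δ : ℝ} (hs : 1 ≤ s) (hN : 0 < N) (hc : 1 ≤ c) (hd : 0 ≤ d)
    (hd1 : d ≤ 1) (he : 0 ≤ e) (he1 : e ≤ 1) (hB : d ^ 3 * N = B * s ^ 7) (hM : e * N = M * s ^ 3)
    (hΔ : Δ = (2 * B * (√c * s * N) + c * s ^ 2 * M ^ 2 + B * N) / N ^ 2) :
    8 * (2 * B + M ^ 3 * (c * s ^ 2) / N ^ 2) * (s ^ 2) ^ 2 / N ≤ (8 * c * (d + e) / s) ^ 3 ∧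
      (Δ + Δ ^ 2) * s ^ 2 ≤ (8 * c * (d + e) / s) ^ 2 ∧
      2 * M * s ^ 2 / N ≤ 8 * c * (d + e) / s := by
  have hs0 : 0 < s := by linarith
  have hc0 : 0 < c := by linarith
  have hcs : √c ≤ c := by
    rw [Real.sqrt_le_left hc0.le]; nlinarith
  -- Eliminating `B` and `M` in favour of `d` and `e` makes `N` cancel from all three claims.
  obtain rfl : B = d ^ 3 * N / s ^ 7 := by field_simp; linarith
  obtain rfl : M = e * N / s ^ 3 := by field_simp; linarith
  have hde : 0 ≤ d * e := by positivity
  refine ⟨?_, ?_, ?_⟩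
  · have e1 : 8 * (2 * (d ^ 3 * N / s ^ 7) + (e * N / s ^ 3) ^ 3 * (c * s ^ 2) / N ^ 2)
        * (s ^ 2) ^ 2 / N = (16 * d ^ 3 + 8 * c * e ^ 3) / s ^ 3 := by
      field_simp; ring
    rw [e1, div_pow]
    gcongr
    have h3 : d ^ 3 + e ^ 3 ≤ (d + e) ^ 3 := by
      have : 0 ≤ d * e * (d + e) := by positivity
      nlinarith
    have hc3 : c ≤ c ^ 3 := le_self_pow₀ hc (by norm_num)
    have h0 : 0 ≤ d ^ 3 + e ^ 3 := by positivity
    calc 16 * d ^ 3 + 8 * c * e ^ 3 ≤ 16 * c * (d ^ 3 + e ^ 3) := by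
          nlinarith [pow_nonneg hd 3, pow_nonneg he 3, mul_nonneg hc0.le (pow_nonneg he 3),
            mul_nonneg (sub_nonneg.2 hc) (pow_nonneg hd 3)]
      _ ≤ 512 * c ^ 3 * (d + e) ^ 3 := by gcongr; norm_num
      _ = _ := by ring
  · have hΔ1 : Δ = 2 * √c * d ^ 3 / s ^ 6 + c * e ^ 2 / s ^ 4 + d ^ 3 / s ^ 7 := by
      rw [hΔ]; field_simp
    have h6 : s ^ 4 ≤ s ^ 6 := pow_le_pow_right₀ hs (by norm_num)
    have h7 : s ^ 4 ≤ s ^ 7 := pow_le_pow_right₀ hs (by norm_num)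
    -- The variance part of `Δ` is of order `d ^ 3`, better than required; `d ≤ 1` reduces it to `d
    -- ^ 2`.
    have hd32 : d ^ 3 ≤ d ^ 2 := pow_le_pow_of_le_one hd hd1 (by norm_num)
    have hΔ0 : 0 ≤ Δ := by rw [hΔ1]; positivity
    have hq : d ^ 2 + e ^ 2 ≤ (d + e) ^ 2 := by nlinarith
    have hΔ2 : Δ ≤ 3 * c * (d ^ 2 + e ^ 2) / s ^ 4 := by
      calc Δ ≤ 2 * c * d ^ 2 / s ^ 4 + c * e ^ 2 / s ^ 4 + d ^ 2 / s ^ 4 := by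
            rw [hΔ1]; gcongr
        _ = (2 * c * d ^ 2 + c * e ^ 2 + d ^ 2) / s ^ 4 := by ring
        _ ≤ _ := by
            gcongr
            nlinarith [mul_nonneg (sub_nonneg.2 hc) (sq_nonneg d), mul_nonneg hc0.le (sq_nonneg e)]
    have hΔ3 : Δ ≤ 6 * c := by
      refine hΔ2.trans ((div_le_iff₀ (by positivity)).2 ?_)
      have : d ^ 2 + e ^ 2 ≤ 2 := by nlinarith
      have h4 : 1 ≤ s ^ 4 := one_le_pow₀ hs
      nlinarith
    calc (Δ + Δ ^ 2) * s ^ 2 = (1 + Δ) * Δ * s ^ 2 := by ring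
      _ ≤ (1 + 6 * c) * (3 * c * (d ^ 2 + e ^ 2) / s ^ 4) * s ^ 2 := by gcongr
      _ = (1 + 6 * c) * (3 * c) * (d ^ 2 + e ^ 2) / s ^ 2 := by field_simp
      _ ≤ (64 * c ^ 2) * (d + e) ^ 2 / s ^ 2 := by
          have : (1 + 6 * c) * (3 * c) ≤ 64 * c ^ 2 := by nlinarith
          gcongr
      _ = _ := by ring
  · have e1 : 2 * (e * N / s ^ 3) * s ^ 2 / N = 2 * e / s := by field_simp
    have : 2 * e ≤ 8 * c * (d + e) := by
      nlinarith [mul_nonneg hc0.le hd, mul_nonneg (sub_nonneg.2 hc) he]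
    rw [e1]
    gcongr

end Rates

/-! ### Assembling the bound on the bootstrap error. -/

section Main

variable {Ω Ω' : Type*} [MeasurableSpace Ω] [MeasurableSpace Ω'] {P : Measure Ω} {Q : Measure Ω'}
  [IsProbabilityMeasure P] [IsProbabilityMeasure Q] {n p : ℕ} {X : Fin n → Ω → Fin p → ℝ}
  {Y : Fin n → Ω' → Fin p → ℝ}

theorem D1_nonneg (n p : ℕ) (B : ℝ) : 0 ≤ D1 n p B := by
  have : 0 ≤ Real.log ((p : ℝ) * n) := by exact_mod_cast Real.log_natCast_nonneg (p * n)
  rw [D1]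
  positivity

theorem D1_pow_six (n p : ℕ) (B : ℝ) :
    D1 n p B ^ 6 = B ^ 2 * Real.log ((p : ℝ) * n) ^ 7 / n := by
  have : 0 ≤ Real.log ((p : ℝ) * n) := by exact_mod_cast Real.log_natCast_nonneg (p * n)
  rw [D1, ← Real.rpow_natCast, ← Real.rpow_mul (by positivity)]
  norm_num

theorem two_le_log_mul (hn : 4 ≤ n) (hp : 3 ≤ p) : 2 ≤ Real.log ((p : ℝ) * n) := by
  have hn' : (4 : ℝ) ≤ n := by exact_mod_cast hn
  have hp' : (3 : ℝ) ≤ p := by exact_mod_cast hp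
  have h1 := Real.exp_one_lt_d9
  rw [Real.le_log_iff_exp_le (by positivity), show (2 : ℝ) = 1 + 1 by norm_num, Real.exp_add]
  nlinarith [Real.exp_pos 1]

/-- The bootstrap error at data satisfying the conclusions of `exists_bad_event`. -/
theorem rhoEB_le_of_moments {b B M c : ℝ} {χK : ℝ} (χ : SmoothCutoff χK) (hχ : 1 ≤ χK)
    (hn : 4 ≤ n) (hp : 3 ≤ p) (hB : 1 ≤ B) (hb : 0 < b) (hc : 1 ≤ c) (hM : 1 ≤ M)
    (hX : IsCenteredSample P X)
    (hY : IsGaussianAnalogue P X Q Y) (h1 : CondM1 P X b) {ω : Ω}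
    (hbd : ∀ i j, |X i ω j| ≤ M)
    (hprod : ∀ a k, |∑ i, extCoord (X i ω) a * extCoord (X i ω) k
        - ∑ i, ∫ ω, extCoord (X i ω) a * extCoord (X i ω) k ∂P| ≤
          2 * B * √(n * (c * Real.log (p * n))) + c * Real.log (p * n) * M ^ 2 + B * √n)
    (hcube : ∀ j, ∑ i, |X i ω j| ^ 3 ≤ 2 * (n * B) + M ^ 3 * (c * Real.log (p * n)))
    (hd1 : D1 n p B ≤ 1) (he1 : √(M ^ 2 * Real.log (p * n) ^ 3 / n) ≤ 1) :
    rhoEB Q Y (hyperrectangles p) (fun i => X i ω) ≤ 20000 * Real.exp 5 * χK / √b * c *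
      (D1 n p B + √(M ^ 2 * Real.log (p * n) ^ 3 / n)) := by
  have hn0 : 0 < n := by omega
  have hn' : (0 : ℝ) < n := by positivity
  set ℓ := Real.log ((p : ℝ) * n) with hℓ
  set d := D1 n p B with hd
  set e := √(M ^ 2 * ℓ ^ 3 / n) with he
  have hℓ1 : 1 ≤ ℓ := by linarith [two_le_log_mul hn hp]
  have hcard : Real.log (2 * p) ≤ ℓ := by
    refine Real.log_le_log (by positivity) ?_
    have : (4 : ℝ) ≤ n := by exact_mod_cast hn
    nlinarith [(Nat.cast_nonneg p : (0 : ℝ) ≤ p)]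
  have hd0 : 0 < d := by
    rw [hd, D1]
    have : 0 < ℓ := by linarith
    positivity
  have he0 : 0 ≤ e := Real.sqrt_nonneg _
  have hs2 : √ℓ ^ 2 = ℓ := Real.sq_sqrt (by linarith)
  have hN2 : √(n : ℝ) ^ 2 = n := Real.sq_sqrt hn'.le
  have hs : 1 ≤ √ℓ := by rw [Real.one_le_sqrt]; exact hℓ1
  have hN : 0 < √(n : ℝ) := by positivity
  have hdN : d ^ 3 * √n = B * √ℓ ^ 7 := by
    rw [← sq_eq_sq₀ (by positivity) (by positivity)]
    calc (d ^ 3 * √n) ^ 2 = d ^ 6 * √n ^ 2 := by ring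
      _ = B ^ 2 * (√ℓ ^ 2) ^ 7 := by rw [hN2, hs2, D1_pow_six, ← hℓ]; field_simp
      _ = _ := by ring
  have heN : e * √n = M * √ℓ ^ 3 := by
    rw [← sq_eq_sq₀ (by positivity) (by positivity)]
    calc (e * √n) ^ 2 = e ^ 2 * √n ^ 2 := by ring
      _ = M ^ 2 * (√ℓ ^ 2) ^ 3 := by
        rw [hN2, hs2, Real.sq_sqrt (by positivity)]; field_simp
      _ = _ := by ring
  set Δ := (2 * B * (√c * √ℓ * √n) + c * √ℓ ^ 2 * M ^ 2 + B * √n) / √(n : ℝ) ^ 2 with hΔ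
  obtain ⟨r1, r2, r3⟩ := rate_bounds hs hN hc hd0.le hd1 he0 he1 hdN heN hΔ
  rw [hs2, hN2] at r1
  rw [hs2] at r2 r3
  -- Division by `√ℓ` cancels the anti-concentration factor, and `2500 * 8 = 20000`.
  set r := 8 * c * (d + e) / √ℓ with hr
  have hr0 : 0 < r := by positivity
  have hΔ' : ∀ a k, |(∑ i, extCoord (X i ω) a * extCoord (X i ω) k) / n
        - (∑ i, ∫ ω, extCoord (X i ω) a * extCoord (X i ω) k ∂P) / n| ≤ Δ := fun a k => by
    rw [← sub_div, abs_div, abs_of_pos hn', hΔ, hs2, hN2]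
    gcongr
    refine (hprod a k).trans_eq ?_
    rw [Real.sqrt_mul hn'.le, Real.sqrt_mul (by positivity)]
    ring
  -- Pairing a coordinate with the constant coordinate turns the product bound into a bound on the
  -- sample mean, since the population means vanish.
  have hmean : ∀ j, |sampleMean (fun i => X i ω) j| ≤ Δ := fun j => by
    have := hΔ' (some j) none
    simpa [extCoord, hX.centered, sampleMean] using this
  have hΔ0 : 0 ≤ Δ := (abs_nonneg _).trans (hΔ' none none)
  have hmeanM : ∀ j, |sampleMean (fun i => X i ω) j| ≤ M := fun j => by
    rw [sampleMean, abs_div, abs_of_pos hn', div_le_iff₀ hn']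
    refine (Finset.abs_sum_le_sum_abs _ _).trans ((Finset.sum_le_sum fun i _ => hbd i j).trans_eq ?_)
    simp [mul_comm]
  refine rhoEB_le fun A hA => ?_
  -- Centring at the sample mean at most doubles the range, costs a factor 8 in the third moments,
  -- and adds a product of two sample means, hence `Δ ^ 2`, to the covariance error.
  refine (abs_bootstrapProb_sub_le (hY.isCenteredGaussian hn0) χ hχ hn0 hr0 hℓ1 hcard hb
    (fun j => ?_) (M := 2 * M) (L := 8 * (2 * B + M ^ 3 * (c * ℓ) / n)) (Δ := Δ + Δ ^ 2)
    (fun i j => ?_) (fun j => ?_) (fun j k => ?_) r1 r2 r3 hA).trans_eq ?_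
  · simpa only [sq] using h1 j
  · have := abs_sub (X i ω j) (sampleMean (fun i => X i ω) j)
    linarith [hbd i j, hmeanM j]
  · refine (sum_abs_sub_sampleMean_cube_le hn0 (fun i => X i ω) j).trans ?_
    gcongr
    rw [div_le_iff₀ hn']
    refine (hcube j).trans_eq ?_
    field_simp
  · rw [secondMoment_sub_sampleMean hn0]
    have h2 := hΔ' (some j) (some k)
    have h3 : |sampleMean (fun i => X i ω) j * sampleMean (fun i => X i ω) k| ≤ Δ ^ 2 := by
      rw [abs_mul, sq]
      exact mul_le_mul (hmean j) (hmean k) (abs_nonneg _) hΔ0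
    have h2' : |(∑ i, X i ω j * X i ω k) / n - (∑ i, ∫ ω, X i ω j * X i ω k ∂P) / n| ≤ Δ := h2
    rw [abs_le] at *
    constructor <;> linarith [h2'.1, h2'.2, h3.1, h3.2]
  · rw [hr]
    field_simp
    ring

theorem one_sub_le_measureReal_of_forall {f : Ω → ℝ} {α c : ℝ} (hα : 0 ≤ α) (h : ∀ ω, f ω ≤ c) :
    1 - α ≤ P.real {ω | f ω ≤ c} := by
  rw [Set.eq_univ_of_forall (s := {ω | f ω ≤ c}) h, probReal_univ]
  linarith

/-- The bootstrap approximation for data that are bounded by `M` with probability at least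
`1 - α / 4`. -/
theorem bootstrap_of_tail_le {b B M K α : ℝ} {χK : ℝ} (χ : SmoothCutoff χK) (hχ : 1 ≤ χK)
    (hn : 4 ≤ n) (hp : 3 ≤ p) (hB : 1 ≤ B) (hα : 0 < α) (hα1 : α < 1)
    (hK : Real.log (1 / α) ≤ K * Real.log ((p : ℝ) * n)) (hb : 0 < b) (hM : 1 ≤ M)
    (hX : IsCenteredSample P X) (hY : IsGaussianAnalogue P X Q Y) (h1 : CondM1 P X b)
    (h2 : CondM2 P X B) (htail : ∑ i, P.real {ω | ¬ ∀ j, |X i ω j| ≤ M} ≤ α / 4) :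
    1 - α ≤ P.real {ω | rhoEB Q Y (hyperrectangles p) (fun i => X i ω) ≤
      (20000 * Real.exp 5 * χK / √b * (4 + |K|) + 1) *
        (D1 n p B + √(M ^ 2 * Real.log (p * n) ^ 3 / n))} := by
  have hn0 : 0 < n := by omega
  have hd0 := D1_nonneg n p B
  have he0 : 0 ≤ √(M ^ 2 * Real.log (p * n) ^ 3 / n) := Real.sqrt_nonneg _
  have hK0 := abs_nonneg K
  have hℓ := two_le_log_mul hn hp
  have hC : 0 ≤ 20000 * Real.exp 5 * χK / √b * (4 + |K|) := by positivity
  -- The error never exceeds one, so a rate above one is trivial; the summand `1` in the constant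
  -- serves this case.
  by_cases hsmall : D1 n p B ≤ 1 ∧ √(M ^ 2 * Real.log (p * n) ^ 3 / n) ≤ 1
  swap
  · have hlarge : 1 ≤ D1 n p B + √(M ^ 2 * Real.log (p * n) ^ 3 / n) := by
      by_contra! hc
      exact hsmall ⟨by linarith, by linarith⟩
    exact one_sub_le_measureReal_of_forall hα.le fun ω =>
      (rhoEB_le_one hn0 _).trans (one_le_mul_of_one_le_of_one_le (by linarith) hlarge)
  -- With this deviation level `exp (-t) ≤ α / (p * n) ^ 4`, enough to absorb the union bound over
  -- pairs and leave `3 * α / 4`.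
  have ht : 0 < (4 + |K|) * Real.log ((p : ℝ) * n) := by positivity
  obtain ⟨bad, hbadP, hbad⟩ := exists_bad_event hn0 hB hX h2 hM ht (by linarith) htail
  have hexp : 3 * ((p : ℝ) + 1) ^ 2 * Real.exp (-((4 + |K|) * Real.log ((p : ℝ) * n)))
      ≤ 3 * α / 4 := by
    have hn' : (4 : ℝ) ≤ n := by exact_mod_cast hn
    have hp' : (3 : ℝ) ≤ p := by exact_mod_cast hp
    have hpn : 0 < (p : ℝ) * n := by positivity
    have hp1 : (p : ℝ) + 1 ≤ p * n := by nlinarith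
    have hpn2 : 4 ≤ ((p : ℝ) * n) ^ 2 := by nlinarith
    have hKℓ : Real.log (1 / α) ≤ |K| * Real.log ((p : ℝ) * n) :=
      hK.trans (mul_le_mul_of_nonneg_right (le_abs_self K) (by linarith))
    have e1 : Real.exp (-((4 + |K|) * Real.log ((p : ℝ) * n))) ≤ α / ((p : ℝ) * n) ^ 4 := by
      rw [← Real.le_log_iff_exp_le (by positivity), Real.log_div hα.ne' (by positivity),
        Real.log_pow]
      rw [one_div, Real.log_inv] at hKℓ
      push_cast
      linarith
    calc 3 * ((p : ℝ) + 1) ^ 2 * Real.exp (-((4 + |K|) * Real.log ((p : ℝ) * n)))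
        ≤ 3 * ((p : ℝ) * n) ^ 2 * (α / ((p : ℝ) * n) ^ 4) := by gcongr
      _ = 3 * α / ((p : ℝ) * n) ^ 2 := by field_simp
      _ ≤ 3 * α / 4 := by gcongr
  have hcover : badᶜ ⊆ {ω | rhoEB Q Y (hyperrectangles p) (fun i => X i ω) ≤
      (20000 * Real.exp 5 * χK / √b * (4 + |K|) + 1) *
        (D1 n p B + √(M ^ 2 * Real.log (p * n) ^ 3 / n))} := fun ω hω => by
    obtain ⟨g1, g2, g3⟩ := hbad ω hω
    refine (rhoEB_le_of_moments χ hχ hn hp hB hb (by linarith) hM hX hY h1 g1 g2 g3 hsmall.1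
      hsmall.2).trans ?_
    gcongr
    linarith
  -- Subadditivity suffices here, so neither the bad event nor the bootstrap error has to be
  -- measurable.
  have hunion : 1 ≤ P.real badᶜ + P.real bad := by
    have := measureReal_union_le (μ := P) badᶜ bad
    rwa [Set.compl_union_self, probReal_univ] at this
  have := measureReal_mono (μ := P) hcover
  linarith

/-- Markov's inequality for the exponential moment of each entry, with a union bound over all `n *
p` entries. -/
theorem sum_tail_le_of_condE1 {B M α : ℝ} (hn : 4 ≤ n) (hp : 3 ≤ p) (hB : 0 < B) (hα : 0 < α)
    (h : CondE1 P X B) (hM : Real.log (8 * (p * n) / α) ≤ M / B) :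
    ∑ i, P.real {ω | ¬ ∀ j, |X i ω j| ≤ M} ≤ α / 4 := by
  have hn0 : 0 < n := by omega
  have hp0 : 0 < p := by omega
  have hexp : 8 * ((p : ℝ) * n) / α ≤ Real.exp (M / B) := by
    rwa [← Real.log_le_iff_le_exp (by positivity)]
  have hij : ∀ i j, P.real {ω | Real.exp (M / B) ≤ Real.exp (|X i ω j| / B)} ≤
      α / (4 * (p * n)) := fun i j => by
    have hm := mul_meas_ge_le_integral_of_nonneg (ae_of_all P fun ω => (Real.exp_pos _).le)
      (h i j).1 (Real.exp (M / B))
    have h0 : 0 ≤ P.real {ω | Real.exp (M / B) ≤ Real.exp (|X i ω j| / B)} := measureReal_nonneg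
    have := (mul_le_mul_of_nonneg_right hexp h0).trans (hm.trans (h i j).2)
    rw [le_div_iff₀ (by positivity)]
    rw [div_mul_eq_mul_div, div_le_iff₀ hα] at this
    linarith
  calc ∑ i, P.real {ω | ¬ ∀ j, |X i ω j| ≤ M}
      ≤ ∑ _i : Fin n, ∑ _j : Fin p, α / (4 * (p * n)) := by
        refine Finset.sum_le_sum fun i _ => ?_
        refine (measureReal_mono (fun ω hω => ?_)).trans
          ((measureReal_iUnion_fintype_le fun j => {ω | Real.exp (M / B) ≤
            Real.exp (|X i ω j| / B)}).trans (Finset.sum_le_sum fun j _ => hij i j))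
        obtain ⟨j, hj⟩ := not_forall.1 hω
        refine Set.mem_iUnion.2 ⟨j, Real.exp_le_exp.2 ?_⟩
        have := (not_le.1 hj).le
        gcongr
    _ = α / 4 := by simp; field_simp

/-- Markov's inequality for the `q`-th moment of the coordinate maximum; the union bound is over the
`n` vectors only, so `M` does not depend on `p`. -/
theorem sum_tail_le_of_condE2 {B M q α : ℝ} (hn : 4 ≤ n) (hB : 0 < B) (hα : 0 < α) (hq : 0 < q)
    (h : CondE2 P X B q) (hM0 : 0 ≤ M) (hM : 8 * n / α ≤ (M / B) ^ q) :
    ∑ i, P.real {ω | ¬ ∀ j, |X i ω j| ≤ M} ≤ α / 4 := by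
  have hn0 : 0 < n := by omega
  have hi : ∀ i, P.real {ω | (M / B) ^ q ≤ ((⨆ j, |X i ω j|) / B) ^ q} ≤ α / (4 * n) := fun i => by
    have hm := mul_meas_ge_le_integral_of_nonneg (ae_of_all P fun ω =>
      Real.rpow_nonneg (div_nonneg (Real.iSup_nonneg fun j => abs_nonneg (X i ω j)) hB.le) q)
      (h i).1 ((M / B) ^ q)
    have h0 : 0 ≤ P.real {ω | (M / B) ^ q ≤ ((⨆ j, |X i ω j|) / B) ^ q} := measureReal_nonneg
    have := (mul_le_mul_of_nonneg_right hM h0).trans (hm.trans (h i).2)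
    rw [le_div_iff₀ (by positivity)]
    rw [div_mul_eq_mul_div, div_le_iff₀ hα] at this
    linarith
  calc ∑ i, P.real {ω | ¬ ∀ j, |X i ω j| ≤ M} ≤ ∑ _i : Fin n, α / (4 * n) := by
        refine Finset.sum_le_sum fun i _ => (measureReal_mono fun ω hω => ?_).trans (hi i)
        obtain ⟨j, hj⟩ := not_forall.1 hω
        have h1 := (not_le.1 hj).le.trans
          (le_ciSup (f := fun j => |X i ω j|) (Set.finite_range _).bddAbove j)
        change (M / B) ^ q ≤ ((⨆ j, |X i ω j|) / B) ^ q
        gcongr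
    _ = α / 4 := by simp; field_simp

/-- The tail term of the rate under exponential moments. -/
theorem sqrt_tail_term_condE1_le {B c : ℝ} (hn : 4 ≤ n) (hp : 3 ≤ p) (hB : 1 ≤ B) (hc : 0 ≤ c)
    (hd1 : D1 n p B ≤ 1) :
    √((c * B * Real.log (p * n)) ^ 2 * Real.log (p * n) ^ 3 / n) ≤ c * D1 n p B := by
  have hn' : (0 : ℝ) < n := by positivity
  have hℓ := two_le_log_mul hn hp
  have hd0 := D1_nonneg n p B
  rw [Real.sqrt_le_left (by positivity)]
  have h6 := D1_pow_six n p B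
  set ℓ := Real.log ((p : ℝ) * n)
  calc (c * B * ℓ) ^ 2 * ℓ ^ 3 / n = c ^ 2 * (B ^ 2 * ℓ ^ 5 / n) := by ring
    _ ≤ c ^ 2 * (B ^ 2 * ℓ ^ 7 / n) := by
        gcongr
        · linarith
        · norm_num
    _ = c ^ 2 * D1 n p B ^ 6 := by rw [h6]
    _ ≤ c ^ 2 * D1 n p B ^ 2 := by
        gcongr ?_ * ?_
        exact pow_le_pow_of_le_one hd0 hd1 (by norm_num)
    _ = _ := by ring

theorem D2_nonneg (n p : ℕ) (B q : ℝ) {α : ℝ} (hα : 0 < α) : 0 ≤ D2 n p B q α := by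
  have : 0 ≤ Real.log ((p : ℝ) * n) := by exact_mod_cast Real.log_natCast_nonneg (p * n)
  rw [D2]
  positivity

/-- The tail term of the rate under polynomial moments. -/
theorem sqrt_tail_term_condE2_le {B q α : ℝ} (hn : 4 ≤ n) (hp : 3 ≤ p) (hB : 1 ≤ B)
    (hα : 0 < α) (hd1 : D2 n p B q α ≤ 1) :
    √((B * (8 * n / α) ^ (1 / q)) ^ 2 * Real.log (p * n) ^ 3 / n) ≤
      (8 : ℝ) ^ (1 / q) * D2 n p B q α := by
  have hn' : (0 : ℝ) < n := by positivity
  have hℓ := two_le_log_mul hn hp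
  have hd0 := D2_nonneg n p B q hα
  have h3 : D2 n p B q α ^ 3 = B ^ 2 * Real.log ((p : ℝ) * n) ^ 3 /
      (α ^ (2 / q) * (n : ℝ) ^ (1 - 2 / q)) := by
    rw [D2, ← Real.rpow_natCast, ← Real.rpow_mul (by positivity)]
    norm_num
  rw [Real.sqrt_le_left (by positivity)]
  set ℓ := Real.log ((p : ℝ) * n)
  have hpow : ∀ y : ℝ, 0 ≤ y → (y ^ (1 / q)) ^ 2 = y ^ (2 / q) := fun y hy => by
    rw [← Real.rpow_natCast, ← Real.rpow_mul hy]; congr 1; push_cast; ring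
  have e : (B * (8 * n / α) ^ (1 / q)) ^ 2 * ℓ ^ 3 / n =
      ((8 : ℝ) ^ (1 / q)) ^ 2 * D2 n p B q α ^ 3 := by
    rw [h3, mul_pow, hpow _ (by positivity), hpow _ (by norm_num), Real.div_rpow (by positivity)
      hα.le, Real.mul_rpow (by norm_num) hn'.le, Real.rpow_sub hn', Real.rpow_one]
    have := Real.rpow_pos_of_pos hn' (2 / q)
    have := Real.rpow_pos_of_pos hα (2 / q)
    field_simp
  rw [e, mul_pow]
  gcongr ?_ * ?_
  exact pow_le_pow_of_le_one hd0 hd1 (by norm_num)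

end Main

end HDBootstrap

end

/-! ### The two moment conditions. -/

theorem mainTheorem11 :
    (∀ b K : ℝ, 0 < b → ∃ C : ℝ, 0 < C ∧
      ∀ (n p : ℕ) (B α : ℝ) (Ω Ω' : Type*) [MeasurableSpace Ω] [MeasurableSpace Ω']
        (P : Measure Ω) (Q : Measure Ω') [IsProbabilityMeasure P] [IsProbabilityMeasure Q]
        (X : Fin n → Ω → Fin p → ℝ) (Y : Fin n → Ω' → Fin p → ℝ),
        4 ≤ n → 3 ≤ p → 1 ≤ B → 0 < α → α < Real.exp (-1) →
        Real.log (1 / α) ≤ K * Real.log ((p : ℝ) * n) →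
        HDBootstrap.IsCenteredSample P X → HDBootstrap.IsGaussianAnalogue P X Q Y →
        HDBootstrap.CondM1 P X b → HDBootstrap.CondM2 P X B →
        HDBootstrap.CondE1 P X B →
        1 - α ≤ P.real {ω | HDBootstrap.rhoEB Q Y (HDBootstrap.hyperrectangles p)
          (fun i => X i ω) ≤ C * HDBootstrap.D1 n p B}) ∧
    (∀ b q K : ℝ, 0 < b → 0 < q → ∃ C : ℝ, 0 < C ∧
      ∀ (n p : ℕ) (B α : ℝ) (Ω Ω' : Type*) [MeasurableSpace Ω] [MeasurableSpace Ω']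
        (P : Measure Ω) (Q : Measure Ω') [IsProbabilityMeasure P] [IsProbabilityMeasure Q]
        (X : Fin n → Ω → Fin p → ℝ) (Y : Fin n → Ω' → Fin p → ℝ),
        4 ≤ n → 3 ≤ p → 1 ≤ B → 0 < α → α < Real.exp (-1) →
        Real.log (1 / α) ≤ K * Real.log ((p : ℝ) * n) →
        HDBootstrap.IsCenteredSample P X → HDBootstrap.IsGaussianAnalogue P X Q Y →
        HDBootstrap.CondM1 P X b → HDBootstrap.CondM2 P X B →
        HDBootstrap.CondE2 P X B q →
        1 - α ≤ P.real {ω | HDBootstrap.rhoEB Q Y (HDBootstrap.hyperrectangles p)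
          (fun i => X i ω) ≤ C * (HDBootstrap.D1 n p B + HDBootstrap.D2 n p B q α)}) := by
  obtain ⟨χK, hχ, ⟨χ⟩⟩ := HDBootstrap.exists_smoothCutoff
  refine ⟨fun b K hb => ?_, fun b q K hb hq => ?_⟩
  · set C₀ := 20000 * Real.exp 5 * χK / √b * (4 + |K|) + 1 with hC₀
    have hK0 := abs_nonneg K
    have hC₁ : 1 ≤ C₀ := by
      rw [hC₀, le_add_iff_nonneg_left]; positivity
    -- One unit for `D1` itself and `4 + |K|` for the tail term at truncation level `(4 + |K|) * B *
    -- log (p * n)`.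
    refine ⟨C₀ * (5 + |K|), by positivity, ?_⟩
    intro n p B α Ω Ω' _ _ P Q _ _ X Y hn hp hB hα hα1 hK hX hY h1 h2 hE
    have hα1' : α < 1 := hα1.trans (by simp)
    have hn0 : 0 < n := by omega
    have hp0 : 0 < p := by omega
    have hℓ := HDBootstrap.two_le_log_mul hn hp
    have hd0 := HDBootstrap.D1_nonneg n p B
    rcases le_total 1 (HDBootstrap.D1 n p B) with hd | hd
    · exact HDBootstrap.one_sub_le_measureReal_of_forall hα.le fun ω =>
        (HDBootstrap.rhoEB_le_one hn0 _).trans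
          (one_le_mul_of_one_le_of_one_le (one_le_mul_of_one_le_of_one_le hC₁ (by linarith)) hd)
    have hlog : Real.log (8 * (p * n) / α) ≤ (4 + |K|) * Real.log (p * n) := by
      have h8 : Real.log 8 ≤ Real.log ((p : ℝ) * n) := by
        have hn' : (4 : ℝ) ≤ n := by exact_mod_cast hn
        have hp' : (3 : ℝ) ≤ p := by exact_mod_cast hp
        exact Real.log_le_log (by norm_num) (by nlinarith)
      have hKℓ : Real.log (1 / α) ≤ |K| * Real.log ((p : ℝ) * n) :=
        hK.trans (mul_le_mul_of_nonneg_right (le_abs_self K) (by linarith))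
      rw [div_eq_mul_one_div, Real.log_mul (by positivity) (by positivity),
        Real.log_mul (by norm_num) (by positivity)]
      linarith
    have hM : 1 ≤ (4 + |K|) * B * Real.log (p * n) := by 
      nlinarith [mul_nonneg hK0 (by linarith : 0 ≤ B)]
    refine (HDBootstrap.bootstrap_of_tail_le χ hχ hn hp hB hα hα1' hK hb hM hX hY h1 h2
      (HDBootstrap.sum_tail_le_of_condE1 hn hp (by linarith) hα hE ?_)).trans
      (measureReal_mono fun ω hω => ?_)
    · rwa [mul_right_comm, mul_div_cancel_right₀ _ (by linarith)]
    · refine (show HDBootstrap.rhoEB _ _ _ _ ≤ _ from hω).trans ?_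
      rw [← hC₀, mul_assoc C₀]
      have := HDBootstrap.sqrt_tail_term_condE1_le hn hp hB (by linarith : 0 ≤ 4 + |K|) hd
      gcongr
      linarith
  · set C₀ := 20000 * Real.exp 5 * χK / √b * (4 + |K|) + 1 with hC₀
    have hK0 := abs_nonneg K
    have hC₁ : 1 ≤ C₀ := by
      rw [hC₀, le_add_iff_nonneg_left]; positivity
    have h8 : (1 : ℝ) ≤ (8 : ℝ) ^ (1 / q) := Real.one_le_rpow (by norm_num) (by positivity)
    refine ⟨C₀ * (8 : ℝ) ^ (1 / q), by positivity, ?_⟩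
    intro n p B α Ω Ω' _ _ P Q _ _ X Y hn hp hB hα hα1 hK hX hY h1 h2 hE
    have hα1' : α < 1 := hα1.trans (by simp)
    have hn0 : 0 < n := by omega
    have hd0 := HDBootstrap.D1_nonneg n p B
    have he0 := HDBootstrap.D2_nonneg n p B q hα
    rcases le_total 1 (HDBootstrap.D2 n p B q α) with hd | hd
    · exact HDBootstrap.one_sub_le_measureReal_of_forall hα.le fun ω =>
        (HDBootstrap.rhoEB_le_one hn0 _).trans (one_le_mul_of_one_le_of_one_le
          (one_le_mul_of_one_le_of_one_le hC₁ h8) (by linarith))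
    have h8n : 1 ≤ 8 * n / α := by
      rw [one_le_div hα]
      have : (4 : ℝ) ≤ n := by exact_mod_cast hn
      linarith
    -- This truncation level solves `(M / B) ^ q = 8 * n / α`; the `8 ^ (1 / q)` in it is the extra
    -- factor in the constant.
    have hM : 1 ≤ B * (8 * n / α) ^ (1 / q) :=
      one_le_mul_of_one_le_of_one_le hB (Real.one_le_rpow h8n (by positivity))
    refine (HDBootstrap.bootstrap_of_tail_le χ hχ hn hp hB hα hα1' hK hb hM hX hY h1 h2
      (HDBootstrap.sum_tail_le_of_condE2 hn (by linarith) hα hq hE (by linarith) ?_)).trans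
      (measureReal_mono fun ω hω => ?_)
    · rw [mul_div_cancel_left₀ _ (by linarith), one_div, Real.rpow_inv_rpow (by linarith) hq.ne']
    · refine (show HDBootstrap.rhoEB _ _ _ _ ≤ _ from hω).trans ?_
      rw [← hC₀, mul_assoc C₀]
      have := HDBootstrap.sqrt_tail_term_condE2_le hn hp hB hα hd
      gcongr
      nlinarith
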